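/- Let $\mathbb K=\mathbb R$ or $\mathbb C$, and let $M$ be a smooth real (respectively complex) manifold of dimension $2n$ over $\mathbb K$; "smooth" means $C^\infty$ if $\mathbb K=\mathbb R$ and holomorphic if $\mathbb K=\mathbb C$. Let $P,P':T^*M\to TM$ be Poisson tensors, with brackets $\{f,g\}=\langle df,P\,dg\rangle$ and $\{f,g\}'=\langle df,P'dg\rangle$ on (locally defined) smooth functions, such that $P'-cP$ is a Poisson tensor for every $c\in\mathbb K$. Suppose that $(M,P,P')$ is *regular*: $P_m$ is invertible for every $m\in M$, and the set of regular points is dense in $M$, where $m$ is called regular if the operator $N_m=P'_mP_m^{-1}$ on $T_mM$ has $n$ pairwise distinct eigenvalues in $\mathbb K$ (the maximal possible number). *Darboux–Nijenhuis (DN) coordinates* on an open set $U\subseteq M$ are smooth coordinates $(x_1,\dots,x_n,y_1,\dots,y_n)$ on $U$ with $\{x_i,y_j\}=\delta_{ij}$, $\{x_i,x_j\}=\{y_i,y_j\}=0$ and $N=\sum_i\lambda_i\big(\frac{\partial}{\partial x_i}\otimes dx_i+\frac{\partial}{\partial y_i}\otimes dy_i\big)$, where $\lambda_1,\dots,\lambda_n$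 are pairwise distinct at every point of $U$. Let $H_1,\dots,H_n:M\to\mathbb K$ be an integrable system: smooth functions with $\{H_i,H_j\}=0$ for all $i,j$ and $dH_1\wedge\dots\wedge dH_n\neq0$ at every point. The system is called *separable* in the coordinates $(x,y)$ on $U$ if near every point $m\in U$ there are $n$ non-trivial relations $\Phi_i(x_i,y_i;H_1,\dots,H_n)=0$, $i=1,\dots,n$, where each $\Phi_i$ is a smooth function with nowhere vanishing differential on a neighbourhood of $(x_i(m),y_i(m),H_1(m),\dots,H_n(m))$ in $\mathbb K^{n+2}$. **Theorem.** The following are equivalent: (a) $\{H_i,H_j\}'=0$ on $M$ for all $i,j=1,\dots,n$; (b) every regular point of $M$ lies in the domain of some DN coordinates in which $H_1,\dots,H_n$ are separable; (c) $H_1,\dots,H_n$ are separable in all DN coordinates on open subsets of $M$; (d) the foliation of $M$ by the common level sets of $H_1,\dots,H_n$ is bilagrangian: at every regular point $m$, the tangent space $D=\bigcap_i\ker dH_i(m)$ of the leaf is Lagrangian with respect to both $P$ and $P'$, i.e. $P_m(D^\circ)=D\cap\operatorname{Im}P_m$ and $P'_m(D^\circ)=D\cap\operatorname{Im}P'_m$,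 where $D^\circ\subseteq T_m^*M$ is the annihilator of $D$. -/

import Mathlib

open scoped Manifold ContDiff Topology

noncomputable section

section Poisson

variable {𝕜 : Type*} [RCLike 𝕜] {E : Type*} [NormedAddCommGroup E] [NormedSpace 𝕜 E]
  {M : Type*} [TopologicalSpace M] [ChartedSpace E M]

/-- The differential `d f (m) ∈ T*_m M` of a scalar function. -/
def dAt (f : M → 𝕜) (m : M) : TangentSpace 𝓘(𝕜, E) m →L[𝕜] 𝕜 :=
  mfderiv 𝓘(𝕜, E) 𝓘(𝕜, 𝕜) f m

variable (𝕜 E M) in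
/-- Fields of linear maps `T*_m M → T_m M`, `m ∈ M`. -/
abbrev BivectorField : Type _ :=
  ∀ m : M, (TangentSpace 𝓘(𝕜, E) m →L[𝕜] 𝕜) →ₗ[𝕜] TangentSpace 𝓘(𝕜, E) m

/-- The bracket `{f, g} = ⟨df, P dg⟩`. -/
def bracket (P : BivectorField 𝕜 E M) (f g : M → 𝕜) (m : M) : 𝕜 :=
  dAt (E := E) f m (P m (dAt g m))

/-- `P` is a Poisson tensor: it is skew-symmetric, it varies smoothly with the point (brackets
of smooth functions are smooth; in a chart these include the coefficients `P^{ij} = {x^i, x^j}`),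
and its bracket satisfies the Jacobi identity. Functions are allowed to be defined on open subsets
only, so that the notion is the correct one also for complex manifolds, where smooth over `ℂ`
means holomorphic. The Leibniz rule holds automatically. -/
structure IsPoissonTensor (P : BivectorField 𝕜 E M) : Prop where
  skew : ∀ (m : M) (α β : TangentSpace 𝓘(𝕜, E) m →L[𝕜] 𝕜), α (P m β) = -β (P m α)
  smooth : ∀ (U : Set M) (f g : M → 𝕜), IsOpen U →
    ContMDiffOn 𝓘(𝕜, E) 𝓘(𝕜, 𝕜) ∞ f U → ContMDiffOn 𝓘(𝕜, E) 𝓘(𝕜, 𝕜) ∞ g U →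
    ContMDiffOn 𝓘(𝕜, E) 𝓘(𝕜, 𝕜) ∞ (bracket P f g) U
  jacobi : ∀ (U : Set M) (f g h : M → 𝕜), IsOpen U →
    ContMDiffOn 𝓘(𝕜, E) 𝓘(𝕜, 𝕜) ∞ f U → ContMDiffOn 𝓘(𝕜, E) 𝓘(𝕜, 𝕜) ∞ g U →
    ContMDiffOn 𝓘(𝕜, E) 𝓘(𝕜, 𝕜) ∞ h U → ∀ m ∈ U,
    bracket P f (bracket P g h) m + bracket P g (bracket P h f) m
      + bracket P h (bracket P f g) m = 0

/-- Bihamiltonian structure: `P` and all the members `P' - c P` of the pencil (in particular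
`P'`) are Poisson tensors. -/
structure IsBihamiltonian (P P' : BivectorField 𝕜 E M) : Prop where
  poisson : IsPoissonTensor P
  pencil : ∀ c : 𝕜, IsPoissonTensor (fun m => P' m - c • P m)

open Classical in
/-- The Nijenhuis operator `N = P' P⁻¹ : T_m M → T_m M` (zero by convention where `P` is not
invertible; on regular bihamiltonian manifolds `P` is invertible everywhere). -/
def nijenhuis (P P' : BivectorField 𝕜 E M) (m : M) :
    TangentSpace 𝓘(𝕜, E) m →ₗ[𝕜] TangentSpace 𝓘(𝕜, E) m :=
  if h : Function.Bijective (P m) then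
    P' m ∘ₗ ((LinearEquiv.ofBijective (P m) h).symm : TangentSpace 𝓘(𝕜, E) m →ₗ[𝕜] _)
  else 0

/-- `m` is a regular point: at `m` the operator `N` has `n` pairwise distinct eigenvalues in the
ground field. Here `n` is half of the dimension, the maximal number possible. -/
def IsRegularPoint (n : ℕ) (P P' : BivectorField 𝕜 E M) (m : M) : Prop :=
  ∃ l : Fin n → 𝕜, Function.Injective l ∧
    ∀ i, Module.End.HasEigenvalue (nijenhuis P P' m) (l i)

/-- Regular bihamiltonian structure on a manifold of dimension `2 n`: the tensor `P` is everywhere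
invertible, and the eigenvalues of `N = P' P⁻¹` are maximally distinct at generic points. -/
structure IsRegularBihamiltonian (n : ℕ) (P P' : BivectorField 𝕜 E M) : Prop where
  finrank_eq : Module.finrank 𝕜 E = 2 * n
  bihamiltonian : IsBihamiltonian P P'
  invertible : ∀ m, Function.Bijective (P m)
  regular : Dense {m | IsRegularPoint n P P' m}

/-- Integrable system: `n` smooth functions that are in involution with respect to `P` and have
linearly independent differentials, `dH₁ ∧ ⋯ ∧ dHₙ ≠ 0`. -/
structure IsIntegrableSystem {n : ℕ} (P : BivectorField 𝕜 E M) (H : Fin n → M → 𝕜) : Prop where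
  smooth : ∀ i, ContMDiff 𝓘(𝕜, E) 𝓘(𝕜, 𝕜) ∞ (H i)
  involution : ∀ i j m, bracket P (H i) (H j) m = 0
  independent : ∀ m, LinearIndependent 𝕜 (fun i => dAt (E := E) (H i) m)

/-- The `i`-th coordinate function `x_i` of a chart with values in `𝕜ⁿ × 𝕜ⁿ`. -/
def xCoord {n : ℕ} (φ : OpenPartialHomeomorph M ((Fin n → 𝕜) × (Fin n → 𝕜))) (i : Fin n)
    (m : M) : 𝕜 := (φ m).1 i

/-- The `i`-th coordinate function `y_i` of a chart with values in `𝕜ⁿ × 𝕜ⁿ`. -/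
def yCoord {n : ℕ} (φ : OpenPartialHomeomorph M ((Fin n → 𝕜) × (Fin n → 𝕜))) (i : Fin n)
    (m : M) : 𝕜 := (φ m).2 i

/-- `φ = (x, y)` is a system of Darboux-Nijenhuis coordinates on the open set `φ.source`: it is a
smooth chart, it is canonical for the bracket of `P`, and `N` is diagonal in it,
`N = ∑ λ_i (∂/∂x_i ⊗ dx_i + ∂/∂y_i ⊗ dy_i)`, that is, `dx_i (N v) = λ_i dx_i (v)` and
`dy_i (N v) = λ_i dy_i (v)`, with `λ_i ≠ λ_j` for `i ≠ j`. -/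
structure IsDNChart {n : ℕ} (P P' : BivectorField 𝕜 E M)
    (φ : OpenPartialHomeomorph M ((Fin n → 𝕜) × (Fin n → 𝕜))) : Prop where
  smooth : ContMDiffOn 𝓘(𝕜, E) 𝓘(𝕜, (Fin n → 𝕜) × (Fin n → 𝕜)) ∞ φ φ.source
  smooth_symm : ContMDiffOn 𝓘(𝕜, (Fin n → 𝕜) × (Fin n → 𝕜)) 𝓘(𝕜, E) ∞ φ.symm φ.target
  darboux_xy : ∀ m ∈ φ.source, ∀ i j,
    bracket P (xCoord φ i) (yCoord φ j) m = if i = j then 1 else 0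
  darboux_xx : ∀ m ∈ φ.source, ∀ i j, bracket P (xCoord φ i) (xCoord φ j) m = 0
  darboux_yy : ∀ m ∈ φ.source, ∀ i j, bracket P (yCoord φ i) (yCoord φ j) m = 0
  diagonal : ∀ m ∈ φ.source, ∃ l : Fin n → 𝕜, Function.Injective l ∧
    ∀ i (v : TangentSpace 𝓘(𝕜, E) m),
      dAt (xCoord φ i) m (nijenhuis P P' m v) = l i * dAt (xCoord φ i) m v ∧
      dAt (yCoord φ i) m (nijenhuis P P' m v) = l i * dAt (yCoord φ i) m v

/-- The system `H` is separable in the coordinates `φ = (x, y)`: near every point of the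
coordinate domain there are separation relations `Φ_i (x_i, y_i; H_1, …, H_n) = 0`, `i = 1, …, n`,
each of them smooth and non-trivial (with non-vanishing differential). -/
def IsSeparableIn {n : ℕ} (φ : OpenPartialHomeomorph M ((Fin n → 𝕜) × (Fin n → 𝕜)))
    (H : Fin n → M → 𝕜) : Prop :=
  ∀ m ∈ φ.source, ∀ i : Fin n,
    ∃ (W : Set (𝕜 × 𝕜 × (Fin n → 𝕜))) (Φ : 𝕜 × 𝕜 × (Fin n → 𝕜) → 𝕜),
      IsOpen W ∧ (xCoord φ i m, yCoord φ i m, fun j => H j m) ∈ W ∧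
      ContDiffOn 𝕜 ∞ Φ W ∧ (∀ z ∈ W, fderiv 𝕜 Φ z ≠ 0) ∧
      ∀ᶠ m' in 𝓝 m, Φ (xCoord φ i m', yCoord φ i m', fun j => H j m') = 0

/-- The tangent space at `m` of the leaf through `m` of the foliation `H_1 = const, …,
H_n = const`. -/
def leafTangent {n : ℕ} (H : Fin n → M → 𝕜) (m : M) : Submodule 𝕜 (TangentSpace 𝓘(𝕜, E) m) :=
  ⨅ i, LinearMap.ker (dAt (E := E) (H i) m : TangentSpace 𝓘(𝕜, E) m →ₗ[𝕜] 𝕜)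

/-- The annihilator `D° ⊆ T*_m M` of a subspace `D ⊆ T_m M`. -/
def annihilator {m : M} (D : Submodule 𝕜 (TangentSpace 𝓘(𝕜, E) m)) :
    Submodule 𝕜 (TangentSpace 𝓘(𝕜, E) m →L[𝕜] 𝕜) where
  carrier := {α | ∀ v ∈ D, α v = 0}
  add_mem' := by
    intro a b ha hb v hv
    simp [ha v hv, hb v hv]
  zero_mem' := by
    intro v _
    simp
  smul_mem' := by
    intro c a ha v hv
    simp [ha v hv]

/-- A subspace `D ⊆ T_m M` is Lagrangian with respect to the (possibly degenerate) Poisson tensor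
`P`: it satisfies `P (D°) = D ∩ Im P`. For invertible `P` this is `P (D°) = D`, i.e. `D` is
Lagrangian for the symplectic form of `P`. -/
def IsLagrangianSubspace (P : BivectorField 𝕜 E M) {m : M}
    (D : Submodule 𝕜 (TangentSpace 𝓘(𝕜, E) m)) : Prop :=
  (annihilator D).map (P m) = D ⊓ LinearMap.range (P m)

/-- The foliation by the common level sets of `H_1, …, H_n` is bilagrangian: at the regular points
the tangent spaces of its leaves are Lagrangian both for `P` and for `P'`. -/
def IsBilagrangian {n : ℕ} (P P' : BivectorField 𝕜 E M) (H : Fin n → M → 𝕜) : Prop :=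
  ∀ m, IsRegularPoint n P P' m →
    IsLagrangianSubspace P (leafTangent (E := E) H m) ∧
    IsLagrangianSubspace P' (leafTangent (E := E) H m)

end Poisson

end

noncomputable section

/-! Pointwise core. At a regular point `P` and `P'` are two skew forms on covectors, and the
transpose of `N` (the recursion operator) splits the cotangent space into n eigenplanes that are
orthogonal for both forms. Let S be the span of the `dH_i`; it is Lagrangian for `P`. All `{H_i,
H_j}'` vanish exactly when S is invariant under the recursion operator. An invariant S is the sum of
its intersections with the eigenplanes, and maximal isotropy forces it to meet each of them
(`IsFrame.exists_combination_mem_span`). Conversely, n nonzero vectors of S, one in each eigenplane,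
already span S, and such a span is isotropic for both forms
(`IsFrame.isotropic_of_combination_mem_span`).

Separation. In DN coordinates the i-th eigenplane is spanned by `dx_i` and `dy_i`, so S meeting it
is the infinitesimal form of a separation relation. Differentiating a relation gives such a covector
(`HasRelationAt.exists_combination`). Conversely, one of the two coordinates, say `x_i`, fails to
commute with some `H_j`; then `(x_i, H_1, …, H_n)` is a submersion and `y_i` is locally a function
of it (`IsEigenSystem.hasRelationAt`). The bilagrangian property rests on the same linear algebra
(`isotropic_iff_lagrangian`), where only the kernel of a degenerate `P'` needs care. Involution at
regular points spreads to all of M by density.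

Existence of DN coordinates around regular points. A hyperbolic pair of eigencovectors extends to
smooth eigenfields Θ, Θ' with a common eigenvalue λ (`exists_eigenfield_pair`). The Jacobi identity
of `P' - c P`, with c frozen at λ(z), shows that dλ vanishes on the image of `P' - λ P` and that
this image, the common kernel of Θ and Θ', is involutive. Frobenius yields two first integrals; the
Jacobi identity of `P` makes their bracket a function of these two alone, and a quadrature
normalizes it to 1. Frobenius is obtained over ℝ and ℂ at once by solving total differential
equations along real rays, with the inverse function theorem in the Banach space of continuous
curves. -/

namespace BihamDN

/-! ### Smoothness of superposition operators on spaces of continuous maps. -/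

section Superposition

universe u

variable {𝕜 : Type*} [RCLike 𝕜] {K : Type*} [TopologicalSpace K]

open Classical in
/-- The superposition operator `u ↦ f ∘ u` (zero where `f ∘ u` is not continuous). -/
def superpose {X Y : Type*} [TopologicalSpace X] [TopologicalSpace Y] [Zero Y] (f : X → Y)
    (u : C(K, X)) : C(K, Y) :=
  if h : Continuous (f ∘ u) then ⟨f ∘ u, h⟩ else 0

lemma superpose_apply {X Y : Type*} [TopologicalSpace X] [TopologicalSpace Y] [Zero Y] {f : X → Y}
    {U : Set X} (hf : ContinuousOn f U) {u : C(K, X)} (hu : ∀ k, u k ∈ U) (k : K) :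
    superpose f u k = f (u k) := by
  have h : Continuous (f ∘ u) := hf.comp_continuous u.continuous hu
  simp [superpose, h]

variable [CompactSpace K]

/-- Pointwise application of a continuous family of operators to a continuous family of
vectors. -/
def applyCLM (K : Type*) [TopologicalSpace K] [CompactSpace K] (X Y : Type*)
    [NormedAddCommGroup X] [NormedSpace 𝕜 X] [NormedAddCommGroup Y] [NormedSpace 𝕜 Y] :
    C(K, X →L[𝕜] Y) →L[𝕜] C(K, X) →L[𝕜] C(K, Y) :=
  LinearMap.mkContinuous₂
    (LinearMap.mk₂ 𝕜 (fun (T : C(K, X →L[𝕜] Y)) (v : C(K, X)) => (⟨fun k => T k (v k), T.continuous.clm_apply v.continuous⟩ : C(K, Y)))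
      (fun _ _ _ => by ext; simp) (fun _ _ _ => by ext; simp)
      (fun _ _ _ => by ext; simp) (fun _ _ _ => by ext; simp)) 1
    (fun T v => by
      rw [one_mul]
      refine (ContinuousMap.norm_le _ (by positivity)).2 fun k => ?_
      exact ((T k).le_opNorm (v k)).trans
        (mul_le_mul (T.norm_coe_le_norm k) (v.norm_coe_le_norm k) (norm_nonneg _) (norm_nonneg T)))

@[simp] lemma applyCLM_apply {X Y : Type*} [NormedAddCommGroup X] [NormedSpace 𝕜 X]
    [NormedAddCommGroup Y] [NormedSpace 𝕜 Y] (T : C(K, X →L[𝕜] Y)) (v : C(K, X)) (k : K) :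
    applyCLM K X Y T v k = T k (v k) := rfl

lemma isOpen_setOf_forall_mem {X : Type*} [TopologicalSpace X] {U : Set X} (hU : IsOpen U) :
    IsOpen {u : C(K, X) | ∀ k, u k ∈ U} := by
  have := ContinuousMap.isOpen_setOfPred_mapsTo (isCompact_univ (X := K)) hU
  simpa [Set.MapsTo] using this

/-- Compactness of `K` makes the first-order expansion of `f` at the points `u k` uniform in `k`,
which is differentiability in the sup norm. Strict differentiability allows the base point to move
while `k` varies near a given one. -/
lemma hasFDerivAt_superpose {X Y : Type*} [NormedAddCommGroup X] [NormedSpace 𝕜 X]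
    [NormedAddCommGroup Y] [NormedSpace 𝕜 Y] {f : X → Y} {U : Set X} (hU : IsOpen U)
    (hf : ContDiffOn 𝕜 ∞ f U) {u : C(K, X)} (hu : ∀ k, u k ∈ U) :
    HasFDerivAt (superpose f) (applyCLM K X Y (superpose (fderiv 𝕜 f) u)) u := by
  have hf' : ContinuousOn (fderiv 𝕜 f) U := hf.continuousOn_fderiv_of_isOpen hU (by simp)
  have hfc := hf.continuousOn
  rw [hasFDerivAt_iff_isLittleO_nhds_zero, Asymptotics.isLittleO_iff]
  intro ε hε
  have key : ∀ᶠ v : X in 𝓝 0, ∀ k ∈ (Set.univ : Set K),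
      ‖f (u k + v) - f (u k) - fderiv 𝕜 f (u k) v‖ ≤ ε * ‖v‖ := by
    refine isCompact_univ.eventually_forall_of_forall_eventually fun k _ => ?_
    have h1 : HasStrictFDerivAt f (fderiv 𝕜 f (u k)) (u k) :=
      (hf.contDiffAt (hU.mem_nhds (hu k))).hasStrictFDerivAt (by simp)
    have h2 := Asymptotics.isLittleO_iff.1 h1.isLittleO (half_pos hε)
    have t1 : Filter.Tendsto (fun z : X × K => (u z.2 + z.1, u z.2)) (𝓝 (0, k))
        (𝓝 (u k, u k)) := by
      have : Continuous (fun z : X × K => (u z.2 + z.1, u z.2)) := by fun_prop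
      simpa using this.tendsto (0, k)
    have t2 : Filter.Tendsto (fun z : X × K => fderiv 𝕜 f (u z.2)) (𝓝 (0, k))
        (𝓝 (fderiv 𝕜 f (u k))) :=
      ((hf'.comp_continuous u.continuous hu).comp continuous_snd).tendsto (0, k)
    have h3 : ∀ᶠ z : X × K in 𝓝 (0, k),
        ‖fderiv 𝕜 f (u z.2) - fderiv 𝕜 f (u k)‖ < ε / 2 := by
      have := t2.eventually (Metric.ball_mem_nhds _ (half_pos hε))
      simpa [dist_eq_norm] using this
    filter_upwards [t1.eventually h2, h3] with z h2 h3
    simp only [add_sub_cancel_left] at h2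
    calc ‖f (u z.2 + z.1) - f (u z.2) - fderiv 𝕜 f (u z.2) z.1‖
        = ‖(f (u z.2 + z.1) - f (u z.2) - fderiv 𝕜 f (u k) z.1)
          - (fderiv 𝕜 f (u z.2) - fderiv 𝕜 f (u k)) z.1‖ := by
          congr 1; simp
      _ ≤ ε / 2 * ‖z.1‖ + ε / 2 * ‖z.1‖ := by
          refine (norm_sub_le _ _).trans (add_le_add h2 ?_)
          exact ((ContinuousLinearMap.le_opNorm _ _).trans
            (mul_le_mul_of_nonneg_right h3.le (norm_nonneg _)))
      _ = ε * ‖z.1‖ := by ring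
  obtain ⟨δ, hδ, hball⟩ := Metric.eventually_nhds_iff_ball.1 key
  have hopen := (isOpen_setOf_forall_mem (K := K) hU).mem_nhds hu
  have hadd : Filter.Tendsto (fun v : C(K, X) => u + v) (𝓝 0) (𝓝 u) := by
    have : Continuous (fun v : C(K, X) => u + v) := by fun_prop
    simpa using this.tendsto 0
  filter_upwards [Metric.ball_mem_nhds (0 : C(K, X)) hδ, hadd.eventually hopen] with v hv hv'
  refine (ContinuousMap.norm_le _ (by positivity)).2 fun k => ?_
  have hvk : ‖v k‖ < δ := (v.norm_coe_le_norm k).trans_lt (by simpa using hv)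
  have h := hball (v k) (by simpa using hvk) k trivial
  simp only [ContinuousMap.sub_apply, applyCLM_apply]
  rw [superpose_apply hfc hv', superpose_apply hfc hu, superpose_apply hf' hu]
  exact h.trans (mul_le_mul_of_nonneg_left (v.norm_coe_le_norm k) hε.le)

/-- The superposition operator of a smooth map is smooth. -/
theorem contDiffOn_superpose {X Y : Type u} [NormedAddCommGroup X] [NormedSpace 𝕜 X]
    [NormedAddCommGroup Y] [NormedSpace 𝕜 Y] {f : X → Y} {U : Set X} (hU : IsOpen U)
    (hf : ContDiffOn 𝕜 ∞ f U) :
    ContDiffOn 𝕜 ∞ (superpose (K := K) f) {u | ∀ k, u k ∈ U} := by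
  rw [contDiffOn_infty]
  intro n
  -- The derivative of superposition by `f` is superposition by `fderiv 𝕜 f` followed by the bounded
  -- operator `applyCLM`, so one order of smoothness is gained by passing to the target `X →L[𝕜] Y`.
  -- A common universe for `X` and `Y` keeps this target admissible.
  induction n generalizing Y with
  | zero =>
    exact contDiffOn_zero.2 fun u hu =>
      (hasFDerivAt_superpose hU hf hu).continuousAt.continuousWithinAt
  | succ n ih =>
    have hd := fun (u : C(K, X)) (hu : ∀ k : K, u k ∈ U) => hasFDerivAt_superpose hU hf hu
    push_cast
    rw [contDiffOn_succ_iff_fderiv_of_isOpen (isOpen_setOf_forall_mem hU)]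
    refine ⟨fun u hu => (hd u hu).differentiableAt.differentiableWithinAt, by simp, ?_⟩
    have h1 := ih (hf.fderiv_of_isOpen hU (m := ∞) (by simp))
    refine (((applyCLM K X Y).contDiff.comp_contDiffOn h1).congr fun u hu => ?_)
    exact (hd u hu).fderiv

end Superposition

/-! ### Inverse function theorem with a smooth inverse. -/

section Inverse

variable {𝕜 : Type*} [RCLike 𝕜] {X Y : Type*} [NormedAddCommGroup X] [NormedSpace 𝕜 X]
  [CompleteSpace X] [NormedAddCommGroup Y] [NormedSpace 𝕜 Y]

/-- Inverse function theorem for smooth maps, with a smooth inverse on the whole target. -/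
theorem exists_openPartialHomeomorph {f : X → Y} {U : Set X} (hU : IsOpen U)
    (hf : ContDiffOn 𝕜 ∞ f U) {a : X} (ha : a ∈ U) (e : X ≃L[𝕜] Y)
    (he : HasFDerivAt f (e : X →L[𝕜] Y) a) :
    ∃ φ : OpenPartialHomeomorph X Y, a ∈ φ.source ∧ φ.source ⊆ U ∧ (∀ x, φ x = f x) ∧
      ContDiffOn 𝕜 ∞ φ.symm φ.target := by
  have hfa := hf.contDiffAt (hU.mem_nhds ha)
  let φ₀ := hfa.toOpenPartialHomeomorph f he (by simp)
  have hcont : ContinuousOn (fderiv 𝕜 f) U := hf.continuousOn_fderiv_of_isOpen hU (by simp)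
  -- Shrinking to points where the derivative remains invertible makes the inverse smooth at every
  -- point of the target, not only at `f a`.
  have hV : IsOpen (U ∩ fderiv 𝕜 f ⁻¹' interior (Set.range ((↑) : (X ≃L[𝕜] Y) → X →L[𝕜] Y))) :=
    hcont.isOpen_inter_preimage hU isOpen_interior
  have haV : a ∈ U ∩ fderiv 𝕜 f ⁻¹' interior (Set.range ((↑) : (X ≃L[𝕜] Y) → X →L[𝕜] Y)) := by
    refine ⟨ha, ?_⟩
    rw [Set.mem_preimage, he.fderiv]
    exact mem_interior_iff_mem_nhds.2 e.nhds
  let φ := φ₀.restrOpen _ hV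
  have hs : φ.source = φ₀.source ∩ (U ∩ fderiv 𝕜 f ⁻¹' interior _) := φ₀.restrOpen_source _ hV
  have hφ : ∀ x, φ x = f x := fun x => rfl
  refine ⟨φ, ?_, ?_, hφ, ?_⟩
  · rw [hs]
    exact ⟨hfa.mem_toOpenPartialHomeomorph_source he (by simp), haV⟩
  · rw [hs]
    exact fun x hx => hx.2.1
  · intro y hy
    have hx : φ.symm y ∈ φ.source := φ.map_target hy
    rw [hs] at hx
    obtain ⟨e', he'⟩ := interior_subset hx.2.2
    have hd := hf.contDiffAt (hU.mem_nhds hx.2.1)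
    have hd' : HasFDerivAt f (e' : X →L[𝕜] Y) (φ.symm y) := by
      rw [he']
      exact (hd.differentiableAt (by simp)).hasFDerivAt
    exact (φ.contDiffAt_symm hy hd' hd).contDiffWithinAt

end Inverse

/-! ### Total differential equations along rays: solutions and their parameters. -/

section TotalDifferential

variable {𝕜 : Type*} [RCLike 𝕜] {A B : Type*}
  [NormedAddCommGroup A] [NormedSpace 𝕜 A] [NormedAddCommGroup B] [NormedSpace 𝕜 B]

variable (𝕜 A) in
/-- The segments `s ↦ s • a`, `s ∈ [0, 1]`. -/
def segmentCLM : A →L[𝕜] C(unitInterval, A) :=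
  LinearMap.mkContinuous
    { toFun := fun a => ⟨fun s => ((s : ℝ) : 𝕜) • a,
        (RCLike.continuous_ofReal.comp continuous_subtype_val).smul continuous_const⟩
      map_add' := fun a b => by ext; simp
      map_smul' := fun c a => by ext; exact smul_comm _ _ _ } 1
    (fun a => by
      refine (ContinuousMap.norm_le _ (by positivity)).2 fun s => ?_
      simp only [LinearMap.coe_mk, AddHom.coe_mk, ContinuousMap.coe_mk, norm_smul, one_mul,
        RCLike.norm_ofReal, abs_of_nonneg s.2.1]
      exact mul_le_of_le_one_left (norm_nonneg _) s.2.2)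

@[simp] lemma segmentCLM_apply (a : A) (s : unitInterval) :
    segmentCLM 𝕜 A a s = ((s : ℝ) : 𝕜) • a := rfl

variable (𝕜 A) in
/-- Constant curves. -/
def constCLM : A →L[𝕜] C(unitInterval, A) :=
  LinearMap.mkContinuous
    { toFun := fun a => ContinuousMap.const _ a
      map_add' := fun a b => by ext; simp
      map_smul' := fun c a => by ext; simp } 1
    (fun a => by
      refine (ContinuousMap.norm_le _ (by positivity)).2 fun s => ?_
      simp)

@[simp] lemma constCLM_apply (a : A) (s : unitInterval) : constCLM 𝕜 A a s = a := rfl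

variable (𝕜 A B) in
/-- The curve `s ↦ (s • a, u s)`. -/
def graphCLM : (A × B) × C(unitInterval, B) →L[𝕜] C(unitInterval, A × B) :=
  ((ContinuousLinearMap.inl 𝕜 A B).compLeftContinuous 𝕜 unitInterval) ∘L (segmentCLM 𝕜 A) ∘L
      (ContinuousLinearMap.fst 𝕜 A B) ∘L (ContinuousLinearMap.fst 𝕜 _ _) +
    ((ContinuousLinearMap.inr 𝕜 A B).compLeftContinuous 𝕜 unitInterval) ∘L
      (ContinuousLinearMap.snd 𝕜 _ _)

@[simp] lemma graphCLM_apply (z : (A × B) × C(unitInterval, B)) (s : unitInterval) :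
    graphCLM 𝕜 A B z s = (((s : ℝ) : 𝕜) • z.1.1, z.2 s) := by
  simp [graphCLM]

variable [NormedSpace ℝ B]

/-- The primitive vanishing at `0` of a continuous curve on `[0, 1]`, extended constantly. -/
def primitive (w : C(unitInterval, B)) (t : ℝ) : B :=
  ∫ s in (0 : ℝ)..t, Set.IccExtend zero_le_one w s

lemma hasDerivAt_primitive [CompleteSpace B] (w : C(unitInterval, B)) (t : ℝ) :
    HasDerivAt (primitive w) (Set.IccExtend zero_le_one w t) t := by
  have hc : Continuous (Set.IccExtend (zero_le_one' ℝ) w) := w.continuous.Icc_extend'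
  exact intervalIntegral.integral_hasDerivAt_right (hc.intervalIntegrable _ _)
    (hc.stronglyMeasurableAtFilter _ _) hc.continuousAt

variable [IsScalarTower ℝ 𝕜 B] [CompleteSpace B]

variable (𝕜 B) in
/-- The primitive as an operator on continuous curves on `[0, 1]`. -/
def primitiveCLM : C(unitInterval, B) →L[𝕜] C(unitInterval, B) :=
  LinearMap.mkContinuous
    { toFun := fun w => ⟨fun t => primitive w t, by
        have : Continuous (primitive w) :=
          continuous_iff_continuousAt.2 fun t => (hasDerivAt_primitive w t).continuousAt
        exact this.comp continuous_subtype_val⟩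
      map_add' := fun v w => by
        ext t
        have hv : Continuous (Set.IccExtend (zero_le_one' ℝ) v) := v.continuous.Icc_extend'
        have hw : Continuous (Set.IccExtend (zero_le_one' ℝ) w) := w.continuous.Icc_extend'
        exact intervalIntegral.integral_add (hv.intervalIntegrable _ _) (hw.intervalIntegrable _ _)
      map_smul' := fun c w => by
        ext t
        exact intervalIntegral.integral_smul c _ } 1
    (fun w => by
      refine (ContinuousMap.norm_le _ (by positivity)).2 fun t => ?_
      refine (intervalIntegral.norm_integral_le_of_norm_le_const (C := ‖w‖) fun s _ => ?_).trans ?_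
      · exact w.norm_coe_le_norm _
      · rw [sub_zero, abs_of_nonneg t.2.1, one_mul]
        exact mul_le_of_le_one_right (norm_nonneg _) t.2.2)

@[simp] lemma primitiveCLM_apply (w : C(unitInterval, B)) (t : unitInterval) :
    primitiveCLM 𝕜 B w t = primitive w t := rfl

/-- The solutions of the ordinary differential equation `u'(s) = F (s a, u(s)) a`, `u(0) = b`,
depend smoothly on the parameters `(a, b)`, `a` near `0`. -/
theorem exists_radial_solution [CompleteSpace A] {F : A × B → A →L[𝕜] B} {U : Set (A × B)}
    (hU : IsOpen U) (hF : ContDiffOn 𝕜 ∞ F U) {b₀ : B} (hb₀ : ((0 : A), b₀) ∈ U) :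
    ∃ (V : Set (A × B)) (Γ : A × B → C(unitInterval, B)), IsOpen V ∧ (0, b₀) ∈ V ∧
      ContDiffOn 𝕜 ∞ Γ V ∧
      ∀ p ∈ V, (∀ s : unitInterval, (((s : ℝ) : 𝕜) • p.1, Γ p s) ∈ U) ∧
        Γ p = constCLM 𝕜 B p.2 + primitiveCLM 𝕜 B
          (applyCLM unitInterval A B (superpose F (graphCLM 𝕜 A B (p, Γ p)))
            (constCLM 𝕜 A p.1)) := by
  let W : (A × B) × C(unitInterval, B) → C(unitInterval, B) := fun z =>
    applyCLM unitInterval A B (superpose F (graphCLM 𝕜 A B z)) (constCLM 𝕜 A z.1.1)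
  let 𝒰 : Set ((A × B) × C(unitInterval, B)) := {z | ∀ s, graphCLM 𝕜 A B z s ∈ U}
  have h𝒰 : IsOpen 𝒰 := (isOpen_setOf_forall_mem hU).preimage (graphCLM 𝕜 A B).continuous
  have hN : ContDiffOn 𝕜 ∞ (fun z => superpose F (graphCLM 𝕜 A B z)) 𝒰 :=
    (contDiffOn_superpose hU hF).comp (graphCLM 𝕜 A B).contDiff.contDiffOn fun z hz => hz
  have hc : ContDiff 𝕜 ∞ (fun z : (A × B) × C(unitInterval, B) => constCLM 𝕜 A z.1.1) :=
    (constCLM 𝕜 A).contDiff.comp (contDiff_fst.comp contDiff_fst)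
  have hA : ContDiff 𝕜 ∞ (applyCLM (𝕜 := 𝕜) unitInterval A B) :=
    ContinuousLinearMap.contDiff _
  have hAN : ContDiffOn 𝕜 ∞
      (fun z => applyCLM unitInterval A B (superpose F (graphCLM 𝕜 A B z))) 𝒰 :=
    hA.comp_contDiffOn hN
  have hW : ContDiffOn 𝕜 ∞ W 𝒰 :=
    hAN.clm_apply hc.contDiffOn
  -- The integral equation for the curve `u` with data `(a, b)` reads `Ψ ((a, b), u) = ((a, b), 0)`.
  -- At `a = 0` the constant curve solves it.
  let Ψ : (A × B) × C(unitInterval, B) → (A × B) × C(unitInterval, B) := fun z =>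
    (z.1, z.2 - constCLM 𝕜 B z.1.2 - primitiveCLM 𝕜 B (W z))
  have hΨ : ContDiffOn 𝕜 ∞ Ψ 𝒰 := by
    refine contDiffOn_fst.prodMk ((contDiffOn_snd.sub ?_).sub ?_)
    · exact ((constCLM 𝕜 B).contDiff.comp (contDiff_snd.comp contDiff_fst)).contDiffOn
    · exact (primitiveCLM 𝕜 B).contDiff.comp_contDiffOn hW
  let z₀ : (A × B) × C(unitInterval, B) := ((0, b₀), constCLM 𝕜 B b₀)
  have hz₀ : z₀ ∈ 𝒰 := fun s => by simpa [z₀] using hb₀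
  let W' : A × B →L[𝕜] C(unitInterval, B) :=
    (applyCLM unitInterval A B (superpose F (graphCLM 𝕜 A B z₀))) ∘L (constCLM 𝕜 A) ∘L
      (ContinuousLinearMap.fst 𝕜 A B)
  let L : A × B →L[𝕜] C(unitInterval, B) :=
    -((constCLM 𝕜 B) ∘L (ContinuousLinearMap.snd 𝕜 A B)) - (primitiveCLM 𝕜 B) ∘L W'
  -- The integrand carries a factor `a`, which is zero at `z₀`; hence its derivative does not see
  -- the curve, and the derivative of `Ψ` is block triangular with identity blocks.
  have hWd : HasFDerivAt W (W' ∘L ContinuousLinearMap.fst 𝕜 _ _) z₀ := by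
    have h1 : HasFDerivAt (fun z => applyCLM unitInterval A B (superpose F (graphCLM 𝕜 A B z)))
        _ z₀ :=
      ((hAN.contDiffAt (h𝒰.mem_nhds hz₀)).differentiableAt (by simp)).hasFDerivAt
    have h2 : HasFDerivAt (fun z : (A × B) × C(unitInterval, B) => constCLM 𝕜 A z.1.1)
        (constCLM 𝕜 A ∘L (ContinuousLinearMap.fst 𝕜 A B) ∘L ContinuousLinearMap.fst 𝕜 _ _) z₀ :=
      (constCLM 𝕜 A).hasFDerivAt.comp z₀
        ((ContinuousLinearMap.fst 𝕜 A B).hasFDerivAt.comp z₀ hasFDerivAt_fst)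
    refine (h1.clm_apply h2).congr_fderiv ?_
    refine ContinuousLinearMap.ext fun z => ?_
    simp [W', z₀]
  let e : ((A × B) × C(unitInterval, B)) ≃L[𝕜] (A × B) × C(unitInterval, B) :=
    (ContinuousLinearEquiv.refl 𝕜 (A × B)).skewProd (ContinuousLinearEquiv.refl 𝕜 _) L
  have he : HasFDerivAt Ψ (e : _ →L[𝕜] _) z₀ := by
    have h1 := (hasFDerivAt_fst (𝕜 := 𝕜) (p := z₀)).prodMk
      (((hasFDerivAt_snd (𝕜 := 𝕜) (p := z₀)).sub
        ((constCLM 𝕜 B ∘L (ContinuousLinearMap.snd 𝕜 A B) ∘L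
          ContinuousLinearMap.fst 𝕜 _ _).hasFDerivAt)).sub
        ((primitiveCLM 𝕜 B).hasFDerivAt.comp z₀ hWd))
    refine h1.congr_fderiv ?_
    refine ContinuousLinearMap.ext fun z => ?_
    refine Prod.ext (by simp [e]) ?_
    simp [e, L, ContinuousLinearEquiv.skewProd_apply]
    abel
  obtain ⟨φ, hzφ, hφU, hφ, hφs⟩ := exists_openPartialHomeomorph h𝒰 hΨ hz₀ e he
  have hΨ₀ : Ψ z₀ = ((0, b₀), 0) := by
    simp [Ψ, W, z₀]
  have hι : Continuous (fun p : A × B => (p, (0 : C(unitInterval, B)))) := by fun_prop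
  refine ⟨{p | (p, (0 : C(unitInterval, B))) ∈ φ.target}, fun p => (φ.symm (p, 0)).2,
    φ.open_target.preimage hι, ?_, ?_, ?_⟩
  · have := φ.map_source hzφ
    rwa [hφ, hΨ₀] at this
  · exact contDiff_snd.comp_contDiffOn
      (hφs.comp (contDiff_id.prodMk contDiff_const).contDiffOn fun p hp => hp)
  · intro p hp
    have h1 : Ψ (φ.symm (p, 0)) = (p, 0) := by rw [← hφ, φ.right_inv hp]
    have h2 : (φ.symm (p, 0)).1 = p := congrArg Prod.fst h1
    have h3 := congrArg Prod.snd h1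
    have h4 := hφU (φ.map_target hp)
    have h5 : φ.symm (p, 0) = (p, (φ.symm (p, 0)).2) := Prod.ext h2 rfl
    refine ⟨fun s => ?_, ?_⟩
    · have := h4 s
      rwa [graphCLM_apply, h2] at this
    · simp only [Ψ, W] at h3
      rw [sub_sub, sub_eq_zero, h2, h5] at h3
      exact h3

end TotalDifferential

/-! ### Radial solutions solve the full equation when the curvature vanishes. -/

section TotalDifferential

variable {𝕜 : Type*} [RCLike 𝕜] {A B : Type*}
  [NormedAddCommGroup A] [NormedSpace 𝕜 A] [NormedAddCommGroup B] [NormedSpace 𝕜 B]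
  [CompleteSpace B]

/-- A family of radial solutions of a total differential equation `D_a u = F (a, u)` with vanishing
curvature solves the equation. -/
theorem hasFDerivAt_radial_solution [NormedSpace ℝ A] [IsScalarTower ℝ 𝕜 A]
    [NormedSpace ℝ B] [IsScalarTower ℝ 𝕜 B] {F : A × B → A →L[𝕜] B}
    {U : Set (A × B)} (hU : IsOpen U) (hF : ContDiffOn 𝕜 ∞ F U)
    (hcurv : ∀ p ∈ U, ∀ h k, fderiv 𝕜 F p (h, F p h) k = fderiv 𝕜 F p (k, F p k) h)
    {Γ : A → C(unitInterval, B)} {a : A} {b : B} (hΓ : DifferentiableAt 𝕜 Γ a)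
    (hsol : ∀ᶠ x in 𝓝 a, (∀ s : unitInterval, (((s : ℝ) : 𝕜) • x, Γ x s) ∈ U) ∧
        Γ x = constCLM 𝕜 B b + primitiveCLM 𝕜 B
          (applyCLM unitInterval A B (superpose F (graphCLM 𝕜 A B ((x, b), Γ x)))
            (constCLM 𝕜 A x))) :
    HasFDerivAt (fun x => Γ x 1) (F (a, Γ a 1)) a := by
  have hFc := hF.continuousOn
  let w : A → C(unitInterval, B) := fun x =>
    applyCLM unitInterval A B (superpose F (graphCLM 𝕜 A B ((x, b), Γ x))) (constCLM 𝕜 A x)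
  have hsa := hsol.self_of_nhds
  have hwv : ∀ᶠ x in 𝓝 a, ∀ s : unitInterval, w x s = F (((s : ℝ) : 𝕜) • x, Γ x s) x := by
    filter_upwards [hsol] with x hx s
    simp only [w, applyCLM_apply, constCLM_apply]
    rw [superpose_apply hFc (fun s => by simpa using hx.1 s)]
    simp
  have hN : DifferentiableAt 𝕜 (fun x => superpose F (graphCLM 𝕜 A B ((x, b), Γ x))) a := by
    have h1 : DifferentiableAt 𝕜 (superpose (K := unitInterval) F)
        (graphCLM 𝕜 A B ((a, b), Γ a)) :=
      (hasFDerivAt_superpose hU hF fun s => by simpa using hsa.1 s).differentiableAt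
    have h2 : DifferentiableAt 𝕜 (fun x => graphCLM 𝕜 A B ((x, b), Γ x)) a :=
      (graphCLM 𝕜 A B).differentiableAt.comp a
        ((differentiableAt_id.prodMk (differentiableAt_const b)).prodMk hΓ)
    exact DifferentiableAt.comp (E := A) (F := C(unitInterval, A × B))
      (G := C(unitInterval, A →L[𝕜] B)) a h1 h2
  have hw : DifferentiableAt 𝕜 w a := by
    have hA : Differentiable 𝕜 (applyCLM (𝕜 := 𝕜) unitInterval A B) :=
      ContinuousLinearMap.differentiable _
    have hAN : DifferentiableAt 𝕜 (applyCLM (𝕜 := 𝕜) unitInterval A B ∘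
        fun x => superpose F (graphCLM 𝕜 A B ((x, b), Γ x))) a :=
      DifferentiableAt.comp (𝕜 := 𝕜) (E := A) (F := C(unitInterval, A →L[𝕜] B))
        (G := C(unitInterval, A) →L[𝕜] C(unitInterval, B))
        (f := fun x => superpose F (graphCLM 𝕜 A B ((x, b), Γ x))) a (hA _) hN
    exact hAN.clm_apply (constCLM 𝕜 A).differentiableAt
  set G := fderiv 𝕜 Γ a with hG
  set w' := fderiv 𝕜 w a with hw'
  have hGd : HasFDerivAt Γ G a := hΓ.hasFDerivAt
  have hwd : HasFDerivAt w w' a := hw.hasFDerivAt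
  have hev : ∀ (f : A → C(unitInterval, B)) (f' : A →L[𝕜] C(unitInterval, B)) (s : unitInterval),
      HasFDerivAt f f' a → HasFDerivAt (fun x => f x s) ((ContinuousMap.evalCLM 𝕜 s) ∘L f') a :=
    fun f f' s hf => HasFDerivAt.comp (E := A) (F := C(unitInterval, B)) (G := B) a
      (ContinuousMap.evalCLM 𝕜 s : C(unitInterval, B) →L[𝕜] B).hasFDerivAt hf
  have hGw : ∀ h, G h = primitiveCLM 𝕜 B (w' h) := by
    have h1 : HasFDerivAt Γ (primitiveCLM 𝕜 B ∘L w') a := by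
      have h2 : HasFDerivAt (fun x => constCLM 𝕜 B b + primitiveCLM 𝕜 B (w x))
          (primitiveCLM 𝕜 B ∘L w') a :=
        ((primitiveCLM 𝕜 B).hasFDerivAt.comp a hwd).const_add _
      refine h2.congr_of_eventuallyEq ?_
      filter_upwards [hsol] with x hx using hx.2
    intro h
    rw [hGd.unique h1]
    rfl
  set D : unitInterval → A × B →L[𝕜] A →L[𝕜] B :=
    fun s => fderiv 𝕜 F (((s : ℝ) : 𝕜) • a, Γ a s) with hD
  have hFd : ∀ s : unitInterval, HasFDerivAt F (D s) (((s : ℝ) : 𝕜) • a, Γ a s) := fun s =>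
    ((hF.contDiffAt (hU.mem_nhds (hsa.1 s))).differentiableAt (by simp)).hasFDerivAt
  have hw'v : ∀ h (s : unitInterval), w' h s =
      D s (((s : ℝ) : 𝕜) • h, G h s) a + F (((s : ℝ) : 𝕜) • a, Γ a s) h := by
    intro h s
    have h1 := hev w w' s hwd
    have h2 : HasFDerivAt (fun x => F (((s : ℝ) : 𝕜) • x, Γ x s))
        (D s ∘L ((((s : ℝ) : 𝕜) • ContinuousLinearMap.id 𝕜 A).prod
          (ContinuousMap.evalCLM 𝕜 s ∘L G))) a :=
      (hFd s).comp a (f := fun x => (((s : ℝ) : 𝕜) • x, Γ x s))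
        (((hasFDerivAt_id a).const_smul _).prodMk (hev Γ G s hGd))
    have h3 := h2.clm_apply (hasFDerivAt_id a)
    have h4 := h1.unique (h3.congr_of_eventuallyEq (hwv.mono fun x hx => hx s))
    have h5 : w' h s = F (((s : ℝ) : 𝕜) • a, Γ a s) h +
        D s (((s : ℝ) : 𝕜) • h, G h s) a := DFunLike.congr_fun h4 h
    rw [h5]
    exact add_comm _ _
  have hcurve : ∀ t : unitInterval, Γ a t = b + primitive (w a) t := fun t => by
    have := DFunLike.congr_fun hsa.2 t
    simpa using this
  have hext : ∀ (v : C(unitInterval, B)) (t : unitInterval),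
      Set.IccExtend (zero_le_one' ℝ) v t = v t := fun v t => Set.IccExtend_val _ _ _
  -- the deviation from being a solution satisfies a homogeneous linear equation
  have hzero : ∀ h, G h 1 = F (a, Γ a 1) h := by
    intro h
    let γ : ℝ → B := fun t => b + primitive (w a) t
    let f : ℝ → B := fun t => primitive (w' h) t - (t : 𝕜) • F ((t : 𝕜) • a, γ t) h
    have hγ : ∀ t, HasDerivAt γ (Set.IccExtend zero_le_one (w a) t) t := fun t =>
      (hasDerivAt_primitive (w a) t).const_add b
    have hγe : ∀ t : unitInterval, γ t = Γ a t := fun t => (hcurve t).symm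
    have hpath : ∀ t : ℝ, HasDerivAt (fun t : ℝ => ((t : 𝕜) • a, γ t))
        (a, Set.IccExtend zero_le_one (w a) t) t := fun t => by
      have h1 : HasDerivAt (fun t : ℝ => (t : 𝕜)) 1 t := by
        simpa using (RCLike.ofRealCLM (K := 𝕜)).hasDerivAt (x := t)
      have h2 : HasDerivAt (fun t : ℝ => (t : 𝕜) • a) ((1 : 𝕜) • a) t := h1.smul_const a
      rw [one_smul] at h2
      exact h2.prodMk (hγ t)
    have hfd : ∀ t : unitInterval, HasDerivAt f (D t (0, f t) a) t := by
      intro t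
      have h0 : HasFDerivAt F (D t) (((t : ℝ) : 𝕜) • a, γ t) := by
        rw [hγe]; exact hFd t
      have h1 : HasDerivAt (fun t : ℝ => F ((t : 𝕜) • a, γ t))
          (D t (a, Set.IccExtend zero_le_one (w a) t)) t := by
        have hr := h0.restrictScalars ℝ
        have := hr.comp_hasDerivAt (t : ℝ) (hpath t)
        exact this
      have h2 : HasDerivAt (fun t : ℝ => F ((t : 𝕜) • a, γ t) h)
          (D t (a, Set.IccExtend zero_le_one (w a) t) h) t := by
        have := ((ContinuousLinearMap.apply 𝕜 B h).restrictScalars ℝ).hasFDerivAt.comp_hasDerivAt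
          (t : ℝ) h1
        exact this
      have h3 : HasDerivAt (fun t : ℝ => (t : 𝕜)) 1 (t : ℝ) := by
        simpa using (RCLike.ofRealCLM (K := 𝕜)).hasDerivAt (x := (t : ℝ))
      have h4 := (hasDerivAt_primitive (w' h) t).sub (h3.smul h2)
      refine h4.congr_deriv ?_
      rw [hext, hext, hw'v, hγe, one_smul, hwv.self_of_nhds t]
      -- Vanishing curvature turns the derivative of `F` along the ray, applied to `h`, into the
      -- derivative along `(h, F h)`, applied to `a`. Subtracting it from the derivative along `(t
      -- h, G h t)` leaves the vertical direction `(0, f t)`; Grönwall with `f 0 = 0` then gives `f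
      -- = 0`, and `t = 1` is the claim.
      have hc := hcurv _ (hsa.1 t) a h
      rw [show fderiv 𝕜 F (((t : ℝ) : 𝕜) • a, Γ a t) = D t from rfl] at hc
      rw [hc]
      have hft : f t = G h t - ((t : ℝ) : 𝕜) • F (((t : ℝ) : 𝕜) • a, Γ a t) h := by
        rw [hGw, primitiveCLM_apply, ← hγe]
      rw [hft]
      have e1 : ((((t : ℝ) : 𝕜) • h, G h t) : A × B) =
          ((t : ℝ) : 𝕜) • (h, F (((t : ℝ) : 𝕜) • a, Γ a t) h) +
            (0, G h t - ((t : ℝ) : 𝕜) • F (((t : ℝ) : 𝕜) • a, Γ a t) h) := by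
        ext <;> simp
      rw [e1, map_add, map_smul]
      simp
    have hDc : Continuous fun t : unitInterval => D t := by
      have h1 := hF.continuousOn_fderiv_of_isOpen hU (by simp)
      refine h1.comp_continuous ?_ hsa.1
      exact ((RCLike.continuous_ofReal.comp continuous_subtype_val).smul continuous_const).prodMk
        (Γ a).continuous
    obtain ⟨C, hC⟩ : ∃ C, ∀ t : unitInterval, ‖D t‖ ≤ C := by
      obtain ⟨C, hC⟩ := (isCompact_range
        ((continuous_norm (E := A × B →L[𝕜] A →L[𝕜] B)).comp hDc)).bddAbove
      exact ⟨C, fun t => hC ⟨t, rfl⟩⟩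
    have hf0 : f 0 = 0 := by simp [f, primitive]
    have hres := eq_zero_of_abs_deriv_le_mul_abs_self_of_eq_zero_right (f := f)
      (f' := fun t => Set.IccExtend (zero_le_one' ℝ) (fun t : unitInterval => D t (0, f t) a) t)
      (K := C * ‖a‖) (a := 0) (b := 1)
      (fun t ht => (hfd ⟨t, ht⟩).continuousAt.continuousWithinAt)
      (fun t ht => by
        rw [Set.IccExtend_of_mem _ _ (Set.Ico_subset_Icc_self ht)]
        exact (hfd ⟨t, Set.Ico_subset_Icc_self ht⟩).hasDerivWithinAt)
      hf0
      (fun t ht => by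
        rw [Set.IccExtend_of_mem _ _ (Set.Ico_subset_Icc_self ht)]
        set t' : unitInterval := ⟨t, Set.Ico_subset_Icc_self ht⟩
        have h1 : ‖((0 : A), f t)‖ = ‖f t‖ := by simp
        calc ‖D t' (0, f t) a‖ ≤ ‖D t' (0, f t)‖ * ‖a‖ := ContinuousLinearMap.le_opNorm _ _
          _ ≤ (C * ‖f t‖) * ‖a‖ := by
            gcongr
            refine (ContinuousLinearMap.le_opNorm _ _).trans ?_
            rw [h1]
            gcongr
            exact hC t'
          _ = C * ‖a‖ * ‖f t‖ := by ring)
      1 ⟨zero_le_one, le_rfl⟩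
    have h1 : f 1 = G h 1 - F (a, Γ a 1) h := by
      have := hγe 1
      simp only [Set.Icc.coe_one] at this
      simp only [f, this, RCLike.ofReal_one, one_smul, hGw, primitiveCLM_apply, Set.Icc.coe_one]
    rw [h1] at hres
    exact sub_eq_zero.1 hres
  have h1 := hev Γ G 1 hGd
  refine h1.congr_fderiv ?_
  ext h
  exact hzero h

/-- Existence and smooth dependence on initial values for total differential equations
`D_a u = F (a, u)` with vanishing curvature. -/
theorem exists_total_differential [CompleteSpace A] {F : A × B → A →L[𝕜] B}
    {U : Set (A × B)} (hU : IsOpen U) (hF : ContDiffOn 𝕜 ∞ F U)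
    (hcurv : ∀ p ∈ U, ∀ h k, fderiv 𝕜 F p (h, F p h) k = fderiv 𝕜 F p (k, F p k) h)
    {b₀ : B} (hb₀ : ((0 : A), b₀) ∈ U) :
    ∃ (V : Set (A × B)) (u : A × B → B), IsOpen V ∧ (0, b₀) ∈ V ∧ ContDiffOn 𝕜 ∞ u V ∧
      (∀ b, (0, b) ∈ V → u (0, b) = b) ∧
      ∀ p ∈ V, (p.1, u p) ∈ U ∧ HasFDerivAt (fun x => u (x, p.2)) (F (p.1, u p)) p.1 := by
  -- Ray parameters and integrals are real even for `𝕜 = ℂ`, which requires real structures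
  -- compatible with the given ones.
  let _ : NormedSpace ℝ A := NormedSpace.restrictScalars ℝ 𝕜 A
  let _ : NormedSpace ℝ B := NormedSpace.restrictScalars ℝ 𝕜 B
  have _ : IsScalarTower ℝ 𝕜 A := ⟨fun r c x => by
    change (r • c) • x = (algebraMap ℝ 𝕜 r) • (c • x)
    rw [smul_smul, Algebra.smul_def]⟩
  have _ : IsScalarTower ℝ 𝕜 B := ⟨fun r c x => by
    change (r • c) • x = (algebraMap ℝ 𝕜 r) • (c • x)
    rw [smul_smul, Algebra.smul_def]⟩
  obtain ⟨V, Γ, hV, h0, hΓ, hsol⟩ := exists_radial_solution hU hF hb₀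
  refine ⟨V, fun p => Γ p 1, hV, h0, ?_, ?_, ?_⟩
  · exact (ContinuousMap.evalCLM 𝕜 (1 : unitInterval)).contDiff.comp_contDiffOn hΓ
  · intro b hb
    have := DFunLike.congr_fun (hsol _ hb).2 1
    simpa using this
  · rintro ⟨a, b⟩ hp
    refine ⟨by simpa using (hsol _ hp).1 1, ?_⟩
    have hι : Continuous (fun x : A => (x, b)) := by fun_prop
    have hd : DifferentiableAt 𝕜 (fun x => Γ (x, b)) a :=
      DifferentiableAt.comp a
        ((hΓ.contDiffAt (hV.mem_nhds hp)).differentiableAt (by simp))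
        (differentiableAt_id.prodMk (differentiableAt_const b))
    exact hasFDerivAt_radial_solution hU hF hcurv hd
      (Filter.mem_of_superset (hι.continuousAt.preimage_mem_nhds (hV.mem_nhds hp))
        fun x hx => hsol (x, b) hx)

end TotalDifferential

/-! ### Frobenius theorem and functional dependence on a submersion. -/

section Frobenius

variable {𝕜 : Type*} [RCLike 𝕜] {E B : Type*} [NormedAddCommGroup E] [NormedSpace 𝕜 E]
  [NormedAddCommGroup B] [NormedSpace 𝕜 B]

/-- A right inverse `s` of `L` splits the space as `ker L × B`. -/
def splitting (L : E →L[𝕜] B) (s : B →L[𝕜] E) (hs : ∀ b, L (s b) = b) : (L.ker × B) ≃L[𝕜] E :=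
  ContinuousLinearEquiv.equivOfInverse
    (L.ker.subtypeL.coprod s)
    (((ContinuousLinearMap.id 𝕜 E - s ∘L L).codRestrict L.ker
      (fun x => by simp [hs])).prod L)
    (fun x => by
      obtain ⟨⟨a, ha⟩, b⟩ := x
      have ha' : L a = 0 := ha
      ext <;> simp [hs, ha'])
    (fun x => by simp)

@[simp] lemma splitting_apply (L : E →L[𝕜] B) (s : B →L[𝕜] E) (hs : ∀ b, L (s b) = b)
    (x : L.ker × B) : splitting L s hs x = x.1 + s x.2 := rfl

/-- Frobenius theorem for a normalized Pfaffian system `q = 0`. -/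
theorem exists_first_integrals_of_normalized [CompleteSpace E] [CompleteSpace B]
    {q : E → E →L[𝕜] B} {s : B →L[𝕜] E}
    {U : Set E} (hU : IsOpen U) (hq : ContDiffOn 𝕜 ∞ q U) (hs : ∀ z ∈ U, ∀ b, q z (s b) = b)
    (hint : ∀ z ∈ U, ∀ v w, q z v = 0 → q z w = 0 → fderiv 𝕜 q z v w = fderiv 𝕜 q z w v)
    {z₀ : E} (hz₀ : z₀ ∈ U) :
    ∃ (V : Set E) (β : E → B), IsOpen V ∧ z₀ ∈ V ∧ V ⊆ U ∧ ContDiffOn 𝕜 ∞ β V ∧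
      (∀ z ∈ V, ∀ v, q z v = 0 → fderiv 𝕜 β z v = 0) ∧
      Function.Surjective (fderiv 𝕜 β z₀) := by
  set A := (q z₀).ker with hA
  have _ : CompleteSpace A := (q z₀).isClosed_ker.completeSpace_coe
  let ι : (A × B) ≃L[𝕜] E := splitting (q z₀) s (hs z₀ hz₀)
  have hι : ∀ x : A × B, ι x = x.1 + s x.2 := fun x => rfl
  have hτ : ContDiff 𝕜 ∞ (fun p : A × B => z₀ + ι p) := contDiff_const.add ι.contDiff
  -- In the splitting `ker (q z₀) × B`, integral manifolds of `q = 0` are graphs of `u`. Since `q ∘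
  -- s = id`, the condition `q (h + s (Du h)) = 0` reads `Du h = -q h`.
  let F : A × B → A →L[𝕜] B := fun p => -(q (z₀ + ι p) ∘L A.subtypeL)
  let UF : Set (A × B) := (fun p : A × B => z₀ + ι p) ⁻¹' U
  have hUF : IsOpen UF := hU.preimage hτ.continuous
  have hqτ : ContDiffOn 𝕜 ∞ (fun p : A × B => q (z₀ + ι p)) UF :=
    hq.comp hτ.contDiffOn fun p hp => hp
  have hF : ContDiffOn 𝕜 ∞ F UF := (hqτ.clm_comp contDiffOn_const).neg
  have hqd : ∀ z ∈ U, HasFDerivAt q (fderiv 𝕜 q z) z := fun z hz =>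
    ((hq.contDiffAt (hU.mem_nhds hz)).differentiableAt (by simp)).hasFDerivAt
  have hFd : ∀ p ∈ UF, ∀ x k, fderiv 𝕜 F p x k = -(fderiv 𝕜 q (z₀ + ι p) (ι x) k) := by
    intro p hp x k
    have h1 : HasFDerivAt (fun p : A × B => z₀ + ι p) (ι : A × B →L[𝕜] E) p :=
      (ι.hasFDerivAt).const_add z₀
    have h2 := HasFDerivAt.comp (g := q) p (hqd _ hp) h1
    have h3 := (h2.clm_comp (hasFDerivAt_const A.subtypeL p)).neg
    have h4 : fderiv 𝕜 F p = _ := h3.fderiv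
    rw [h4]
    simp
  -- The normalization makes `q z (s b)` constant in `z`. Arguments may thus be corrected by
  -- elements of the range of `s`, so involutivity on kernel vectors gives the curvature condition
  -- for all `h`, `k`.
  have hqs : ∀ z ∈ U, ∀ v b, fderiv 𝕜 q z v (s b) = 0 := by
    intro z hz v b
    have h1 : HasFDerivAt (fun z => q z (s b)) ((fderiv 𝕜 q z).flip (s b)) z := by
      refine ((hqd z hz).clm_apply (hasFDerivAt_const (s b) z)).congr_fderiv ?_
      ext; simp
    have h2 : HasFDerivAt (fun z => q z (s b)) (0 : E →L[𝕜] B) z := by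
      refine (hasFDerivAt_const b z).congr_of_eventuallyEq ?_
      filter_upwards [hU.mem_nhds hz] with y hy using hs y hy b
    exact DFunLike.congr_fun (h1.unique h2) v
  have hker : ∀ z ∈ U, ∀ v, q z (v - s (q z v)) = 0 := fun z hz v => by
    rw [map_sub, hs z hz, sub_self]
  have hιF : ∀ p ∈ UF, ∀ h : A, ι (h, F p h) = h - s (q (z₀ + ι p) h) := by
    intro p _ h
    simp [hι, F, sub_eq_add_neg]
  have hcurv : ∀ p ∈ UF, ∀ h k, fderiv 𝕜 F p (h, F p h) k = fderiv 𝕜 F p (k, F p k) h := by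
    intro p hp h k
    rw [hFd p hp, hFd p hp, hιF p hp, hιF p hp]
    have key : ∀ v (k : E), fderiv 𝕜 q (z₀ + ι p) v k =
        fderiv 𝕜 q (z₀ + ι p) v (k - s (q (z₀ + ι p) k)) := fun v k => by
      rw [map_sub, hqs _ hp, sub_zero]
    rw [key _ (k : E), key _ (h : E), hint _ hp _ _ (hker _ hp _) (hker _ hp _)]
  have h0F : ((0 : A), (0 : B)) ∈ UF := by
    change z₀ + ι 0 ∈ U
    simpa using hz₀
  obtain ⟨V, u, hV, h0V, hu, hu0, hsol⟩ := exists_total_differential hUF hF hcurv h0F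
  -- `Θ` straightens the foliation: its leaves are the images of the slices of constant second
  -- component, and the first integrals are the second component of the inverse.
  let Θ : A × B → E := fun p => z₀ + ι (p.1, u p)
  have hΘ : ContDiffOn 𝕜 ∞ Θ V :=
    contDiffOn_const.add (ι.contDiff.comp_contDiffOn (contDiffOn_fst.prodMk hu))
  have hΘd : ∀ p ∈ V, HasFDerivAt Θ
      ((ι : A × B →L[𝕜] E) ∘L (ContinuousLinearMap.fst 𝕜 A B).prod (fderiv 𝕜 u p)) p := by
    intro p hp
    have h1 : HasFDerivAt u (fderiv 𝕜 u p) p :=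
      ((hu.contDiffAt (hV.mem_nhds hp)).differentiableAt (by simp)).hasFDerivAt
    exact ((ι.hasFDerivAt).comp p (hasFDerivAt_fst.prodMk h1)).const_add z₀
  have hua : ∀ p ∈ V, ∀ h : A, fderiv 𝕜 u p (h, 0) = F (p.1, u p) h := by
    intro p hp h
    have h1 : HasFDerivAt u (fderiv 𝕜 u p) (p.1, p.2) :=
      ((hu.contDiffAt (hV.mem_nhds hp)).differentiableAt (by simp)).hasFDerivAt
    have h2 := HasFDerivAt.comp (g := u) (f := fun x => (x, p.2)) p.1 h1
      ((hasFDerivAt_id p.1).prodMk (hasFDerivAt_const p.2 p.1))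
    have h3 := h2.unique (hsol p hp).2
    have := DFunLike.congr_fun h3 h
    simpa using this
  have hub : ∀ b : B, fderiv 𝕜 u (0, 0) (0, b) = b := by
    intro b
    have h1 : HasFDerivAt u (fderiv 𝕜 u (0, 0)) (0, 0) :=
      ((hu.contDiffAt (hV.mem_nhds h0V)).differentiableAt (by simp)).hasFDerivAt
    have h2 := HasFDerivAt.comp (g := u) (f := fun y : B => ((0 : A), y)) 0 h1
      ((hasFDerivAt_const (0 : A) (0 : B)).prodMk (hasFDerivAt_id 0))
    have hc : Continuous (fun y : B => ((0 : A), y)) := by fun_prop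
    have h3 : HasFDerivAt (u ∘ fun y : B => ((0 : A), y)) (ContinuousLinearMap.id 𝕜 B) 0 := by
      refine (hasFDerivAt_id 0).congr_of_eventuallyEq ?_
      filter_upwards [hc.continuousAt.preimage_mem_nhds (hV.mem_nhds h0V)] with y hy
      exact hu0 y hy
    have := DFunLike.congr_fun (h2.unique h3) b
    simpa using this
  have hu00 : u (0, 0) = 0 := hu0 0 h0V
  have hΘ0 : HasFDerivAt Θ (ι : A × B →L[𝕜] E) (0, 0) := by
    refine (hΘd _ h0V).congr_fderiv ?_
    refine ContinuousLinearMap.ext fun x => ?_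
    have h1 : fderiv 𝕜 u (0, 0) x = x.2 := by
      have : x = (x.1, 0) + (0, x.2) := by simp
      rw [this, map_add, hub, hua _ h0V]
      have hx1 : q z₀ x.1 = 0 := x.1.2
      simp [F, hu00, hx1, hι]
    simp [h1]
  have hΘ00 : Θ (0, 0) = z₀ := by simp [Θ, hu00, hι]
  obtain ⟨φ, h0φ, hφV, hφ, hφs⟩ := exists_openPartialHomeomorph hV hΘ h0V ι hΘ0
  have hβΘ : ∀ p ∈ φ.source, ∀ x,
      fderiv 𝕜 (fun z => (φ.symm z).2) (Θ p) (ι (x.1, fderiv 𝕜 u p x)) = x.2 := by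
    intro p hp x
    have hpt : Θ p ∈ φ.target := by
      rw [← hφ]; exact φ.map_source hp
    have h1 : HasFDerivAt (fun z => (φ.symm z).2) (fderiv 𝕜 (fun z => (φ.symm z).2) (Θ p)) (Θ p) :=
      (((contDiff_snd.comp_contDiffOn hφs).contDiffAt
        (φ.open_target.mem_nhds hpt)).differentiableAt (by simp)).hasFDerivAt
    have h2 := h1.comp p (hΘd p (hφV hp))
    have h3 : HasFDerivAt ((fun z => (φ.symm z).2) ∘ Θ) (ContinuousLinearMap.snd 𝕜 A B) p := by
      refine hasFDerivAt_snd.congr_of_eventuallyEq ?_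
      filter_upwards [φ.open_source.mem_nhds hp] with y hy
      simp [← hφ, φ.left_inv hy]
    have := DFunLike.congr_fun (h2.unique h3) x
    simpa using this
  refine ⟨φ.target, fun z => (φ.symm z).2, φ.open_target, ?_, ?_,
    contDiff_snd.comp_contDiffOn hφs, ?_, ?_⟩
  · have := φ.map_source h0φ
    rwa [hφ, hΘ00] at this
  · intro z hz
    have h1 := (hsol _ (hφV (φ.map_target hz))).1
    have h2 : Θ (φ.symm z) = z := by rw [← hφ, φ.right_inv hz]
    rw [← h2]
    exact h1
  · intro z hz v hv
    have hp := φ.map_target hz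
    have h2 : Θ (φ.symm z) = z := by rw [← hφ, φ.right_inv hz]
    set p := φ.symm z with hpdef
    have hmem := (hsol p (hφV hp)).1
    -- The kernel of `q z` is a graph over `ker (q z₀)`, so `v` is recovered from its projection
    -- `h`.
    let h : A := ⟨v - s (q z₀ v), hker z₀ hz₀ v⟩
    have h3 := hβΘ p hp (h, 0)
    rw [hua p (hφV hp), hιF _ hmem] at h3
    have h4 : z₀ + ι (p.1, u p) = z := h2
    rw [h4, h2] at h3
    have h5 : (h : E) - s (q z h) = v := by
      have hz' : z ∈ U := by rw [← h4]; exact hmem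
      simp only [h, map_sub, hs z hz', hv]
      simp
    rwa [h5] at h3
  · intro b
    have h3 := hβΘ _ h0φ (0, b)
    rw [hΘ00] at h3
    exact ⟨_, h3⟩

/-- Frobenius theorem: an involutive Pfaffian system `q = 0` of full rank at `z₀` has a full set of
first integrals near `z₀`. -/
theorem exists_first_integrals [FiniteDimensional 𝕜 E] [FiniteDimensional 𝕜 B]
    {q : E → E →L[𝕜] B}
    {U : Set E} (hU : IsOpen U) (hq : ContDiffOn 𝕜 ∞ q U)
    (hint : ∀ z ∈ U, ∀ v w, q z v = 0 → q z w = 0 → fderiv 𝕜 q z v w = fderiv 𝕜 q z w v)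
    {z₀ : E} (hz₀ : z₀ ∈ U) (hsurj : Function.Surjective (q z₀)) :
    ∃ (V : Set E) (β : E → B), IsOpen V ∧ z₀ ∈ V ∧ V ⊆ U ∧ ContDiffOn 𝕜 ∞ β V ∧
      (∀ z ∈ V, ∀ v, q z v = 0 → fderiv 𝕜 β z v = 0) ∧
      Function.Surjective (fderiv 𝕜 β z₀) := by
  have _ : CompleteSpace E := FiniteDimensional.complete 𝕜 E
  have _ : CompleteSpace B := FiniteDimensional.complete 𝕜 B
  obtain ⟨s', hs'⟩ := (q z₀ : E →ₗ[𝕜] B).exists_rightInverse_of_surjective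
    (LinearMap.range_eq_top.2 hsurj)
  let s : B →L[𝕜] E := LinearMap.toContinuousLinearMap s'
  have hs : q z₀ ∘L s = 1 := by
    ext b
    exact LinearMap.congr_fun hs' b
  -- Replacing `q` by `(q ∘ s)⁻¹ q` normalizes the system without changing its kernel. On kernel
  -- vectors the derivative of the factor `(q ∘ s)⁻¹` does not contribute, so involutivity survives.
  let m : E → B →L[𝕜] B := fun z => q z ∘L s
  have hm : ContDiffOn 𝕜 ∞ m U := hq.clm_comp contDiffOn_const
  let U' : Set E := U ∩ m ⁻¹' {x | IsUnit x}
  have hU' : IsOpen U' := hm.continuousOn.isOpen_inter_preimage hU Units.isOpen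
  have hinv : ContDiffOn 𝕜 ∞ (fun z => Ring.inverse (m z)) U' := by
    intro z hz
    obtain ⟨x, hx⟩ := hz.2
    have h1 : ContDiffAt 𝕜 ∞ (Ring.inverse : (B →L[𝕜] B) → _) (m z) := by
      rw [← hx]
      exact contDiffAt_ringInverse 𝕜 x
    exact h1.comp_contDiffWithinAt z ((hm z hz.1).mono Set.inter_subset_left)
  have hq' : ContDiffOn 𝕜 ∞ q U' := hq.mono Set.inter_subset_left
  have hQ : ContDiffOn 𝕜 ∞ (fun z => Ring.inverse (m z) ∘L q z) U' := hinv.clm_comp hq'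
  have hz₀' : z₀ ∈ U' := ⟨hz₀, by simp [m, hs]⟩
  have hinj : ∀ z ∈ U', ∀ b, Ring.inverse (m z) b = 0 → b = 0 := by
    intro z hz b hb
    have := DFunLike.congr_fun (Ring.mul_inverse_cancel _ hz.2) b
    simpa [hb] using this.symm
  obtain ⟨V, β, hV, hzV, hVU, hβ, hker, hsur⟩ := exists_first_integrals_of_normalized (s := s)
    hU' hQ (fun z hz b => DFunLike.congr_fun (Ring.inverse_mul_cancel _ hz.2) b)
    (fun z hz v w hv hw => by
      have h1 : HasFDerivAt q (fderiv 𝕜 q z) z :=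
        ((hq.contDiffAt (hU.mem_nhds hz.1)).differentiableAt (by simp)).hasFDerivAt
      have h2 : HasFDerivAt (fun z => Ring.inverse (m z))
          (fderiv 𝕜 (fun z => Ring.inverse (m z)) z) z :=
        ((hinv.contDiffAt (hU'.mem_nhds hz)).differentiableAt (by simp)).hasFDerivAt
      have hv' : q z v = 0 := hinj z hz _ hv
      have hw' : q z w = 0 := hinj z hz _ hw
      rw [(h2.clm_comp h1).fderiv]
      simp [hv', hw', hint z hz.1 v w hv' hw'])
    hz₀'
  refine ⟨V, β, hV, hzV, hVU.trans Set.inter_subset_left, hβ, fun z hz v hv => ?_, hsur⟩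
  exact hker z hz v (by simp [hv])

/-- A function whose differential vanishes on the kernel of the differential of a submersion `q`
is locally a function of `q`. -/
theorem exists_eq_comp_submersion {Z : Type*} [NormedAddCommGroup Z] [NormedSpace 𝕜 Z]
    [FiniteDimensional 𝕜 E] [FiniteDimensional 𝕜 B]
    {q : E → B} {g : E → Z} {U : Set E} (hU : IsOpen U) (hq : ContDiffOn 𝕜 ∞ q U)
    (hg : ContDiffOn 𝕜 ∞ g U) {z₀ : E} (hz₀ : z₀ ∈ U)
    (hsurj : Function.Surjective (fderiv 𝕜 q z₀))
    (hker : ∀ z ∈ U, ∀ v, fderiv 𝕜 q z v = 0 → fderiv 𝕜 g z v = 0) :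
    ∃ (W : Set B) (G : B → Z), IsOpen W ∧ q z₀ ∈ W ∧ ContDiffOn 𝕜 ∞ G W ∧
      ∀ᶠ z in 𝓝 z₀, q z ∈ W ∧ g z = G (q z) := by
  have _ : CompleteSpace E := FiniteDimensional.complete 𝕜 E
  obtain ⟨s', hs'⟩ := (fderiv 𝕜 q z₀ : E →ₗ[𝕜] B).exists_rightInverse_of_surjective
    (LinearMap.range_eq_top.2 hsurj)
  let s : B →L[𝕜] E := LinearMap.toContinuousLinearMap s'
  have hs : ∀ b, fderiv 𝕜 q z₀ (s b) = b := fun b => LinearMap.congr_fun hs' b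
  set L := fderiv 𝕜 q z₀ with hL
  let e := splitting L s hs
  let π : E →L[𝕜] L.ker := (ContinuousLinearMap.fst 𝕜 L.ker B) ∘L (e.symm : E →L[𝕜] L.ker × B)
  -- `q` is completed to a local diffeomorphism. In these coordinates `g` has zero derivative along
  -- the `L.ker` factor, hence is constant along balls in that factor.
  let Ψ : E → L.ker × B := fun z => (π z, q z)
  have hqd : ∀ z ∈ U, HasFDerivAt q (fderiv 𝕜 q z) z := fun z hz =>
    ((hq.contDiffAt (hU.mem_nhds hz)).differentiableAt (by simp)).hasFDerivAt
  have hΨ : ContDiffOn 𝕜 ∞ Ψ U := π.contDiff.contDiffOn.prodMk hq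
  have hΨd : ∀ z ∈ U, HasFDerivAt Ψ (π.prod (fderiv 𝕜 q z)) z := fun z hz =>
    π.hasFDerivAt.prodMk (hqd z hz)
  have hΨ0 : HasFDerivAt Ψ (e.symm : E →L[𝕜] L.ker × B) z₀ :=
    (hΨd z₀ hz₀).congr_fderiv (ContinuousLinearMap.ext fun x => rfl)
  obtain ⟨φ, h0φ, hφU, hφ, hφs⟩ := exists_openPartialHomeomorph hU hΨ hz₀ e.symm hΨ0
  have hgφ : ContDiffOn 𝕜 ∞ (fun y => g (φ.symm y)) φ.target :=
    hg.comp hφs fun y hy => hφU (φ.map_target hy)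
  have hzero : ∀ y ∈ φ.target, ∀ k : L.ker, fderiv 𝕜 (fun y => g (φ.symm y)) y (k, 0) = 0 := by
    intro y hy k
    have hzU := hφU (φ.map_target hy)
    have h1 : HasFDerivAt φ.symm (fderiv 𝕜 φ.symm y) y :=
      ((hφs.contDiffAt (φ.open_target.mem_nhds hy)).differentiableAt (by simp)).hasFDerivAt
    have h2 : HasFDerivAt (Ψ ∘ φ.symm) _ y := (hΨd _ hzU).comp y h1
    have h3 : HasFDerivAt (Ψ ∘ φ.symm) (ContinuousLinearMap.id 𝕜 (L.ker × B)) y := by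
      refine (hasFDerivAt_id y).congr_of_eventuallyEq ?_
      filter_upwards [φ.open_target.mem_nhds hy] with x hx
      simp [← hφ, φ.right_inv hx]
    have h4 := congrArg Prod.snd (DFunLike.congr_fun (h2.unique h3) (k, 0))
    have h5 : HasFDerivAt g (fderiv 𝕜 g (φ.symm y)) (φ.symm y) :=
      ((hg.contDiffAt (hU.mem_nhds hzU)).differentiableAt (by simp)).hasFDerivAt
    have h6 : fderiv 𝕜 (fun y => g (φ.symm y)) y = _ := (h5.comp y h1).fderiv
    rw [h6]
    exact hker _ hzU _ h4
  have hmem : Ψ z₀ ∈ φ.target := by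
    rw [← hφ]; exact φ.map_source h0φ
  obtain ⟨ε, hε, hball⟩ := Metric.isOpen_iff.1 φ.open_target _ hmem
  rw [show Ψ z₀ = (π z₀, q z₀) from rfl, ← ball_prod_same] at hball
  refine ⟨Metric.ball (q z₀) ε, fun b => g (φ.symm (π z₀, b)), Metric.isOpen_ball,
    Metric.mem_ball_self hε, ?_, ?_⟩
  · exact hgφ.comp (contDiff_const.prodMk contDiff_id).contDiffOn fun b hb =>
      hball ⟨Metric.mem_ball_self hε, hb⟩
  · have hΨc : ContinuousAt Ψ z₀ := hΨ0.continuousAt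
    have hnear : ∀ᶠ z in 𝓝 z₀, Ψ z ∈ Metric.ball (π z₀) ε ×ˢ Metric.ball (q z₀) ε :=
      hΨc.preimage_mem_nhds (prod_mem_nhds (Metric.ball_mem_nhds _ hε) (Metric.ball_mem_nhds _ hε))
    filter_upwards [hnear, φ.open_source.mem_nhds h0φ] with z hz hzs
    refine ⟨hz.2, ?_⟩
    let _ : NormedSpace ℝ L.ker := NormedSpace.restrictScalars ℝ 𝕜 L.ker
    have hpre : IsPreconnected (Metric.ball (π z₀) ε) := (convex_ball _ _).isPreconnected
    have hd : ∀ k ∈ Metric.ball (π z₀) ε, HasFDerivAt (fun k : L.ker => g (φ.symm (k, q z)))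
        (0 : L.ker →L[𝕜] Z) k := by
      intro k hk
      have hkt : (k, q z) ∈ φ.target := hball ⟨hk, hz.2⟩
      have h1 : HasFDerivAt (fun y => g (φ.symm y)) _ (k, q z) :=
        ((hgφ.contDiffAt (φ.open_target.mem_nhds hkt)).differentiableAt (by simp)).hasFDerivAt
      have h2 := HasFDerivAt.comp (g := fun y => g (φ.symm y)) (f := fun k => (k, q z)) k h1
        ((hasFDerivAt_id k).prodMk (hasFDerivAt_const (q z) k))
      refine h2.congr_fderiv (ContinuousLinearMap.ext fun x => ?_)
      simpa using hzero _ hkt x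
    have hconst := Metric.isOpen_ball.is_const_of_fderiv_eq_zero hpre
      (fun k hk => (hd k hk).differentiableAt.differentiableWithinAt)
      (fun k hk => (hd k hk).fderiv) hz.1 (Metric.mem_ball_self hε)
    have h7 : φ.symm (π z, q z) = z := by
      have : φ.symm (φ z) = z := φ.left_inv hzs
      rwa [hφ] at this
    rw [← hconst]
    change g z = g (φ.symm (π z, q z))
    rw [h7]

end Frobenius

/-! ### Linear algebra of a pair of skew forms. -/

section SkewForms

variable {𝕜 : Type*} [Field 𝕜] {V : Type*} [AddCommGroup V] [Module 𝕜 V]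

/-- Skew-symmetry of a bilinear form. -/
def IsSkew (Ω : V →ₗ[𝕜] V →ₗ[𝕜] 𝕜) : Prop := ∀ ξ η, Ω ξ η = -Ω η ξ

/-- `ξ` is an eigenvector with eigenvalue `l` of the recursion operator of a pair of forms. -/
def IsEigen (Ω Ω' : V →ₗ[𝕜] V →ₗ[𝕜] 𝕜) (l : 𝕜) (ξ : V) : Prop := ∀ η, Ω' η ξ = l * Ω η ξ

lemma IsSkew.self_eq_zero [CharZero 𝕜] {Ω : V →ₗ[𝕜] V →ₗ[𝕜] 𝕜} (h : IsSkew Ω) (ξ : V) :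
    Ω ξ ξ = 0 := self_eq_neg.1 (h ξ ξ)

/-- Eigenvectors with different eigenvalues are orthogonal. -/
lemma IsEigen.orth {Ω Ω' : V →ₗ[𝕜] V →ₗ[𝕜] 𝕜} (hΩ : IsSkew Ω) (hΩ' : IsSkew Ω')
    {ξ η : V} {l m : 𝕜} (hξ : IsEigen Ω Ω' l ξ) (hη : IsEigen Ω Ω' m η) (hlm : l ≠ m) :
    Ω ξ η = 0 := by
  have h1 := hη ξ
  rw [hΩ', hξ η, hΩ ξ η] at h1
  have h3 : (m - l) * Ω η ξ = 0 := by linear_combination h1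
  rcases mul_eq_zero.1 h3 with h | h
  · exact absurd (sub_eq_zero.1 h).symm hlm
  · rw [hΩ, h, neg_zero]

/-- `(θ, θ')` is a family of pairwise orthogonal hyperbolic pairs. -/
structure IsFrame {n : ℕ} (Ω : V →ₗ[𝕜] V →ₗ[𝕜] 𝕜) (θ θ' : Fin n → V) : Prop where
  orth : ∀ i j, i ≠ j → Ω (θ i) (θ j) = 0 ∧ Ω (θ i) (θ' j) = 0 ∧ Ω (θ' i) (θ' j) = 0
  pair : ∀ i, Ω (θ i) (θ' i) ≠ 0

/-- Hyperbolic pairs of eigenvectors with distinct eigenvalues form a frame. -/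
lemma IsFrame.of_eigen {n : ℕ} {Ω Ω' : V →ₗ[𝕜] V →ₗ[𝕜] 𝕜} (hΩ : IsSkew Ω) (hΩ' : IsSkew Ω')
    {θ θ' : Fin n → V} {l : Fin n → 𝕜} (hl : Function.Injective l)
    (h : ∀ i, IsEigen Ω Ω' (l i) (θ i)) (h' : ∀ i, IsEigen Ω Ω' (l i) (θ' i))
    (hpair : ∀ i, Ω (θ i) (θ' i) ≠ 0) : IsFrame Ω θ θ' where
  orth i j hij :=
    ⟨(h i).orth hΩ hΩ' (h j) (hl.ne hij), (h i).orth hΩ hΩ' (h' j) (hl.ne hij),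
      (h' i).orth hΩ hΩ' (h' j) (hl.ne hij)⟩
  pair := hpair

namespace IsFrame

variable [CharZero 𝕜] {n : ℕ} {Ω : V →ₗ[𝕜] V →ₗ[𝕜] 𝕜} {θ θ' : Fin n → V}

/-- Pairing with `θ' j` isolates the coefficient of `θ j`. With `sum_pair_left` it plays the role of
a dual basis. -/
lemma sum_pair_right (hΩ : IsSkew Ω) (h : IsFrame Ω θ θ') (a b : Fin n → 𝕜) (j : Fin n) :
    Ω (∑ i, (a i • θ i + b i • θ' i)) (θ' j) = a j * Ω (θ j) (θ' j) := by
  rw [map_sum, LinearMap.sum_apply, Finset.sum_eq_single j]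
  · simp [hΩ.self_eq_zero]
  · intro i _ hij
    simp [(h.orth i j hij).2.1, (h.orth i j hij).2.2]
  · simp

lemma sum_pair_left (hΩ : IsSkew Ω) (h : IsFrame Ω θ θ') (a b : Fin n → 𝕜) (j : Fin n) :
    Ω (∑ i, (a i • θ i + b i • θ' i)) (θ j) = -(b j * Ω (θ j) (θ' j)) := by
  rw [map_sum, LinearMap.sum_apply, Finset.sum_eq_single j]
  · simp [hΩ.self_eq_zero, hΩ (θ' j) (θ j)]
  · intro i _ hij
    simp [(h.orth i j hij).1, hΩ (θ' i) (θ j), (h.orth j i hij.symm).2.1]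
  · simp

lemma linearIndependent (hΩ : IsSkew Ω) (h : IsFrame Ω θ θ') :
    LinearIndependent 𝕜 (Sum.elim θ θ') := by
  rw [Fintype.linearIndependent_iff]
  intro g hg
  rw [Fintype.sum_sum_type] at hg
  simp only [Sum.elim_inl, Sum.elim_inr] at hg
  rw [← Finset.sum_add_distrib] at hg
  rintro (j | j)
  · have := h.sum_pair_right hΩ (fun i => g (Sum.inl i)) (fun i => g (Sum.inr i)) j
    rw [hg] at this
    simpa [h.pair j] using this.symm
  · have := h.sum_pair_left hΩ (fun i => g (Sum.inl i)) (fun i => g (Sum.inr i)) j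
    rw [hg] at this
    simpa [h.pair j] using this.symm

variable [FiniteDimensional 𝕜 V]

lemma exists_coeff (hn : Module.finrank 𝕜 V = 2 * n) (hΩ : IsSkew Ω) (h : IsFrame Ω θ θ')
    (ξ : V) : ∃ a b : Fin n → 𝕜, ξ = ∑ i, (a i • θ i + b i • θ' i) := by
  have htop := (h.linearIndependent hΩ).span_eq_top_of_card_eq_finrank' (by
    rw [hn, Fintype.card_sum, Fintype.card_fin]; ring)
  have hξ : ξ ∈ Submodule.span 𝕜 (Set.range (Sum.elim θ θ')) := htop ▸ Submodule.mem_top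
  obtain ⟨c, hc⟩ := (Submodule.mem_span_range_iff_exists_fun 𝕜).1 hξ
  refine ⟨fun i => c (Sum.inl i), fun i => c (Sum.inr i), ?_⟩
  rw [← hc, Fintype.sum_sum_type, Finset.sum_add_distrib]
  rfl

/-- Serves twice: for eigenvectors of the i-th eigenvalue, and for the differential of `{x_i, y_i}`,
both orthogonal to all the other pairs. -/
lemma eq_of_orth (hn : Module.finrank 𝕜 V = 2 * n) (hΩ : IsSkew Ω) (h : IsFrame Ω θ θ')
    {ξ : V} {i : Fin n} (hξ : ∀ j, j ≠ i → Ω ξ (θ j) = 0 ∧ Ω ξ (θ' j) = 0) :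
    ∃ a b : 𝕜, ξ = a • θ i + b • θ' i := by
  obtain ⟨a, b, hab⟩ := h.exists_coeff hn hΩ ξ
  refine ⟨a i, b i, ?_⟩
  rw [hab]
  refine Finset.sum_eq_single_of_mem i (Finset.mem_univ i) fun j _ hj => ?_
  have h1 := h.sum_pair_left hΩ a b j
  have h2 := h.sum_pair_right hΩ a b j
  rw [← hab, (hξ j hj).1] at h1
  rw [← hab, (hξ j hj).2] at h2
  have h3 : b j = 0 := by simpa [h.pair j] using h1.symm
  have h4 : a j = 0 := by simpa [h.pair j] using h2.symm
  simp [h3, h4]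

lemma eq_zero_of_orth (hn : Module.finrank 𝕜 V = 2 * n) (hΩ : IsSkew Ω) (h : IsFrame Ω θ θ')
    {ξ : V} (hξ : ∀ j, Ω ξ (θ j) = 0 ∧ Ω ξ (θ' j) = 0) : ξ = 0 := by
  obtain ⟨a, b, hab⟩ := h.exists_coeff hn hΩ ξ
  rw [hab]
  refine Finset.sum_eq_zero fun j _ => ?_
  have h1 := h.sum_pair_left hΩ a b j
  have h2 := h.sum_pair_right hΩ a b j
  rw [← hab, (hξ j).1] at h1
  rw [← hab, (hξ j).2] at h2
  have h3 : b j = 0 := by simpa [h.pair j] using h1.symm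
  have h4 : a j = 0 := by simpa [h.pair j] using h2.symm
  simp [h3, h4]

/-- Every eigenvector is a combination of the pair with the same eigenvalue. -/
lemma eq_of_eigen (hn : Module.finrank 𝕜 V = 2 * n) {Ω' : V →ₗ[𝕜] V →ₗ[𝕜] 𝕜}
    (hΩ : IsSkew Ω) (hΩ' : IsSkew Ω') {l : Fin n → 𝕜} (hl : Function.Injective l)
    (h : ∀ i, IsEigen Ω Ω' (l i) (θ i)) (h' : ∀ i, IsEigen Ω Ω' (l i) (θ' i))
    (hf : IsFrame Ω θ θ') {ξ : V} {i : Fin n} (hξ : IsEigen Ω Ω' (l i) ξ) :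
    ∃ a b : 𝕜, ξ = a • θ i + b • θ' i :=
  hf.eq_of_orth hn hΩ fun j hj =>
    ⟨hξ.orth hΩ hΩ' (h j) (hl.ne hj.symm), hξ.orth hΩ hΩ' (h' j) (hl.ne hj.symm)⟩

end IsFrame

lemma mem_eigenspace_recursion {Ω Ω' : V →ₗ[𝕜] V →ₗ[𝕜] 𝕜}
    (hnd : ∀ η, (∀ ξ, Ω ξ η = 0) → η = 0)
    {T : Module.End 𝕜 V} (hT : ∀ η ξ, Ω η (T ξ) = Ω' η ξ) {ξ : V} {m : 𝕜} :
    ξ ∈ T.eigenspace m ↔ IsEigen Ω Ω' m ξ := by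
  rw [Module.End.mem_eigenspace_iff]
  constructor
  · intro h η
    rw [← hT, h, map_smul, smul_eq_mul]
  · intro h
    refine sub_eq_zero.1 (hnd _ fun η => ?_)
    rw [map_sub, hT, h η, map_smul, smul_eq_mul, sub_self]

/-- Independent functionals define a surjective map. -/
lemma surjective_of_linearIndependent {n : ℕ} {h : Fin n → Module.Dual 𝕜 V}
    (hh : LinearIndependent 𝕜 h) : Function.Surjective (LinearMap.pi h) := by
  by_contra hcon
  have hlt : (LinearMap.pi h).range < ⊤ :=
    lt_top_iff_ne_top.2 fun htop => hcon (LinearMap.range_eq_top.1 htop)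
  -- The coefficients of a nonzero functional vanishing on the range form a linear relation between
  -- the `h i`.
  obtain ⟨f, hf, hle⟩ := Submodule.exists_le_ker_of_lt_top _ hlt
  have hfe : ∀ x, f x = ∑ i, x i * f (Pi.single i 1) := fun x => by
    conv_lhs => rw [← Finset.univ_sum_single x]
    rw [map_sum]
    refine Finset.sum_congr rfl fun i _ => ?_
    rw [← smul_eq_mul, ← map_smul, ← Pi.single_smul, smul_eq_mul, mul_one]
  apply hf
  have h0 := Fintype.linearIndependent_iff.1 hh (fun i => f (Pi.single i 1)) (by
    refine LinearMap.ext fun x => ?_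
    have h1 : f (LinearMap.pi h x) = 0 := hle ⟨x, rfl⟩
    rw [hfe] at h1
    simpa [mul_comm] using h1)
  refine LinearMap.ext fun x => ?_
  rw [hfe]
  simp [h0]

variable [FiniteDimensional 𝕜 V]

/-- The radical of a skew form on an even-dimensional space is not one-dimensional. -/
lemma IsSkew.finrank_ker_ne_one [CharZero 𝕜] {n : ℕ} (hn : Module.finrank 𝕜 V = 2 * n)
    {σ : V →ₗ[𝕜] V →ₗ[𝕜] 𝕜} (hσ : IsSkew σ) : Module.finrank 𝕜 σ.ker ≠ 1 := by
  intro h1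
  obtain ⟨W, hW⟩ := Submodule.exists_isCompl σ.ker
  have hdim := Submodule.finrank_add_eq_of_isCompl hW
  rw [h1, hn] at hdim
  let b := Module.finBasis 𝕜 W
  let M : Matrix (Fin (Module.finrank 𝕜 W)) (Fin (Module.finrank 𝕜 W)) 𝕜 :=
    fun i j => σ (b i) (b j)
  have hM : M.transpose = -M := by
    ext i j
    exact hσ _ _
  have hdet : M.det = 0 := by
    have h2 : M.det = (-1) ^ Module.finrank 𝕜 W * M.det := by
      conv_lhs => rw [← Matrix.det_transpose, hM, Matrix.det_neg, Fintype.card_fin]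
    -- A complement of a one-dimensional radical has dimension `2n - 1`, and a skew matrix of odd
    -- size is singular. Its null vector is orthogonal to the complement and to the radical, so it
    -- lies in the radical, against the choice of `W`.
    have hodd : Odd (Module.finrank 𝕜 W) := ⟨n - 1, by omega⟩
    rw [hodd.neg_one_pow, neg_one_mul] at h2
    exact self_eq_neg.1 h2
  obtain ⟨v, hv, hMv⟩ := Matrix.exists_mulVec_eq_zero_iff.2 hdet
  let w : W := ∑ j, v j • b j
  have hbw : ∀ x : W, σ x w = 0 := by
    intro x
    have hb : ∀ i, σ (b i) w = 0 := fun i => by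
      have := congrFun hMv i
      simpa [Matrix.mulVec, dotProduct, M, w, mul_comm] using this
    have e : (σ.flip w) ∘ₗ W.subtype = 0 := b.ext hb
    exact LinearMap.congr_fun e x
  have hw : σ w = 0 := by
    refine LinearMap.ext fun ξ => ?_
    obtain ⟨κ, hκ, x, hx, rfl⟩ := Submodule.mem_sup.1
      (show ξ ∈ σ.ker ⊔ W by rw [hW.sup_eq_top]; trivial)
    have e1 : σ w κ = 0 := by rw [hσ, LinearMap.mem_ker.1 hκ]; simp
    have e2 : σ w x = 0 := by rw [hσ, hbw ⟨x, hx⟩, neg_zero]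
    simp [e1, e2]
  have hw0 : w = 0 := by
    have : (w : V) ∈ σ.ker ⊓ W := ⟨hw, w.2⟩
    rw [hW.inf_eq_bot, Submodule.mem_bot] at this
    exact Subtype.ext this
  exact hv (funext fun j => Fintype.linearIndependent_iff.1 b.linearIndependent v hw0 j)

/-- The recursion operator of a pair of forms. -/
lemma exists_recursion {Ω : V →ₗ[𝕜] V →ₗ[𝕜] 𝕜} (hnd : ∀ η, (∀ ξ, Ω ξ η = 0) → η = 0)
    (Ω' : V →ₗ[𝕜] V →ₗ[𝕜] 𝕜) : ∃ T : Module.End 𝕜 V, ∀ η ξ, Ω η (T ξ) = Ω' η ξ := by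
  have hinj : Function.Injective Ω.flip := by
    rw [← LinearMap.ker_eq_bot, LinearMap.ker_eq_bot']
    exact fun η h => hnd η fun ξ => LinearMap.congr_fun h ξ
  let e := LinearMap.linearEquivOfInjective (Ω.flip : V →ₗ[𝕜] Module.Dual 𝕜 V) hinj
    Subspace.dual_finrank_eq.symm
  refine ⟨e.symm.toLinearMap ∘ₗ Ω'.flip, fun η ξ => ?_⟩
  exact LinearMap.congr_fun (e.apply_symm_apply (Ω'.flip ξ)) η

/-- If the recursion operator has `n` distinct eigenvalues then every eigenvector is part of a
hyperbolic pair of eigenvectors. -/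
theorem exists_hyperbolic_partner [CharZero 𝕜] {n : ℕ} (hn : Module.finrank 𝕜 V = 2 * n)
    {Ω Ω' : V →ₗ[𝕜] V →ₗ[𝕜] 𝕜} (hΩ : IsSkew Ω) (hΩ' : IsSkew Ω')
    (hnd : ∀ η, (∀ ξ, Ω ξ η = 0) → η = 0)
    {l : Fin n → 𝕜} (hl : Function.Injective l) {θ : Fin n → V}
    (hθ : ∀ i, IsEigen Ω Ω' (l i) (θ i)) (hθ0 : ∀ i, θ i ≠ 0) :
    ∃ θ' : Fin n → V, (∀ i, IsEigen Ω Ω' (l i) (θ' i)) ∧ ∀ i, Ω (θ i) (θ' i) ≠ 0 := by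
  obtain ⟨T, hT'⟩ := exists_recursion hnd Ω'
  have hT : ∀ ξ m, ξ ∈ T.eigenspace m ↔ IsEigen Ω Ω' m ξ := fun ξ m =>
    mem_eigenspace_recursion hnd hT'
  -- The eigenspace is the radical of the skew form `Ω' - l i • Ω`: nonzero and not a line, hence at
  -- least a plane.
  have hdim : ∀ i, ∃ f : Fin 2 → V, LinearIndependent 𝕜 f ∧
      ∀ k, f k ∈ T.eigenspace (l i) := by
    intro i
    have hS : IsSkew (Ω' - l i • Ω) := fun ξ η => by
      simp [hΩ ξ η, hΩ' ξ η]; ring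
    have hker : (Ω' - l i • Ω).ker = T.eigenspace (l i) := by
      ext ξ
      rw [hT, LinearMap.mem_ker]
      constructor
      · intro h η
        have := LinearMap.congr_fun h η
        rw [hS] at this
        simp only [LinearMap.sub_apply, LinearMap.smul_apply, smul_eq_mul, LinearMap.zero_apply,
          neg_eq_zero] at this
        exact sub_eq_zero.1 this
      · intro h
        refine LinearMap.ext fun η => ?_
        rw [hS]
        simp [h η]
    have h1 := hS.finrank_ker_ne_one hn
    rw [hker] at h1
    have h0 : 0 < Module.finrank 𝕜 (T.eigenspace (l i)) := by
      have hnt : Nontrivial (T.eigenspace (l i)) :=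
        ⟨⟨⟨θ i, (hT _ _).2 (hθ i)⟩, 0, fun h => hθ0 i (congrArg Subtype.val h)⟩⟩
      exact Module.finrank_pos
    obtain ⟨f, hf⟩ := exists_linearIndependent_of_le_finrank
      (show 2 ≤ Module.finrank 𝕜 (T.eigenspace (l i)) by omega)
    exact ⟨fun k => f k, hf.map' _ (Submodule.ker_subtype _), fun k => (f k).2⟩
  choose f hf hfe using hdim
  -- Two vectors from each of n independent eigenspaces exhaust the dimension `2n`.
  have hind : LinearIndependent 𝕜 (fun x : Fin n × Fin 2 => f x.1 x.2) := by
    rw [Fintype.linearIndependent_iff]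
    intro g hg
    rw [Fintype.sum_prod_type] at hg
    have hindep := T.eigenspaces_iSupIndep.comp hl
    have hzero := (iSupIndep_iff_finsetSum_eq_zero_imp_eq_zero _).1 hindep Finset.univ
      (fun i => ∑ k, g (i, k) • f i k)
      (fun i _ => Submodule.sum_mem _ fun k _ => Submodule.smul_mem _ _ (hfe i k)) hg
    rintro ⟨i, k⟩
    exact Fintype.linearIndependent_iff.1 (hf i) (fun k => g (i, k))
      (hzero i (Finset.mem_univ i)) k
  have htop := hind.span_eq_top_of_card_eq_finrank' (by
    rw [hn, Fintype.card_prod, Fintype.card_fin, Fintype.card_fin, mul_comm])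
  -- Other eigenspaces are orthogonal to `θ i` anyway; were its own one orthogonal too, `θ i` would
  -- lie in the radical of `Ω`.
  have key : ∀ i, ∃ ξ, IsEigen Ω Ω' (l i) ξ ∧ Ω (θ i) ξ ≠ 0 := by
    intro i
    by_contra! hcon
    refine hθ0 i (hnd _ fun ξ => ?_)
    have hξ : ξ ∈ Submodule.span 𝕜 (Set.range fun x : Fin n × Fin 2 => f x.1 x.2) :=
      htop ▸ Submodule.mem_top
    induction hξ using Submodule.span_induction with
    | mem x hx =>
      obtain ⟨⟨j, k⟩, rfl⟩ := hx
      have hjk := (hT _ _).1 (hfe j k)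
      by_cases hij : j = i
      · subst hij
        rw [hΩ, hcon _ hjk, neg_zero]
      · exact hjk.orth hΩ hΩ' (hθ i) (hl.ne hij)
    | zero => simp
    | add x y _ _ hx hy => simp [hx, hy]
    | smul c x _ hx => simp [hx]
  choose θ' h1 h2 using key
  exact ⟨θ', h1, h2⟩

/-- An isotropic family of `n` independent vectors spans a Lagrangian subspace. -/
lemma mem_span_of_orth {n : ℕ} (hn : Module.finrank 𝕜 V = 2 * n) {Ω : V →ₗ[𝕜] V →ₗ[𝕜] 𝕜}
    (hΩ : IsSkew Ω) (hnd : ∀ η, (∀ ξ, Ω ξ η = 0) → η = 0) {h : Fin n → V}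
    (hh : LinearIndependent 𝕜 h)
    (hiso : ∀ i j, Ω (h i) (h j) = 0) {ξ : V} (hξ : ∀ i, Ω (h i) ξ = 0) :
    ξ ∈ Submodule.span 𝕜 (Set.range h) := by
  have hker : Ω.ker = ⊥ := by
    rw [LinearMap.ker_eq_bot']
    exact fun η h => hnd η fun ξ => by rw [hΩ, h]; simp
  have hind : LinearIndependent 𝕜 (fun i => (Ω (h i) : Module.Dual 𝕜 V)) := hh.map' Ω hker
  have hR := surjective_of_linearIndependent hind
  set R := LinearMap.pi (fun i => (Ω (h i) : Module.Dual 𝕜 V)) with hRdef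
  have hrank := LinearMap.finrank_range_add_finrank_ker R
  rw [LinearMap.range_eq_top.2 hR, finrank_top, hn, Module.finrank_fin_fun] at hrank
  have hle : Submodule.span 𝕜 (Set.range h) ≤ R.ker := by
    rw [Submodule.span_le]
    rintro _ ⟨j, rfl⟩
    exact LinearMap.mem_ker.2 (funext fun i => hiso i j)
  -- The orthogonal of `n` independent vectors has dimension `2n - n = n`, so it is no larger than
  -- the span it contains.
  have heq := Submodule.eq_of_le_of_finrank_eq hle (by
    rw [finrank_span_eq_card hh, Fintype.card_fin]; omega)
  rw [heq]
  exact LinearMap.mem_ker.2 (funext hξ)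

/-- The span of a bi-isotropic family is invariant under the recursion operator. -/
lemma recursion_mem_span {n : ℕ} (hn : Module.finrank 𝕜 V = 2 * n)
    {Ω Ω' : V →ₗ[𝕜] V →ₗ[𝕜] 𝕜} (hΩ : IsSkew Ω) (hnd : ∀ η, (∀ ξ, Ω ξ η = 0) → η = 0)
    {h : Fin n → V} (hh : LinearIndependent 𝕜 h)
    (hiso : ∀ i j, Ω (h i) (h j) = 0) (hiso' : ∀ i j, Ω' (h i) (h j) = 0)
    {T : Module.End 𝕜 V} (hT : ∀ η ξ, Ω η (T ξ) = Ω' η ξ) {ξ : V}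
    (hξ : ξ ∈ Submodule.span 𝕜 (Set.range h)) : T ξ ∈ Submodule.span 𝕜 (Set.range h) := by
  -- The span is its own `Ω`-orthogonal, and `Ω (h i) (T ξ) = Ω' (h i) ξ`.
  refine mem_span_of_orth hn hΩ hnd hh hiso fun i => ?_
  rw [hT]
  induction hξ using Submodule.span_induction with
  | mem x hx =>
    obtain ⟨j, rfl⟩ := hx
    exact hiso' i j
  | zero => simp
  | add x y _ _ hx hy => simp [hx, hy]
  | smul c x _ hx => simp [hx]

namespace IsFrame

variable [CharZero 𝕜] {n : ℕ} {Ω Ω' : V →ₗ[𝕜] V →ₗ[𝕜] 𝕜} {θ θ' : Fin n → V} {l : Fin n → 𝕜}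

/-- The recursion operator of a frame of eigenvectors is diagonalizable, so its invariant
subspaces are sums of subspaces of eigenspaces. -/
lemma invariant_eq_iSup (hn : Module.finrank 𝕜 V = 2 * n) (hΩ : IsSkew Ω)
    (hnd : ∀ η, (∀ ξ, Ω ξ η = 0) → η = 0)
    (hθ : ∀ i, IsEigen Ω Ω' (l i) (θ i)) (hθ' : ∀ i, IsEigen Ω Ω' (l i) (θ' i))
    (hf : IsFrame Ω θ θ') {T : Module.End 𝕜 V} (hT : ∀ η ξ, Ω η (T ξ) = Ω' η ξ)
    {S : Submodule 𝕜 V} (hS : ∀ ξ ∈ S, T ξ ∈ S) :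
    S = ⨆ m, S ⊓ T.eigenspace m := by
  have htop : ⨆ m, T.eigenspace m = ⊤ := by
    refine eq_top_iff.2 fun ξ _ => ?_
    obtain ⟨a, b, rfl⟩ := hf.exists_coeff hn hΩ ξ
    refine Submodule.sum_mem _ fun i _ => ?_
    refine (le_iSup T.eigenspace (l i)) (Submodule.add_mem _ ?_ ?_)
    · exact Submodule.smul_mem _ _ ((mem_eigenspace_recursion hnd hT).2 (hθ i))
    · exact Submodule.smul_mem _ _ ((mem_eigenspace_recursion hnd hT).2 (hθ' i))
  have := Submodule.inf_iSup_genEigenspace hS 1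
  change S ⊓ ⨆ m, T.eigenspace m = ⨆ m, S ⊓ T.eigenspace m at this
  rwa [htop, inf_top_eq] at this

/-- The span of a bi-isotropic family contains a combination of each pair of the frame. -/
lemma exists_combination_mem_span (hn : Module.finrank 𝕜 V = 2 * n)
    (hΩ : IsSkew Ω) (hΩ' : IsSkew Ω') (hnd : ∀ η, (∀ ξ, Ω ξ η = 0) → η = 0)
    (hl : Function.Injective l) (hθ : ∀ i, IsEigen Ω Ω' (l i) (θ i))
    (hθ' : ∀ i, IsEigen Ω Ω' (l i) (θ' i)) (hf : IsFrame Ω θ θ')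
    {h : Fin n → V} (hh : LinearIndependent 𝕜 h) (hiso : ∀ i j, Ω (h i) (h j) = 0)
    (hiso' : ∀ i j, Ω' (h i) (h j) = 0) (i : Fin n) :
    ∃ a b : 𝕜, (a ≠ 0 ∨ b ≠ 0) ∧ a • θ i + b • θ' i ∈ Submodule.span 𝕜 (Set.range h) := by
  obtain ⟨T, hT⟩ := exists_recursion hnd Ω'
  set S := Submodule.span 𝕜 (Set.range h) with hSdef
  have hS : ∀ ξ ∈ S, T ξ ∈ S := fun ξ hξ => recursion_mem_span hn hΩ hnd hh hiso hiso' hT hξ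
  have hsup := hf.invariant_eq_iSup hn hΩ hnd hθ hθ' hT hS
  -- If `S` met the i-th eigenplane only in 0, it would be a sum of pieces of other eigenspaces,
  -- hence orthogonal to `θ i`. A Lagrangian `S` would then contain `θ i`, a contradiction.
  by_contra! hcon
  have hbot : ∀ ξ ∈ S, IsEigen Ω Ω' (l i) ξ → ξ = 0 := by
    intro ξ hξ hξl
    obtain ⟨a, b, rfl⟩ := hf.eq_of_eigen hn hΩ hΩ' hl hθ hθ' hξl
    by_cases h0 : a ≠ 0 ∨ b ≠ 0
    · exact absurd hξ (hcon a b h0)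
    · push Not at h0
      simp [h0.1, h0.2]
  have horth : ∀ ξ ∈ S, Ω ξ (θ i) = 0 := by
    intro ξ hξ
    rw [hsup] at hξ
    refine Submodule.iSup_induction _ (motive := fun ξ => Ω ξ (θ i) = 0) hξ ?_ (by simp) ?_
    · intro m x hx
      have hxm := (mem_eigenspace_recursion hnd hT).1 hx.2
      by_cases hm : m = l i
      · rw [hbot x hx.1 (hm ▸ hxm)]; simp
      · exact hxm.orth hΩ hΩ' (hθ i) hm
    · intro x y hx hy
      simp [hx, hy]
  have hmem : θ i ∈ S := mem_span_of_orth hn hΩ hnd hh hiso fun j =>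
    horth _ (Submodule.subset_span ⟨j, rfl⟩)
  have h0 := hbot _ hmem (hθ i)
  exact hf.pair i (by simp [h0])

/-- A family of `n` vectors, one from the span of each pair of a frame of eigenvectors, spans a
bi-isotropic subspace. -/
lemma isotropic_of_combination_mem_span (hΩ : IsSkew Ω)
    (hθ : ∀ i, IsEigen Ω Ω' (l i) (θ i)) (hθ' : ∀ i, IsEigen Ω Ω' (l i) (θ' i))
    (hf : IsFrame Ω θ θ') {h : Fin n → V} (hh : LinearIndependent 𝕜 h) {a b : Fin n → 𝕜}
    (hab : ∀ i, a i ≠ 0 ∨ b i ≠ 0)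
    (hmem : ∀ i, a i • θ i + b i • θ' i ∈ Submodule.span 𝕜 (Set.range h)) (i j : Fin n) :
    Ω' (h i) (h j) = 0 := by
  -- The `c i` are `n` independent vectors in the span of `h`, so the spans agree. Bi-isotropy is
  -- evident on `c`: distinct eigenplanes are orthogonal, and a vector is orthogonal to itself.
  let c : Fin n → V := fun i => a i • θ i + b i • θ' i
  have hc : LinearIndependent 𝕜 c := by
    rw [Fintype.linearIndependent_iff]
    intro t ht k
    have e : ∑ i, ((t i * a i) • θ i + (t i * b i) • θ' i) = 0 := by
      rw [← ht]
      exact Finset.sum_congr rfl fun i _ => by simp [c, smul_smul]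
    have h1 := hf.sum_pair_right hΩ (fun i => t i * a i) (fun i => t i * b i) k
    have h2 := hf.sum_pair_left hΩ (fun i => t i * a i) (fun i => t i * b i) k
    rw [e] at h1 h2
    rcases hab k with h0 | h0
    · simpa [hf.pair k, h0] using h1.symm
    · simpa [hf.pair k, h0] using h2.symm
  have hle : Submodule.span 𝕜 (Set.range c) ≤ Submodule.span 𝕜 (Set.range h) := by
    rw [Submodule.span_le]
    rintro _ ⟨k, rfl⟩
    exact hmem k
  have heq := Submodule.eq_of_le_of_finrank_eq hle (by
    rw [finrank_span_eq_card hh, finrank_span_eq_card hc])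
  have hcc : ∀ k m, Ω' (c k) (c m) = 0 := by
    intro k m
    have h3 : Ω' (c k) (c m) = l m * Ω (c k) (c m) := by
      have e1 := hθ m (c k)
      have e2 := hθ' m (c k)
      change Ω' (c k) (a m • θ m + b m • θ' m) = l m * Ω (c k) (a m • θ m + b m • θ' m)
      simp only [map_add, map_smul, smul_eq_mul, e1, e2]
      ring
    rw [h3]
    by_cases hkm : k = m
    · subst hkm
      simp [hΩ.self_eq_zero]
    · have h1 := hf.orth k m hkm
      have h2 : Ω (θ' k) (θ m) = 0 := by rw [hΩ, (hf.orth m k (Ne.symm hkm)).2.1, neg_zero]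
      simp [c, h1.1, h1.2.1, h1.2.2, h2]
  have hall : ∀ x ∈ Submodule.span 𝕜 (Set.range c), ∀ y ∈ Submodule.span 𝕜 (Set.range c),
      Ω' x y = 0 := by
    intro x hx y hy
    induction hx, hy using Submodule.span_induction₂ with
    | mem_mem x y hx hy =>
      obtain ⟨k, rfl⟩ := hx
      obtain ⟨m, rfl⟩ := hy
      exact hcc k m
    | zero_left y _ => simp
    | zero_right x _ => simp
    | add_left x y z _ _ _ h1 h2 => simp [h1, h2]
    | add_right x y z _ _ _ h1 h2 => simp [h1, h2]
    | smul_left r x y _ _ h1 => simp [h1]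
    | smul_right r x y _ _ h1 => simp [h1]
  exact hall _ (heq ▸ Submodule.subset_span ⟨i, rfl⟩) _ (heq ▸ Submodule.subset_span ⟨j, rfl⟩)

/-- For a bi-isotropic family `h`, a vector that is `Ω'`-orthogonal to the family is congruent
modulo the radical of `Ω'` to an element of the span. -/
lemma exists_mem_span_congr (hn : Module.finrank 𝕜 V = 2 * n) (hΩ : IsSkew Ω)
    (hnd : ∀ η, (∀ ξ, Ω ξ η = 0) → η = 0) (hθ : ∀ i, IsEigen Ω Ω' (l i) (θ i))
    (hθ' : ∀ i, IsEigen Ω Ω' (l i) (θ' i)) (hf : IsFrame Ω θ θ')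
    {h : Fin n → V} (hh : LinearIndependent 𝕜 h) (hiso : ∀ i j, Ω (h i) (h j) = 0)
    (hiso' : ∀ i j, Ω' (h i) (h j) = 0) {ξ : V} (hξ : ∀ i, Ω' (h i) ξ = 0) :
    ∃ η ∈ Submodule.span 𝕜 (Set.range h), ∀ ζ, Ω' ζ η = Ω' ζ ξ := by
  obtain ⟨T, hT⟩ := exists_recursion hnd Ω'
  set S := Submodule.span 𝕜 (Set.range h) with hSdef
  have hS : ∀ ξ ∈ S, T ξ ∈ S := fun ξ hξ => recursion_mem_span hn hΩ hnd hh hiso hiso' hT hξ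
  have hS' : ∀ ξ ∈ S.comap T, T ξ ∈ S.comap T := fun ξ hξ => hS _ hξ
  -- The hypothesis says `T ξ ∈ S`, an invariant condition, so it passes to the eigencomponents of
  -- `ξ`. A component with nonzero eigenvalue lies in `S` itself; one with eigenvalue 0 lies in the
  -- radical of `Ω'` and is discarded.
  have hmem : ξ ∈ S.comap T := mem_span_of_orth hn hΩ hnd hh hiso fun i => by rw [hT, hξ]
  have hsup := hf.invariant_eq_iSup hn hΩ hnd hθ hθ' hT hS'
  rw [hsup] at hmem
  refine Submodule.iSup_induction _ (motive := fun ξ => ∃ η ∈ S, ∀ ζ, Ω' ζ η = Ω' ζ ξ) hmem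
    ?_ ⟨0, Submodule.zero_mem _, fun _ => rfl⟩ ?_
  · intro m x hx
    by_cases hm : m = 0
    · refine ⟨0, Submodule.zero_mem _, fun ζ => ?_⟩
      rw [(mem_eigenspace_recursion hnd hT).1 hx.2, hm]
      simp
    · refine ⟨x, ?_, fun _ => rfl⟩
      have h1 : T x ∈ S := hx.1
      rw [Module.End.mem_eigenspace_iff.1 hx.2] at h1
      exact (Submodule.smul_mem_iff _ hm).1 h1
  · rintro x y ⟨u, hu, hu'⟩ ⟨v, hv, hv'⟩
    exact ⟨u + v, Submodule.add_mem _ hu hv, fun ζ => by rw [map_add, hu', hv', map_add]⟩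

end IsFrame

end SkewForms

/-! ### Poisson pencils on open sets of a vector space, and their eigenfields. -/

section LocalPoisson

variable {𝕜 : Type*} [RCLike 𝕜] {E : Type*} [NormedAddCommGroup E] [NormedSpace 𝕜 E]

/-- The bilinear form `(ξ, η) ↦ ξ (A η)` on covectors. -/
def pairing (A : (E →L[𝕜] 𝕜) →ₗ[𝕜] E) : (E →L[𝕜] 𝕜) →ₗ[𝕜] (E →L[𝕜] 𝕜) →ₗ[𝕜] 𝕜 :=
  LinearMap.mk₂ 𝕜 (fun ξ η => ξ (A η)) (fun _ _ _ => rfl) (fun _ _ _ => rfl)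
    (fun ξ η ζ => by rw [map_add, map_add]) (fun c ξ η => by rw [map_smul, map_smul])

lemma pairing_apply (A : (E →L[𝕜] 𝕜) →ₗ[𝕜] E) (ξ η : E →L[𝕜] 𝕜) :
    pairing A ξ η = ξ (A η) := rfl

lemma isEigen_pairing {A A' : (E →L[𝕜] 𝕜) →ₗ[𝕜] E} {l : 𝕜} {ξ : E →L[𝕜] 𝕜} :
    IsEigen (pairing A) (pairing A') l ξ ↔ A' ξ = l • A ξ := by
  constructor
  · intro h
    refine sub_eq_zero.1 (SeparatingDual.eq_zero_of_forall_dual_eq_zero (R := 𝕜) fun η => ?_)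
    have := h η
    rw [pairing_apply, pairing_apply] at this
    rw [map_sub, this, map_smul, smul_eq_mul, sub_self]
  · intro h η
    rw [pairing_apply, pairing_apply, h, map_smul, smul_eq_mul]

lemma pairing_nondegenerate {A : (E →L[𝕜] 𝕜) →ₗ[𝕜] E} (hA : Function.Injective A)
    (η : E →L[𝕜] 𝕜) (h : ∀ ξ, pairing A ξ η = 0) : η = 0 := by
  have h1 : A η = 0 := SeparatingDual.eq_zero_of_forall_dual_eq_zero (R := 𝕜) h
  exact hA (by rw [h1, map_zero])

lemma finrank_continuousDual [FiniteDimensional 𝕜 E] :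
    Module.finrank 𝕜 (E →L[𝕜] 𝕜) = Module.finrank 𝕜 E := by
  rw [← LinearEquiv.finrank_eq (LinearMap.toContinuousLinearMap : (E →ₗ[𝕜] 𝕜) ≃ₗ[𝕜] _)]
  exact Subspace.dual_finrank_eq

/-- The bracket of functions defined by a bivector field on a vector space. -/
def localBracket (r : E → (E →L[𝕜] 𝕜) →L[𝕜] E) (f g : E → 𝕜) (z : E) : 𝕜 :=
  fderiv 𝕜 f z (r z (fderiv 𝕜 g z))

/-- `r` is a Poisson tensor on the open set `U`. -/
structure IsPoissonOn (r : E → (E →L[𝕜] 𝕜) →L[𝕜] E) (U : Set E) : Prop where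
  skew : ∀ z ∈ U, ∀ ξ η : E →L[𝕜] 𝕜, ξ (r z η) = -η (r z ξ)
  smooth : ContDiffOn 𝕜 ∞ r U
  jacobi : ∀ (V : Set E) (f g h : E → 𝕜), IsOpen V → V ⊆ U → ContDiffOn 𝕜 ∞ f V →
    ContDiffOn 𝕜 ∞ g V → ContDiffOn 𝕜 ∞ h V → ∀ z ∈ V,
    localBracket r f (localBracket r g h) z + localBracket r g (localBracket r h f) z
      + localBracket r h (localBracket r f g) z = 0

variable {r : E → (E →L[𝕜] 𝕜) →L[𝕜] E} {U : Set E}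

lemma IsPoissonOn.isSkew (h : IsPoissonOn r U) {z : E} (hz : z ∈ U) :
    IsSkew (pairing (r z : (E →L[𝕜] 𝕜) →ₗ[𝕜] E)) := h.skew z hz

lemma IsPoissonOn.hasFDerivAt (h : IsPoissonOn r U) (hU : IsOpen U) {z : E} (hz : z ∈ U) :
    HasFDerivAt r (fderiv 𝕜 r z) z :=
  ((h.smooth.contDiffAt (hU.mem_nhds hz)).differentiableAt (by simp)).hasFDerivAt

lemma IsPoissonOn.fderiv_skew (h : IsPoissonOn r U) (hU : IsOpen U) {z : E} (hz : z ∈ U)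
    (v : E) (ξ η : E →L[𝕜] 𝕜) : ξ (fderiv 𝕜 r z v η) = -η (fderiv 𝕜 r z v ξ) := by
  have hd := h.hasFDerivAt hU hz
  have h1 : HasFDerivAt (fun y => ξ (r y η)) (ξ.comp ((fderiv 𝕜 r z).flip η)) z :=
    ξ.hasFDerivAt.comp z (hd.clm_apply (hasFDerivAt_const η z) |>.congr_fderiv (by ext; simp))
  have h2 : HasFDerivAt (fun y => -η (r y ξ)) (-(η.comp ((fderiv 𝕜 r z).flip ξ))) z :=
    (η.hasFDerivAt.comp z
      (hd.clm_apply (hasFDerivAt_const ξ z) |>.congr_fderiv (by ext; simp))).neg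
  have h3 := h1.unique (h2.congr_of_eventuallyEq (by
    filter_upwards [hU.mem_nhds hz] with y hy using h.skew y hy ξ η))
  exact DFunLike.congr_fun h3 v

lemma localBracket_const (hr : DifferentiableAt 𝕜 r z) (η ζ : E →L[𝕜] 𝕜) (v : E) :
    fderiv 𝕜 (localBracket r η ζ) z v = η (fderiv 𝕜 r z v ζ) := by
  have e : localBracket r η ζ = fun y => η (r y ζ) := by
    funext y
    rw [localBracket, ContinuousLinearMap.fderiv, ContinuousLinearMap.fderiv]
  have h1 : HasFDerivAt (fun y => η (r y ζ)) (η.comp ((fderiv 𝕜 r z).flip ζ)) z :=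
    η.hasFDerivAt.comp z
      (hr.hasFDerivAt.clm_apply (hasFDerivAt_const ζ z) |>.congr_fderiv (by ext; simp))
  rw [e, h1.fderiv]
  rfl

/-- The Jacobi identity for covectors with constant coefficients. -/
lemma IsPoissonOn.jacobi_const (h : IsPoissonOn r U) (hU : IsOpen U) {z : E} (hz : z ∈ U)
    (ξ η ζ : E →L[𝕜] 𝕜) :
    η (fderiv 𝕜 r z (r z ξ) ζ) + ζ (fderiv 𝕜 r z (r z η) ξ) + ξ (fderiv 𝕜 r z (r z ζ) η) = 0 := by
  have hd := (h.hasFDerivAt hU hz).differentiableAt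
  have h1 := h.jacobi U ξ η ζ hU subset_rfl ξ.contDiff.contDiffOn η.contDiff.contDiffOn
    ζ.contDiff.contDiffOn z hz
  have key : ∀ α β γ : E →L[𝕜] 𝕜, localBracket r α (localBracket r β γ) z
      = -β (fderiv 𝕜 r z (r z α) γ) := fun α β γ => by
    rw [localBracket, ContinuousLinearMap.fderiv, h.skew z hz, localBracket_const hd]
  rw [key, key, key] at h1
  linear_combination -h1

variable {p p' : E → (E →L[𝕜] 𝕜) →L[𝕜] E}

/-- The members of the pencil spanned by a pair of local Poisson tensors are Poisson. -/
structure IsPencilOn (p p' : E → (E →L[𝕜] 𝕜) →L[𝕜] E) (U : Set E) : Prop where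
  poisson : IsPoissonOn p U
  poisson' : IsPoissonOn p' U
  pencil : ∀ c : 𝕜, IsPoissonOn (fun z => p' z - c • p z) U
  bijective : ∀ z ∈ U, Function.Bijective (p z)

lemma hasFDerivAt_sub_smul {F : Type*} [NormedAddCommGroup F] [NormedSpace 𝕜 F] {f g : E → F}
    {z : E} {f' g' : E →L[𝕜] F} (hf : HasFDerivAt f f' z) (hg : HasFDerivAt g g' z) (c : 𝕜) :
    HasFDerivAt (fun y => g y - c • f y) (g' - c • f') z :=
  hg.sub (hf.const_smul c)

lemma IsPencilOn.fderiv_pencil (h : IsPencilOn p p' U) (hU : IsOpen U) {z : E} (hz : z ∈ U)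
    (c : 𝕜) (v : E) (ξ : E →L[𝕜] 𝕜) : fderiv 𝕜 (fun z => p' z - c • p z) z v ξ
      = fderiv 𝕜 p' z v ξ - c • fderiv 𝕜 p z v ξ := by
  have h1 := hasFDerivAt_sub_smul (F := (E →L[𝕜] 𝕜) →L[𝕜] E) (f := p) (g := p')
    (h.poisson.hasFDerivAt hU hz) (h.poisson'.hasFDerivAt hU hz) c
  rw [h1.fderiv]
  rfl

/-- `Θ` is a field of eigencovectors with eigenvalue `l`. -/
structure IsEigenField (p p' : E → (E →L[𝕜] 𝕜) →L[𝕜] E) (U : Set E) (l : E → 𝕜)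
    (Θ : E → E →L[𝕜] 𝕜) : Prop where
  smooth : ContDiffOn 𝕜 ∞ Θ U
  smooth_eigenvalue : ContDiffOn 𝕜 ∞ l U
  eigen : ∀ z ∈ U, p' z (Θ z) = l z • p z (Θ z)

lemma IsEigenField.fderiv_eigen {l : E → 𝕜} {Θ : E → E →L[𝕜] 𝕜} (hΘ : IsEigenField p p' U l Θ)
    (h : IsPencilOn p p' U) (hU : IsOpen U) {z : E} (hz : z ∈ U) (v : E) :
    fderiv 𝕜 p' z v (Θ z) + p' z (fderiv 𝕜 Θ z v) =
      fderiv 𝕜 l z v • p z (Θ z)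
        + l z • (fderiv 𝕜 p z v (Θ z) + p z (fderiv 𝕜 Θ z v)) := by
  have hl : HasFDerivAt l (fderiv 𝕜 l z) z :=
    ((hΘ.smooth_eigenvalue.contDiffAt (hU.mem_nhds hz)).differentiableAt (by simp)).hasFDerivAt
  have hT : HasFDerivAt Θ (fderiv 𝕜 Θ z) z :=
    ((hΘ.smooth.contDiffAt (hU.mem_nhds hz)).differentiableAt (by simp)).hasFDerivAt
  have h1 := (h.poisson'.hasFDerivAt hU hz).clm_apply hT
  have h2 := hl.smul ((h.poisson.hasFDerivAt hU hz).clm_apply hT)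
  have h3 := h1.unique (h2.congr_of_eventuallyEq (by
    filter_upwards [hU.mem_nhds hz] with y hy using hΘ.eigen y hy))
  have h4 := DFunLike.congr_fun h3 v
  simp only [add_apply, ContinuousLinearMap.comp_apply,
    ContinuousLinearMap.flip_apply, smul_apply,
    ContinuousLinearMap.smulRight_apply] at h4
  rw [add_comm, h4, add_comm, add_comm (p z _)]

/-- Applied to a covector `η`, the derivative of the eigenvalue equation. -/
lemma IsEigenField.apply_fderiv {l : E → 𝕜} {Θ : E → E →L[𝕜] 𝕜} (hΘ : IsEigenField p p' U l Θ)
    (h : IsPencilOn p p' U) (hU : IsOpen U) {z : E} (hz : z ∈ U) (v : E) (η : E →L[𝕜] 𝕜) :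
    η (fderiv 𝕜 (fun y => p' y - l z • p y) z v (Θ z)) =
      fderiv 𝕜 l z v * η (p z (Θ z)) + fderiv 𝕜 Θ z v (p' z η - l z • p z η) := by
  -- The pencil parameter is frozen at `l z`, so the variation of the eigenvalue survives as a
  -- separate term.
  have h1 := congrArg η (hΘ.fderiv_eigen h hU hz v)
  rw [h.fderiv_pencil hU hz]
  simp only [map_add, map_sub, map_smul, smul_eq_mul] at h1 ⊢
  have h2 := h.poisson.skew z hz η (fderiv 𝕜 Θ z v)
  have h3 := h.poisson'.skew z hz η (fderiv 𝕜 Θ z v)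
  linear_combination h1 - h3 + l z * h2

/-- Eigenvalues are Casimir functions of the degenerate member of the pencil. -/
lemma IsEigenField.fderiv_eigenvalue {l : E → 𝕜} {Θ Θ' : E → E →L[𝕜] 𝕜}
    (hΘ : IsEigenField p p' U l Θ) (hΘ' : IsEigenField p p' U l Θ')
    (h : IsPencilOn p p' U) (hU : IsOpen U) {z : E} (hz : z ∈ U)
    (hne : Θ z (p z (Θ' z)) ≠ 0) (ξ : E →L[𝕜] 𝕜) :
    fderiv 𝕜 l z (p' z ξ - l z • p z ξ) = 0 := by
  -- Both eigencovectors lie in the kernel of the frozen member, so one term of its Jacobi identity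
  -- remains. By `apply_fderiv` it is the sought derivative times the nonzero number `Θ (p Θ')`.
  have hc := (h.pencil (l z)).jacobi_const hU hz ξ (Θ z) (Θ' z)
  have e1 : p' z (Θ z) - l z • p z (Θ z) = 0 := sub_eq_zero.2 (hΘ.eigen z hz)
  have e2 : p' z (Θ' z) - l z • p z (Θ' z) = 0 := sub_eq_zero.2 (hΘ'.eigen z hz)
  have h1 := hΘ'.apply_fderiv h hU hz (p' z ξ - l z • p z ξ) (Θ z)
  simp only [sub_apply, smul_apply, e1, e2, map_zero,
    zero_apply, add_zero] at hc h1
  rw [hc] at h1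
  exact (mul_eq_zero.1 h1.symm).resolve_right hne

/-- The distribution `Im (p' - l p)` is involutive. -/
lemma IsEigenField.fderiv_comm {l : E → 𝕜} {Θ : E → E →L[𝕜] 𝕜}
    (hΘ : IsEigenField p p' U l Θ) (h : IsPencilOn p p' U) (hU : IsOpen U) {z : E} (hz : z ∈ U)
    (hl : ∀ ξ, fderiv 𝕜 l z (p' z ξ - l z • p z ξ) = 0) (ξ η : E →L[𝕜] 𝕜) :
    fderiv 𝕜 Θ z (p' z ξ - l z • p z ξ) (p' z η - l z • p z η)
      = fderiv 𝕜 Θ z (p' z η - l z • p z η) (p' z ξ - l z • p z ξ) := by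
  -- Now one term drops since `Θ z` is in the kernel. The other two, by `apply_fderiv` and `hl`, say
  -- that `dΘ` vanishes as a 2-form on the image of `p' - l p`.
  have hc := (h.pencil (l z)).jacobi_const hU hz ξ η (Θ z)
  have hs := (h.pencil (l z)).fderiv_skew hU hz (p' z η - l z • p z η) (Θ z) ξ
  have e1 : p' z (Θ z) - l z • p z (Θ z) = 0 := sub_eq_zero.2 (hΘ.eigen z hz)
  have h1 := hΘ.apply_fderiv h hU hz (p' z ξ - l z • p z ξ) η
  have h2 := hΘ.apply_fderiv h hU hz (p' z η - l z • p z η) ξ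
  rw [hl, zero_mul, zero_add] at h1 h2
  simp only [sub_apply, smul_apply, e1, map_zero,
    zero_apply, add_zero] at hc
  rw [h1, hs, h2] at hc
  linear_combination hc

end LocalPoisson

/-! ### Smooth extension of eigencovectors with a double eigenvalue. -/

section EigenFields

variable {𝕜 : Type*} [RCLike 𝕜]

/-- Smooth dependence on parameters of the solution `(η, λ, μ)` of a bordered eigenvalue problem
`p' η - λ p η + μ e = 0` with two normalization conditions. -/
lemma exists_bordered_eigenvector {X D F : Type*} [NormedAddCommGroup X] [NormedSpace 𝕜 X]
    [FiniteDimensional 𝕜 X] [NormedAddCommGroup D] [NormedSpace 𝕜 D] [FiniteDimensional 𝕜 D]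
    [NormedAddCommGroup F] [NormedSpace 𝕜 F] [FiniteDimensional 𝕜 F]
    (hdim : Module.finrank 𝕜 D = Module.finrank 𝕜 F) {p p' : X → D →L[𝕜] F} {U : Set X}
    (hU : IsOpen U) (hp : ContDiffOn 𝕜 ∞ p U) (hp' : ContDiffOn 𝕜 ∞ p' U) {z₀ : X} (hz₀ : z₀ ∈ U)
    {θ : D} {l : 𝕜} (hθ : p' z₀ θ = l • p z₀ θ) (a b : D →L[𝕜] 𝕜) (e : F)
    (hinj : ∀ (δ : D) (s m : 𝕜), p' z₀ δ - (l • p z₀ δ + s • p z₀ θ) + m • e = 0 → a δ = 0 →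
      b δ = 0 → δ = 0 ∧ s = 0 ∧ m = 0) :
    ∃ (V : Set X) (Θ : X → D) (L M : X → 𝕜), IsOpen V ∧ z₀ ∈ V ∧ V ⊆ U ∧ ContDiffOn 𝕜 ∞ Θ V ∧
      ContDiffOn 𝕜 ∞ L V ∧ Θ z₀ = θ ∧ L z₀ = l ∧
      ∀ z ∈ V, p' z (Θ z) - L z • p z (Θ z) + M z • e = 0 ∧ a (Θ z) = a θ := by
  have _ := FiniteDimensional.complete 𝕜 X
  have _ := FiniteDimensional.complete 𝕜 D
  -- In the application the eigenspace is a plane, so the eigenvalue equation with unknown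
  -- eigenvalue is still one dimension short of surjective linearization. The term `μ e` fills this
  -- gap, and the normalizations `a`, `b` fix the eigenvector; `hinj` and equality of dimensions
  -- make the linearization bijective.
  let ψ : X × D × 𝕜 × 𝕜 → F := fun x => p' x.1 x.2.1 - x.2.2.1 • p x.1 x.2.1 + x.2.2.2 • e
  let Ψ : X × D × 𝕜 × 𝕜 → X × F × 𝕜 × 𝕜 := fun x => (x.1, ψ x, a x.2.1, b x.2.1)
  let x₀ : X × D × 𝕜 × 𝕜 := (z₀, θ, l, 0)
  have hUo : IsOpen ((Prod.fst : X × D × 𝕜 × 𝕜 → X) ⁻¹' U) := hU.preimage continuous_fst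
  have hψ : ContDiffOn 𝕜 ∞ ψ (Prod.fst ⁻¹' U) := by
    have h1 : ContDiffOn 𝕜 ∞ (fun x : X × D × 𝕜 × 𝕜 => p x.1) (Prod.fst ⁻¹' U) :=
      hp.comp contDiff_fst.contDiffOn fun _ h => h
    have h2 : ContDiffOn 𝕜 ∞ (fun x : X × D × 𝕜 × 𝕜 => p' x.1) (Prod.fst ⁻¹' U) :=
      hp'.comp contDiff_fst.contDiffOn fun _ h => h
    have h3 : ContDiffOn 𝕜 ∞ (fun x : X × D × 𝕜 × 𝕜 => x.2.1) (Prod.fst ⁻¹' U) :=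
      contDiff_snd.fst.contDiffOn
    have h4 : ContDiffOn 𝕜 ∞ (fun x : X × D × 𝕜 × 𝕜 => x.2.2.1) (Prod.fst ⁻¹' U) :=
      contDiff_snd.snd.fst.contDiffOn
    have h5 : ContDiffOn 𝕜 ∞ (fun x : X × D × 𝕜 × 𝕜 => x.2.2.2) (Prod.fst ⁻¹' U) :=
      contDiff_snd.snd.snd.contDiffOn
    exact ((h2.clm_apply h3).sub (h4.smul (h1.clm_apply h3))).add (h5.smul contDiffOn_const)
  have hΨ : ContDiffOn 𝕜 ∞ Ψ (Prod.fst ⁻¹' U) :=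
    contDiff_fst.contDiffOn.prodMk (hψ.prodMk
      ((a.contDiff.comp contDiff_snd.fst).contDiffOn.prodMk
        (b.contDiff.comp contDiff_snd.fst).contDiffOn))
  have hψd : HasFDerivAt ψ (fderiv 𝕜 ψ x₀) x₀ :=
    ((hψ.contDiffAt (hUo.mem_nhds hz₀)).differentiableAt (by simp)).hasFDerivAt
  have hψv : ∀ (δ : D) (s m : 𝕜), fderiv 𝕜 ψ x₀ (0, δ, s, m)
      = p' z₀ δ - (l • p z₀ δ + s • p z₀ θ) + m • e := by
    intro δ s m
    let ι : D × 𝕜 × 𝕜 →L[𝕜] X × D × 𝕜 × 𝕜 := ContinuousLinearMap.inr 𝕜 X (D × 𝕜 × 𝕜)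
    have h1 : HasFDerivAt (fun w : D × 𝕜 × 𝕜 => ((z₀, w) : X × D × 𝕜 × 𝕜)) ι (θ, l, 0) :=
      hasFDerivAt_prodMk_right z₀ _
    have h2 : HasFDerivAt (fun w : D × 𝕜 × 𝕜 => ψ (z₀, w)) ((fderiv 𝕜 ψ x₀).comp ι) (θ, l, 0) :=
      HasFDerivAt.comp (g := ψ) (f := fun w : D × 𝕜 × 𝕜 => ((z₀, w) : X × D × 𝕜 × 𝕜)) _ hψd h1
    have hη : HasFDerivAt (fun w : D × 𝕜 × 𝕜 => w.1) (ContinuousLinearMap.fst 𝕜 D (𝕜 × 𝕜))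
      (θ, l, (0 : 𝕜)) := hasFDerivAt_fst
    have hl : HasFDerivAt (fun w : D × 𝕜 × 𝕜 => w.2.1) ((ContinuousLinearMap.fst 𝕜 𝕜 𝕜).comp
      (ContinuousLinearMap.snd 𝕜 D (𝕜 × 𝕜))) (θ, l, (0 : 𝕜)) := hasFDerivAt_snd.fst
    have hm : HasFDerivAt (fun w : D × 𝕜 × 𝕜 => w.2.2) ((ContinuousLinearMap.snd 𝕜 𝕜 𝕜).comp
      (ContinuousLinearMap.snd 𝕜 D (𝕜 × 𝕜))) (θ, l, (0 : 𝕜)) := hasFDerivAt_snd.snd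
    have h3 := (((p' z₀).hasFDerivAt.comp _ hη).sub (hl.smul ((p z₀).hasFDerivAt.comp _ hη))).add
      (hm.smul_const e)
    exact DFunLike.congr_fun (h2.unique h3) (δ, s, m)
  let Λ : X × D × 𝕜 × 𝕜 →L[𝕜] X × F × 𝕜 × 𝕜 :=
    (ContinuousLinearMap.fst 𝕜 X (D × 𝕜 × 𝕜)).prod ((fderiv 𝕜 ψ x₀).prod
      ((a.comp ((ContinuousLinearMap.fst 𝕜 D (𝕜 × 𝕜)).comp
        (ContinuousLinearMap.snd 𝕜 X (D × 𝕜 × 𝕜)))).prod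
       (b.comp ((ContinuousLinearMap.fst 𝕜 D (𝕜 × 𝕜)).comp
        (ContinuousLinearMap.snd 𝕜 X (D × 𝕜 × 𝕜))))))
  have hΛ : HasFDerivAt Ψ Λ x₀ :=
    hasFDerivAt_fst.prodMk (hψd.prodMk
      ((a.hasFDerivAt.comp x₀ hasFDerivAt_snd.fst).prodMk
        (b.hasFDerivAt.comp x₀ hasFDerivAt_snd.fst)))
  have hΛinj : Function.Injective Λ := by
    refine (injective_iff_map_eq_zero Λ).2 ?_
    rintro ⟨v, δ, s, m⟩ h
    have h1 : v = 0 := congrArg Prod.fst h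
    subst h1
    have h2 : fderiv 𝕜 ψ x₀ (0, δ, s, m) = 0 := congrArg (fun y => y.2.1) h
    have h3 : a δ = 0 := congrArg (fun y => y.2.2.1) h
    have h4 : b δ = 0 := congrArg (fun y => y.2.2.2) h
    rw [hψv] at h2
    obtain ⟨rfl, rfl, rfl⟩ := hinj δ s m h2 h3 h4
    rfl
  let Λe : (X × D × 𝕜 × 𝕜) ≃L[𝕜] X × F × 𝕜 × 𝕜 :=
    (LinearMap.linearEquivOfInjective (Λ : X × D × 𝕜 × 𝕜 →ₗ[𝕜] X × F × 𝕜 × 𝕜) hΛinj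
      (by simp [hdim])).toContinuousLinearEquiv
  have hΛe : HasFDerivAt Ψ (Λe : X × D × 𝕜 × 𝕜 →L[𝕜] X × F × 𝕜 × 𝕜) x₀ :=
    hΛ.congr_fderiv (ContinuousLinearMap.ext fun _ => rfl)
  obtain ⟨φ, hφ0, -, hφ, hφs⟩ := exists_openPartialHomeomorph hUo hΨ hz₀ Λe hΛe
  have hΨ0 : Ψ x₀ = (z₀, 0, a θ, b θ) := by simp [Ψ, ψ, x₀, hθ]
  let ι : X → X × F × 𝕜 × 𝕜 := fun z => (z, 0, a θ, b θ)
  have hι : ContDiff 𝕜 ∞ ι := contDiff_id.prodMk contDiff_const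
  let g : X → X × D × 𝕜 × 𝕜 := fun z => φ.symm (ι z)
  have hg0 : g z₀ = x₀ := by
    change φ.symm (z₀, 0, a θ, b θ) = x₀
    rw [← hΨ0, ← hφ, φ.left_inv hφ0]
  have hgs : ContDiffOn 𝕜 ∞ g (ι ⁻¹' φ.target) := hφs.comp hι.contDiffOn fun _ h => h
  refine ⟨U ∩ ι ⁻¹' φ.target, fun z => (g z).2.1, fun z => (g z).2.2.1, fun z => (g z).2.2.2,
    hU.inter (φ.open_target.preimage hι.continuous), ⟨hz₀, ?_⟩, Set.inter_subset_left,
    (contDiff_snd.fst.comp_contDiffOn hgs).mono Set.inter_subset_right,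
    (contDiff_snd.snd.fst.comp_contDiffOn hgs).mono Set.inter_subset_right,
    congrArg (fun x => x.2.1) hg0, congrArg (fun x => x.2.2.1) hg0, fun z hz => ?_⟩
  · have := φ.map_source hφ0
    rwa [hφ, hΨ0] at this
  · have h1 : Ψ (g z) = ι z := by rw [← hφ]; exact φ.right_inv hz.2
    have h2 : (g z).1 = z := congrArg Prod.fst h1
    have h3 : ψ (g z) = 0 := congrArg (fun y => y.2.1) h1
    have h4 : a (g z).2.1 = a θ := congrArg (fun y => y.2.2.1) h1
    refine ⟨?_, h4⟩
    simpa only [ψ, h2] using h3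

variable {E : Type*} [NormedAddCommGroup E] [NormedSpace 𝕜 E] [FiniteDimensional 𝕜 E]

/-- A hyperbolic pair of eigencovectors extends to smooth fields of eigencovectors. -/
lemma exists_eigenfield {p p' : E → (E →L[𝕜] 𝕜) →L[𝕜] E} {U : Set E} (hU : IsOpen U)
    (hp : IsPoissonOn p U) (hp' : IsPoissonOn p' U) {z₀ : E} (hz₀ : z₀ ∈ U)
    {θ θ' : E →L[𝕜] 𝕜} {l : 𝕜} (hθ : p' z₀ θ = l • p z₀ θ)
    (hθ' : p' z₀ θ' = l • p z₀ θ') (hne : θ (p z₀ θ') ≠ 0)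
    (hspan : ∀ ξ : E →L[𝕜] 𝕜, p' z₀ ξ = l • p z₀ ξ → ∃ a b : 𝕜, ξ = a • θ + b • θ') :
    ∃ (V : Set E) (L : E → 𝕜) (Θ : E → E →L[𝕜] 𝕜), IsOpen V ∧ z₀ ∈ V ∧ V ⊆ U ∧
      IsEigenField p p' V L Θ ∧ Θ z₀ = θ ∧ L z₀ = l := by
  have hz : ∀ {r : E → (E →L[𝕜] 𝕜) →L[𝕜] E}, IsPoissonOn r U → ∀ z ∈ U, ∀ ξ : E →L[𝕜] 𝕜,
      ξ (r z ξ) = 0 := fun hr z hz ξ => (hr.isSkew hz).self_eq_zero ξ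
  let ev : E → (E →L[𝕜] 𝕜) →L[𝕜] 𝕜 := fun v => ContinuousLinearMap.apply 𝕜 𝕜 v
  obtain ⟨V, Θ, L, M, hV, hzV, hVU, hΘ, hL, hΘ0, hL0, heq⟩ :=
    exists_bordered_eigenvector (D := E →L[𝕜] 𝕜) (F := E) finrank_continuousDual hU hp.smooth
      hp'.smooth hz₀ hθ (ev (p z₀ θ')) (ev (p z₀ θ)) (p z₀ θ') (by
      intro δ s m h1 h2 h3
      change δ (p z₀ θ') = 0 at h2
      change δ (p z₀ θ) = 0 at h3
      -- `θ` and `θ'` annihilate the image of `p' - l p` at `z₀`, so testing on them isolates `m`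
      -- and `s`. What remains of `δ` lies in the eigenplane and is killed by the two
      -- normalizations.
      have e1 := congrArg θ h1
      have e2 := congrArg θ' h1
      simp only [map_add, map_sub, map_smul, smul_eq_mul, map_zero, hz hp z₀ hz₀] at e1 e2
      rw [hp'.skew z₀ hz₀ θ, hp.skew z₀ hz₀ θ δ, hθ, map_smul, smul_eq_mul] at e1
      rw [hp'.skew z₀ hz₀ θ', hp.skew z₀ hz₀ θ' δ, hp.skew z₀ hz₀ θ' θ, hθ', map_smul,
        smul_eq_mul] at e2
      have hm : m = 0 := by
        refine (mul_eq_zero.1 (?_ : m * θ (p z₀ θ') = 0)).resolve_right hne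
        linear_combination e1
      have hs : s = 0 := by
        refine (mul_eq_zero.1 (?_ : s * θ (p z₀ θ') = 0)).resolve_right hne
        linear_combination e2
      subst hm hs
      obtain ⟨a, b, rfl⟩ := hspan δ (by
        rw [zero_smul, zero_smul, add_zero, add_zero] at h1
        exact sub_eq_zero.1 h1)
      have f2 : a * θ (p z₀ θ') + b * θ' (p z₀ θ') = 0 := h2
      have f3 : a * θ (p z₀ θ) + b * θ' (p z₀ θ) = 0 := h3
      rw [hz hp z₀ hz₀, mul_zero, add_zero] at f2
      rw [hz hp z₀ hz₀, mul_zero, zero_add, hp.skew z₀ hz₀] at f3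
      have ha : a = 0 := (mul_eq_zero.1 f2).resolve_right hne
      have hb : b = 0 := (mul_eq_zero.1 f3).resolve_right (neg_ne_zero.2 hne)
      refine ⟨ContinuousLinearMap.ext fun v => ?_, rfl, rfl⟩
      change a * θ v + b * θ' v = 0
      rw [ha, hb, zero_mul, zero_mul, add_zero])
  refine ⟨V, L, Θ, hV, hzV, hVU, ⟨hΘ, hL, fun z hzz => ?_⟩, hΘ0, hL0⟩
  obtain ⟨h1, h2⟩ := heq z hzz
  -- Pairing with `Θ z` itself removes the `p` and `p'` terms by skewness, so the correction `M z`
  -- vanishes: the double eigenvalue does not split.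
  have h3 := congrArg (Θ z) h1
  have h4 : Θ z (p z₀ θ') = θ (p z₀ θ') := h2
  simp only [map_add, map_sub, map_smul, smul_eq_mul, map_zero, hz hp z (hVU hzz),
    hz hp' z (hVU hzz), h4] at h3
  have hM : M z = 0 := by simpa [hne] using h3
  rw [hM, zero_smul, add_zero] at h1
  exact sub_eq_zero.1 h1

end EigenFields

/-! ### Antiderivatives with a parameter. -/

section Antiderivative

variable {𝕜 : Type*} [RCLike 𝕜]

/-- Antiderivative with respect to the second variable, depending smoothly on the first one. -/
lemma exists_antiderivative {f : 𝕜 × 𝕜 → 𝕜} {U : Set (𝕜 × 𝕜)} (hU : IsOpen U)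
    (hf : ContDiffOn 𝕜 ∞ f U) {b : 𝕜 × 𝕜} (hb : b ∈ U) :
    ∃ (V : Set (𝕜 × 𝕜)) (Y : 𝕜 × 𝕜 → 𝕜), IsOpen V ∧ b ∈ V ∧ V ⊆ U ∧ ContDiffOn 𝕜 ∞ Y V ∧
      ∀ q ∈ V, fderiv 𝕜 Y q (0, 1) = f q := by
  -- The parameter is carried as a constant first component of the unknown, with time centred at
  -- `b.2`. A one-dimensional time makes the curvature condition automatic.
  let κ : 𝕜 × 𝕜 × 𝕜 → 𝕜 × 𝕜 := fun q => (q.2.1, b.2 + q.1)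
  have hκ : ContDiff 𝕜 ∞ κ := contDiff_snd.fst.prodMk (contDiff_const.add contDiff_fst)
  let S : 𝕜 →L[𝕜] 𝕜 →L[𝕜] 𝕜 × 𝕜 := (ContinuousLinearMap.smulRightL 𝕜 𝕜 (𝕜 × 𝕜)
    (ContinuousLinearMap.id 𝕜 𝕜)).comp (ContinuousLinearMap.inr 𝕜 𝕜 𝕜)
  have hS : ∀ c t, S c t = (0, t * c) := fun c t => by simp [S]
  let F : 𝕜 × 𝕜 × 𝕜 → 𝕜 →L[𝕜] 𝕜 × 𝕜 := fun q => S (f (κ q))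
  have hF : ContDiffOn 𝕜 ∞ F (κ ⁻¹' U) :=
    S.contDiff.comp_contDiffOn (hf.comp hκ.contDiffOn fun _ h => h)
  obtain ⟨V, u, hV, hbV, hu, hu0, huF⟩ := exists_total_differential
    (hU.preimage hκ.continuous) hF (b₀ := (b.1, 0)) (by
      intro q _ h k
      have e : ∀ t : 𝕜, ((t, F q t) : 𝕜 × 𝕜 × 𝕜) = t • ((1, F q 1) : 𝕜 × 𝕜 × 𝕜) := fun t => by
        simp [F, hS]
      have e' : ∀ (A : 𝕜 →L[𝕜] 𝕜 × 𝕜) (t : 𝕜), A t = t • A 1 := fun A t => by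
        rw [← map_smul, smul_eq_mul, mul_one]
      rw [e h, e k, map_smul, map_smul, smul_apply, smul_apply, e' _ k, e' _ h, smul_comm])
    (by simpa [κ] using hb)
  let j : 𝕜 × 𝕜 → 𝕜 × 𝕜 × 𝕜 := fun q => (q.2 - b.2, q.1, 0)
  have hj : ContDiff 𝕜 ∞ j :=
    (contDiff_snd.sub contDiff_const).prodMk (contDiff_fst.prodMk contDiff_const)
  obtain ⟨ε, hε, hball⟩ := Metric.isOpen_iff.1 (hV.preimage hj.continuous) b (by
    simpa [j] using hbV)
  have hfst : ∀ q ∈ Metric.ball b ε, (u (j q)).1 = q.1 := by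
    intro q hq
    rw [← ball_prod_same] at hq hball
    have hmem : ∀ t ∈ Metric.ball b.2 ε, j (q.1, t) ∈ V := fun t ht => hball ⟨hq.1, ht⟩
    have hd : ∀ t ∈ Metric.ball b.2 ε,
        HasFDerivAt (fun t => (u (j (q.1, t))).1) (0 : 𝕜 →L[𝕜] 𝕜) t := by
      intro t ht
      have h1 := (huF _ (hmem t ht)).2
      have h2 : HasFDerivAt (fun t : 𝕜 => t - b.2) (ContinuousLinearMap.id 𝕜 𝕜) t :=
        (hasFDerivAt_id t).sub_const _
      have h3 := (HasFDerivAt.comp (g := fun x => u (x, (j (q.1, t)).2)) t h1 h2).fst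
      refine h3.congr_fderiv (ContinuousLinearMap.ext fun v => ?_)
      simp [F, hS]
    have hconn : IsPreconnected (Metric.ball b.2 ε) := by
      let _ : NormedSpace ℝ 𝕜 := NormedSpace.restrictScalars ℝ 𝕜 𝕜
      exact (convex_ball b.2 ε).isPreconnected
    have h4 := Metric.isOpen_ball.is_const_of_fderiv_eq_zero hconn
      (fun t ht => (hd t ht).differentiableAt.differentiableWithinAt)
      (fun t ht => (hd t ht).fderiv) hq.2 (Metric.mem_ball_self hε)
    have h5 : u (j (q.1, b.2)) = (q.1, 0) := by
      have := hu0 (q.1, 0) (by simpa [j] using hmem b.2 (Metric.mem_ball_self hε))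
      simpa [j] using this
    have h6 : (u (j (q.1, b.2))).1 = q.1 := by rw [h5]
    exact h4.trans h6
  have hκu : ∀ q ∈ Metric.ball b ε, κ ((j q).1, u (j q)) = q := fun q hq => by
    simp only [κ, hfst q hq, j, add_sub_cancel]
  have hY : ContDiffOn 𝕜 ∞ (fun q => (u (j q)).2) (Metric.ball b ε) :=
    contDiff_snd.comp_contDiffOn (hu.comp hj.contDiffOn hball)
  refine ⟨Metric.ball b ε, fun q => (u (j q)).2, Metric.isOpen_ball, Metric.mem_ball_self hε,
    fun q hq => ?_, hY, fun q hq => ?_⟩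
  · have h1 : κ ((j q).1, u (j q)) ∈ U := (huF _ (hball hq)).1
    rwa [hκu q hq] at h1
  · have h1 := (huF _ (hball hq)).2
    have h2 : HasFDerivAt (fun t : 𝕜 => t - b.2) (ContinuousLinearMap.id 𝕜 𝕜) q.2 :=
      (hasFDerivAt_id q.2).sub_const _
    have h3 := (HasFDerivAt.comp (g := fun x => u (x, (j q).2)) q.2 h1 h2).snd
    have h4 := ((hY.contDiffAt (Metric.isOpen_ball.mem_nhds hq)).differentiableAt
      (by simp)).hasFDerivAt
    have h5 : HasFDerivAt (fun t : 𝕜 => (q.1, t)) (ContinuousLinearMap.inr 𝕜 𝕜 𝕜) q.2 :=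
      hasFDerivAt_prodMk_right q.1 q.2
    have h6 := HasFDerivAt.comp (g := fun q => (u (j q)).2) (f := fun t : 𝕜 => (q.1, t)) q.2 h4 h5
    have h7 := DFunLike.congr_fun (h6.unique h3) 1
    simpa [F, hS, hκu q hq] using h7

end Antiderivative

/-! ### The image of the recursion operator shifted by an eigenvalue. -/

section SkewForms

/-- A vector orthogonal to the `i`-th pair of a frame of eigenvectors is in the range of the
recursion operator minus the `i`-th eigenvalue. -/
lemma IsFrame.exists_preimage {𝕜 V : Type*} [Field 𝕜] [AddCommGroup V] [Module 𝕜 V] [CharZero 𝕜]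
    [FiniteDimensional 𝕜 V] {n : ℕ} (hn : Module.finrank 𝕜 V = 2 * n)
    {Ω Ω' : V →ₗ[𝕜] V →ₗ[𝕜] 𝕜} (hΩ : IsSkew Ω) {l : Fin n → 𝕜} (hl : Function.Injective l)
    {θ θ' : Fin n → V} (hθ : ∀ i, IsEigen Ω Ω' (l i) (θ i))
    (hθ' : ∀ i, IsEigen Ω Ω' (l i) (θ' i)) (hf : IsFrame Ω θ θ') {i : Fin n} {η : V}
    (h : Ω η (θ i) = 0) (h' : Ω η (θ' i) = 0) :
    ∃ ξ, ∀ ζ, Ω' ζ ξ - l i * Ω ζ ξ = Ω ζ η := by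
  obtain ⟨a, b, hab⟩ := hf.exists_coeff hn hΩ η
  have h1 := hf.sum_pair_left hΩ a b i
  have h2 := hf.sum_pair_right hΩ a b i
  rw [← hab, h] at h1
  rw [← hab, h'] at h2
  have hb : b i = 0 := by simpa [hf.pair i] using h1.symm
  have ha : a i = 0 := by simpa [hf.pair i] using h2.symm
  -- For `j = i` the inverse is `0⁻¹ = 0`, harmless because `a i = b i = 0`.
  refine ⟨∑ j, (l j - l i)⁻¹ • (a j • θ j + b j • θ' j), fun ζ => ?_⟩
  rw [hab]
  simp only [map_sum, map_smul, map_add, smul_eq_mul, Finset.mul_sum, ← Finset.sum_sub_distrib]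
  refine Finset.sum_congr rfl fun j _ => ?_
  rw [hθ j ζ, hθ' j ζ]
  by_cases hj : j = i
  · subst hj
    simp [ha, hb]
  · have : l j - l i ≠ 0 := sub_ne_zero.2 (hl.ne hj)
    field_simp

end SkewForms

/-! ### Pairs of eigenfields and their first integrals. -/

section DNCoordinates

variable {𝕜 : Type*} [RCLike 𝕜] {E : Type*} [NormedAddCommGroup E] [NormedSpace 𝕜 E]
  {p p' : E → (E →L[𝕜] 𝕜) →L[𝕜] E}

lemma IsPoissonOn.mono {r : E → (E →L[𝕜] 𝕜) →L[𝕜] E} {U V : Set E} (h : IsPoissonOn r U)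
    (hV : V ⊆ U) : IsPoissonOn r V where
  skew z hz := h.skew z (hV hz)
  smooth := h.smooth.mono hV
  jacobi W f g k hW hWV := h.jacobi W f g k hW (hWV.trans hV)

lemma IsPencilOn.mono {U V : Set E} (h : IsPencilOn p p' U) (hV : V ⊆ U) : IsPencilOn p p' V where
  poisson := h.poisson.mono hV
  poisson' := h.poisson'.mono hV
  pencil c := (h.pencil c).mono hV
  bijective z hz := h.bijective z (hV hz)

lemma IsEigenField.mono {U V : Set E} {L : E → 𝕜} {Θ : E → E →L[𝕜] 𝕜}
    (h : IsEigenField p p' U L Θ) (hV : V ⊆ U) : IsEigenField p p' V L Θ where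
  smooth := h.smooth.mono hV
  smooth_eigenvalue := h.smooth_eigenvalue.mono hV
  eigen z hz := h.eigen z (hV hz)

lemma contDiffOn_localBracket {r : E → (E →L[𝕜] 𝕜) →L[𝕜] E} {U : Set E} (hU : IsOpen U)
    (hr : ContDiffOn 𝕜 ∞ r U) {f g : E → 𝕜} (hf : ContDiffOn 𝕜 ∞ f U) (hg : ContDiffOn 𝕜 ∞ g U) :
    ContDiffOn 𝕜 ∞ (localBracket r f g) U :=
  (hf.fderiv_of_isOpen hU (by simp)).clm_apply
    (hr.clm_apply (hg.fderiv_of_isOpen hU (by simp)))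

variable [FiniteDimensional 𝕜 E]

/-- A hyperbolic pair of eigencovectors extends to fields of eigencovectors with a common smooth
eigenvalue. -/
lemma exists_eigenfield_pair {U : Set E} (hU : IsOpen U) (hp : IsPencilOn p p' U)
    {z₀ : E} (hz₀ : z₀ ∈ U) {θ θ' : E →L[𝕜] 𝕜} {l : 𝕜} (hθ : p' z₀ θ = l • p z₀ θ)
    (hθ' : p' z₀ θ' = l • p z₀ θ') (hne : θ (p z₀ θ') ≠ 0)
    (hspan : ∀ ξ : E →L[𝕜] 𝕜, p' z₀ ξ = l • p z₀ ξ → ∃ a b : 𝕜, ξ = a • θ + b • θ') :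
    ∃ (V : Set E) (L : E → 𝕜) (Θ Θ' : E → E →L[𝕜] 𝕜), IsOpen V ∧ z₀ ∈ V ∧ V ⊆ U ∧
      IsEigenField p p' V L Θ ∧ IsEigenField p p' V L Θ' ∧ L z₀ = l ∧
      ∀ z ∈ V, Θ z (p z (Θ' z)) ≠ 0 := by
  have hne' : θ' (p z₀ θ) ≠ 0 := by
    rw [hp.poisson.skew z₀ hz₀]
    exact neg_ne_zero.2 hne
  obtain ⟨V, L, Θ, hV, hzV, hVU, hΘ, hΘ0, hL0⟩ :=
    exists_eigenfield hU hp.poisson hp.poisson' hz₀ hθ hθ' hne hspan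
  obtain ⟨V', L', Θ', hV', hzV', hVU', hΘ', hΘ0', hL0'⟩ :=
    exists_eigenfield hU hp.poisson hp.poisson' hz₀ hθ' hθ hne' fun ξ hξ => by
      obtain ⟨a, b, h⟩ := hspan ξ hξ
      exact ⟨b, a, by rw [h, add_comm]⟩
  have h1 := hΘ.mono (Set.inter_subset_left (s := V) (t := V'))
  have h2 := hΘ'.mono (Set.inter_subset_right (s := V) (t := V'))
  have hVV : V ∩ V' ⊆ U := Set.inter_subset_left.trans hVU
  have hc : ContinuousOn (fun z => Θ z (p z (Θ' z))) (V ∩ V') :=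
    (h1.smooth.clm_apply ((hp.poisson.smooth.mono hVV).clm_apply h2.smooth)).continuousOn
  let W := (V ∩ V') ∩ (fun z => Θ z (p z (Θ' z))) ⁻¹' {0}ᶜ
  have hW : IsOpen W := hc.isOpen_inter_preimage (hV.inter hV') isOpen_compl_singleton
  have hWV : W ⊆ V ∩ V' := Set.inter_subset_left
  refine ⟨W, L, Θ, Θ', hW, ⟨⟨hzV, hzV'⟩, ?_⟩, hWV.trans hVV, h1.mono hWV,
    ⟨h2.smooth.mono hWV, h1.smooth_eigenvalue.mono hWV, fun z hz => ?_⟩, hL0, fun z hz => hz.2⟩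
  · simpa [hΘ0, hΘ0'] using hne
  · have hzU := hVV (hWV hz)
    have e1 := isEigen_pairing (A := (p z : (E →L[𝕜] 𝕜) →ₗ[𝕜] E))
      (A' := (p' z : (E →L[𝕜] 𝕜) →ₗ[𝕜] E)).2 (h1.eigen z (hWV hz))
    have e2 := isEigen_pairing (A := (p z : (E →L[𝕜] 𝕜) →ₗ[𝕜] E))
      (A' := (p' z : (E →L[𝕜] 𝕜) →ₗ[𝕜] E)).2 (h2.eigen z (hWV hz))
    -- The two extensions come with their own eigenvalues; if these differed, the fields would be
    -- orthogonal.
    have hLL : L z = L' z := by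
      by_contra hcon
      exact hz.2 (e1.orth (hp.poisson.isSkew hzU) (hp.poisson'.isSkew hzU) e2 hcon)
    rw [hLL]
    exact h2.eigen z (hWV hz)

/-- Functions whose differentials are eigencovectors, from a pair of fields of eigencovectors. -/
lemma exists_eigenfunctions {U : Set E} (hU : IsOpen U) (hp : IsPencilOn p p' U) {z₀ : E}
    (hz₀ : z₀ ∈ U) {L : E → 𝕜} {Θ Θ' : E → E →L[𝕜] 𝕜} (hΘ : IsEigenField p p' U L Θ)
    (hΘ' : IsEigenField p p' U L Θ') (hne : ∀ z ∈ U, Θ z (p z (Θ' z)) ≠ 0)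
    (hrange : ∀ z ∈ U, ∀ v, Θ z v = 0 → Θ' z v = 0 → ∃ ξ : E →L[𝕜] 𝕜,
      v = p' z ξ - L z • p z ξ) :
    ∃ (V : Set E) (x y : E → 𝕜), IsOpen V ∧ z₀ ∈ V ∧ V ⊆ U ∧ ContDiffOn 𝕜 ∞ x V ∧
      ContDiffOn 𝕜 ∞ y V ∧
      (∀ z ∈ V, p' z (fderiv 𝕜 x z) = L z • p z (fderiv 𝕜 x z) ∧
        p' z (fderiv 𝕜 y z) = L z • p z (fderiv 𝕜 y z)) ∧
      ∀ a b : 𝕜, ∃ v, fderiv 𝕜 x z₀ v = a ∧ fderiv 𝕜 y z₀ v = b := by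
  let q : E → E →L[𝕜] 𝕜 × 𝕜 := fun z => (Θ z).prod (Θ' z)
  let C : (E →L[𝕜] 𝕜) × (E →L[𝕜] 𝕜) →L[𝕜] (E →L[𝕜] 𝕜 × 𝕜) :=
    (ContinuousLinearMap.prodₗᵢ 𝕜 : _ ≃ₗᵢ[𝕜] (E →L[𝕜] 𝕜 × 𝕜)).toContinuousLinearEquiv
  have hq : ContDiffOn 𝕜 ∞ q U := by
    have hC : ContDiff 𝕜 ∞ C := ContinuousLinearMap.contDiff _
    exact hC.comp_contDiffOn (hΘ.smooth.prodMk hΘ'.smooth)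
  have hqd : ∀ z ∈ U, ∀ v w, fderiv 𝕜 q z v w = (fderiv 𝕜 Θ z v w, fderiv 𝕜 Θ' z v w) := by
    intro z hz v w
    have h1 : HasFDerivAt Θ (fderiv 𝕜 Θ z) z :=
      ((hΘ.smooth.contDiffAt (hU.mem_nhds hz)).differentiableAt (by simp)).hasFDerivAt
    have h2 : HasFDerivAt Θ' (fderiv 𝕜 Θ' z) z :=
      ((hΘ'.smooth.contDiffAt (hU.mem_nhds hz)).differentiableAt (by simp)).hasFDerivAt
    have h3 : HasFDerivAt q (C.comp ((fderiv 𝕜 Θ z).prod (fderiv 𝕜 Θ' z))) z :=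
      HasFDerivAt.comp (g := C) (f := fun z => (Θ z, Θ' z)) z C.hasFDerivAt (h1.prodMk h2)
    rw [h3.fderiv]
    rfl
  have hcas : ∀ z ∈ U, ∀ ξ : E →L[𝕜] 𝕜, fderiv 𝕜 L z (p' z ξ - L z • p z ξ) = 0 :=
    fun z hz ξ => hΘ.fderiv_eigenvalue hΘ' hp hU hz (hne z hz) ξ
  -- Common kernel vectors of `Θ` and `Θ'` are images under `p' - L p`, where `fderiv_comm` supplies
  -- involutivity.
  obtain ⟨V, β, hV, hzV, hVU, hβ, hker, hsurj⟩ := exists_first_integrals hU hq (by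
    intro z hz v w hv hw
    obtain ⟨ξ, rfl⟩ := hrange z hz v (congrArg Prod.fst hv) (congrArg Prod.snd hv)
    obtain ⟨η, rfl⟩ := hrange z hz w (congrArg Prod.fst hw) (congrArg Prod.snd hw)
    rw [hqd z hz, hqd z hz, hΘ.fderiv_comm hp hU hz (hcas z hz),
      hΘ'.fderiv_comm hp hU hz (hcas z hz)]) hz₀ (by
    have hz := hp.poisson.isSkew hz₀
    rintro ⟨a, b⟩
    have h0 := hne z₀ hz₀
    have e1 : Θ' z₀ (p z₀ (Θ z₀)) = -Θ z₀ (p z₀ (Θ' z₀)) := hp.poisson.skew z₀ hz₀ _ _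
    have e2 : Θ z₀ (p z₀ (Θ z₀)) = 0 := hz.self_eq_zero _
    have e3 : Θ' z₀ (p z₀ (Θ' z₀)) = 0 := hz.self_eq_zero _
    refine ⟨(a / Θ z₀ (p z₀ (Θ' z₀))) • p z₀ (Θ' z₀)
      - (b / Θ z₀ (p z₀ (Θ' z₀))) • p z₀ (Θ z₀), ?_⟩
    simp only [q, ContinuousLinearMap.prod_apply, map_sub, map_smul, e1, e2, e3, Prod.smul_mk,
      Prod.mk_sub_mk, smul_eq_mul, mul_zero, sub_zero, zero_sub, mul_neg, neg_neg]
    rw [div_mul_cancel₀ _ h0, div_mul_cancel₀ _ h0])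
  have hβd : ∀ z ∈ V, HasFDerivAt β (fderiv 𝕜 β z) z := fun z hz =>
    ((hβ.contDiffAt (hV.mem_nhds hz)).differentiableAt (by simp)).hasFDerivAt
  have hx : ∀ z ∈ V, ∀ v, fderiv 𝕜 (fun z => (β z).1) z v = (fderiv 𝕜 β z v).1 := fun z hz v => by
    rw [(hβd z hz).fst.fderiv]; rfl
  have hy : ∀ z ∈ V, ∀ v, fderiv 𝕜 (fun z => (β z).2) z v = (fderiv 𝕜 β z v).2 := fun z hz v => by
    rw [(hβd z hz).snd.fderiv]; rfl
  have hIm : ∀ z ∈ V, ∀ ξ : E →L[𝕜] 𝕜, fderiv 𝕜 β z (p' z ξ - L z • p z ξ) = 0 := by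
    intro z hz ξ
    have key : ∀ {T : E → E →L[𝕜] 𝕜}, IsEigenField p p' U L T →
        T z (p' z ξ - L z • p z ξ) = 0 := fun {T} hT => by
      rw [map_sub, map_smul, hp.poisson'.skew z (hVU hz), hp.poisson.skew z (hVU hz) (T z),
        hT.eigen z (hVU hz)]
      simp
    exact hker z hz _ (Prod.ext (key hΘ) (key hΘ'))
  -- By skewness, the annihilator of the image of `p' - L p` is its kernel.
  have hEig : ∀ z ∈ V, ∀ α : E →L[𝕜] 𝕜, (∀ ξ : E →L[𝕜] 𝕜, α (p' z ξ - L z • p z ξ) = 0) →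
      p' z α = L z • p z α := by
    intro z hz α hα
    refine sub_eq_zero.1 (SeparatingDual.eq_zero_of_forall_dual_eq_zero (R := 𝕜) fun ξ => ?_)
    have h1 := hα ξ
    rw [map_sub, map_smul, hp.poisson'.skew z (hVU hz), hp.poisson.skew z (hVU hz) α] at h1
    rw [map_sub, map_smul]
    simp only [smul_eq_mul] at h1 ⊢
    linear_combination -h1
  refine ⟨V, fun z => (β z).1, fun z => (β z).2, hV, hzV, hVU, contDiff_fst.comp_contDiffOn hβ,
    contDiff_snd.comp_contDiffOn hβ, fun z hz => ⟨hEig z hz _ fun ξ => ?_, hEig z hz _ fun ξ => ?_⟩,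
    fun a b => ?_⟩
  · rw [hx z hz, hIm z hz]; rfl
  · rw [hy z hz, hIm z hz]; rfl
  · obtain ⟨v, hv⟩ := hsurj (a, b)
    exact ⟨v, by rw [hx _ hzV, hv], by rw [hy _ hzV, hv]⟩

end DNCoordinates

/-! ### Systems of eigenfunctions near a regular point. -/

section DNCoordinates

variable {𝕜 : Type*} [RCLike 𝕜] {E : Type*} [NormedAddCommGroup E] [NormedSpace 𝕜 E]
  {p p' : E → (E →L[𝕜] 𝕜) →L[𝕜] E} {n : ℕ} {x y : Fin n → E → 𝕜}

/-- Functions `x_i`, `y_i` whose differentials are hyperbolic pairs of eigencovectors. -/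
structure IsEigenSystem (p p' : E → (E →L[𝕜] 𝕜) →L[𝕜] E) (U : Set E)
    (x y : Fin n → E → 𝕜) : Prop where
  smooth_x : ∀ i, ContDiffOn 𝕜 ∞ (x i) U
  smooth_y : ∀ i, ContDiffOn 𝕜 ∞ (y i) U
  eigen : ∀ z ∈ U, ∃ l : Fin n → 𝕜, Function.Injective l ∧ ∀ i,
    p' z (fderiv 𝕜 (x i) z) = l i • p z (fderiv 𝕜 (x i) z) ∧
    p' z (fderiv 𝕜 (y i) z) = l i • p z (fderiv 𝕜 (y i) z)
  pair : ∀ z ∈ U, ∀ i, localBracket p (x i) (y i) z ≠ 0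

lemma IsEigenSystem.mono {U V : Set E} (h : IsEigenSystem p p' U x y) (hV : V ⊆ U) :
    IsEigenSystem p p' V x y where
  smooth_x i := (h.smooth_x i).mono hV
  smooth_y i := (h.smooth_y i).mono hV
  eigen z hz := h.eigen z (hV hz)
  pair z hz := h.pair z (hV hz)

lemma IsEigenSystem.isFrame {U : Set E} (h : IsEigenSystem p p' U x y) (hp : IsPencilOn p p' U)
    {z : E} (hz : z ∈ U) : IsFrame (pairing (p z : (E →L[𝕜] 𝕜) →ₗ[𝕜] E))
      (fun i => fderiv 𝕜 (x i) z) (fun i => fderiv 𝕜 (y i) z) := by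
  obtain ⟨l, hl, hxy⟩ := h.eigen z hz
  exact IsFrame.of_eigen (Ω' := pairing (p' z : (E →L[𝕜] 𝕜) →ₗ[𝕜] E))
    (hp.poisson.isSkew hz) (hp.poisson'.isSkew hz) hl
    (fun i => isEigen_pairing.2 (hxy i).1) (fun i => isEigen_pairing.2 (hxy i).2) (h.pair z hz)

variable [FiniteDimensional 𝕜 E]

/-- Around a point with distinct eigenvalues there is a system of functions whose differentials
are hyperbolic pairs of eigencovectors. -/
lemma exists_eigenSystem (hn : Module.finrank 𝕜 E = 2 * n) {U : Set E} (hU : IsOpen U)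
    (hp : IsPencilOn p p' U) {z₀ : E} (hz₀ : z₀ ∈ U) {l : Fin n → 𝕜} (hl : Function.Injective l)
    {θ : Fin n → E →L[𝕜] 𝕜} (hθ : ∀ i, p' z₀ (θ i) = l i • p z₀ (θ i)) (hθ0 : ∀ i, θ i ≠ 0) :
    ∃ (V : Set E) (x y : Fin n → E → 𝕜), IsOpen V ∧ z₀ ∈ V ∧ V ⊆ U ∧
      IsEigenSystem p p' V x y := by
  have hn' : Module.finrank 𝕜 (E →L[𝕜] 𝕜) = 2 * n := finrank_continuousDual.trans hn
  have hΩ := hp.poisson.isSkew hz₀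
  have hΩ' := hp.poisson'.isSkew hz₀
  have hnd := pairing_nondegenerate (A := (p z₀ : (E →L[𝕜] 𝕜) →ₗ[𝕜] E)) (hp.bijective z₀ hz₀).1
  have hθe : ∀ i, IsEigen (pairing (p z₀ : (E →L[𝕜] 𝕜) →ₗ[𝕜] E))
    (pairing (p' z₀ : (E →L[𝕜] 𝕜) →ₗ[𝕜] E)) (l i) (θ i) := fun i => isEigen_pairing.2 (hθ i)
  obtain ⟨θ', hθ', hne⟩ := exists_hyperbolic_partner hn' hΩ hΩ' hnd hl hθe hθ0
  have hframe := IsFrame.of_eigen hΩ hΩ' hl hθe hθ' hne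
  have hspan : ∀ i (ξ : E →L[𝕜] 𝕜), p' z₀ ξ = l i • p z₀ ξ →
      ∃ a b : 𝕜, ξ = a • θ i + b • θ' i := fun i ξ hξ =>
    hframe.eq_of_eigen hn' hΩ hΩ' hl hθe hθ' (isEigen_pairing.2 hξ)
  choose V L Θ Θ' hV hzV hVU hΘ hΘ' hL hpair using fun i =>
    exists_eigenfield_pair hU hp hz₀ (hθ i) (isEigen_pairing.1 (hθ' i)) (hne i) (hspan i)
  let Vi : Set E := U ∩ ⋂ i, V i
  have hVi : IsOpen Vi := hU.inter (isOpen_iInter_of_finite hV)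
  have hViV : ∀ i, Vi ⊆ V i := fun i z hz => Set.mem_iInter.1 hz.2 i
  have hLc : ContinuousOn (fun z i => L i z) Vi :=
    continuousOn_pi.2 fun i => ((hΘ i).mono (hViV i)).smooth_eigenvalue.continuousOn
  have hinj : IsOpen {t : Fin n → 𝕜 | Function.Injective t} := by
    have : {t : Fin n → 𝕜 | Function.Injective t}
        = ⋂ i, ⋂ j, ⋂ (_ : i ≠ j), {t : Fin n → 𝕜 | t i ≠ t j} := by
      ext t
      simp only [Set.mem_ofPred_eq, Set.mem_iInter]
      exact ⟨fun h i j hij => h.ne hij, fun h i j hij => by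
        by_contra hcon; exact h i j hcon hij⟩
    rw [this]
    refine isOpen_iInter_of_finite fun i => isOpen_iInter_of_finite fun j =>
      isOpen_iInter_of_finite fun _ => ?_
    exact isOpen_ne_fun (continuous_apply i) (continuous_apply j)
  let W : Set E := Vi ∩ (fun z i => L i z) ⁻¹' {t | Function.Injective t}
  have hW : IsOpen W := hLc.isOpen_inter_preimage hVi hinj
  have hzW : z₀ ∈ W := by
    refine ⟨⟨hz₀, Set.mem_iInter.2 hzV⟩, ?_⟩
    change Function.Injective fun i => L i z₀
    simpa [hL] using hl
  have hWU : W ⊆ U := fun z hz => hz.1.1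
  have hWV : ∀ i, W ⊆ V i := fun i z hz => hViV i hz.1
  have hpW := hp.mono hWU
  have hfr : ∀ z ∈ W, IsFrame (pairing (p z : (E →L[𝕜] 𝕜) →ₗ[𝕜] E))
      (fun i => Θ i z) (fun i => Θ' i z) := fun z hz =>
    IsFrame.of_eigen (Ω' := pairing (p' z : (E →L[𝕜] 𝕜) →ₗ[𝕜] E)) (l := fun i => L i z)
      (hpW.poisson.isSkew hz) (hpW.poisson'.isSkew hz) hz.2
      (fun i => isEigen_pairing.2 ((hΘ i).eigen z (hWV i hz)))
      (fun i => isEigen_pairing.2 ((hΘ' i).eigen z (hWV i hz)))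
      (fun i => hpair i z (hWV i hz))
  have hrange : ∀ i, ∀ z ∈ W, ∀ v, Θ i z v = 0 → Θ' i z v = 0 → ∃ ξ : E →L[𝕜] 𝕜,
      v = p' z ξ - L i z • p z ξ := by
    intro i z hz v h1 h2
    obtain ⟨η, rfl⟩ := (hpW.bijective z hz).2 v
    obtain ⟨ξ, hξ⟩ := IsFrame.exists_preimage (Ω' := pairing (p' z : (E →L[𝕜] 𝕜) →ₗ[𝕜] E)) hn'
      (hpW.poisson.isSkew hz) (l := fun i => L i z) hz.2
      (fun i => isEigen_pairing.2 ((hΘ i).eigen z (hWV i hz)))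
      (fun i => isEigen_pairing.2 ((hΘ' i).eigen z (hWV i hz))) (hfr z hz) (i := i) (η := η)
      (by rw [hpW.poisson.isSkew hz]; exact neg_eq_zero.2 h1)
      (by rw [hpW.poisson.isSkew hz]; exact neg_eq_zero.2 h2)
    refine ⟨ξ, sub_eq_zero.1 (SeparatingDual.eq_zero_of_forall_dual_eq_zero (R := 𝕜)
      fun ζ => ?_)⟩
    have h3 := hξ ζ
    simp only [pairing_apply, ContinuousLinearMap.coe_coe] at h3
    simp only [map_sub, map_smul, smul_eq_mul]
    linear_combination -h3
  choose V' x y hV' hzV' hVW hx hy hxy hsurj using fun i =>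
    exists_eigenfunctions hW hpW hzW ((hΘ i).mono (hWV i)) ((hΘ' i).mono (hWV i))
      (fun z hz => hpair i z (hWV i hz)) (hrange i)
  let W' : Set E := W ∩ ⋂ i, V' i
  have hW' : IsOpen W' := hW.inter (isOpen_iInter_of_finite hV')
  have hWV' : ∀ i, W' ⊆ V' i := fun i z hz => Set.mem_iInter.1 hz.2 i
  have hW'U : W' ⊆ U := fun z hz => hWU hz.1
  have hbc : ContinuousOn (fun z i => localBracket p (x i) (y i) z) W' :=
    continuousOn_pi.2 fun i => (contDiffOn_localBracket hW' (hp.poisson.smooth.mono hW'U)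
      ((hx i).mono (hWV' i)) ((hy i).mono (hWV' i))).continuousOn
  have hne0 : IsOpen {t : Fin n → 𝕜 | ∀ i, t i ≠ 0} := by
    have : {t : Fin n → 𝕜 | ∀ i, t i ≠ 0} = ⋂ i, {t : Fin n → 𝕜 | t i ≠ 0} := by ext; simp
    rw [this]
    exact isOpen_iInter_of_finite fun i => isOpen_ne_fun (continuous_apply i) continuous_const
  refine ⟨W' ∩ (fun z i => localBracket p (x i) (y i) z) ⁻¹' {t | ∀ i, t i ≠ 0}, x, y,
    hbc.isOpen_inter_preimage hW' hne0, ⟨⟨hzW, Set.mem_iInter.2 hzV'⟩, fun i => ?_⟩,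
    Set.inter_subset_left.trans hW'U, ⟨fun i => (hx i).mono (Set.inter_subset_left.trans (hWV' i)),
    fun i => (hy i).mono (Set.inter_subset_left.trans (hWV' i)),
    fun z hz => ⟨fun i => L i z, hz.1.1.2, fun i => hxy i z (hWV' i hz.1)⟩, fun z hz => hz.2⟩⟩
  obtain ⟨h1, h2⟩ := hxy i z₀ (hzV' i)
  rw [hL] at h1 h2
  obtain ⟨a, b, hab⟩ := hspan i _ h1
  obtain ⟨c, d, hcd⟩ := hspan i _ h2
  obtain ⟨v, hv1, hv2⟩ := hsurj i 1 0
  obtain ⟨w, hw1, hw2⟩ := hsurj i 0 1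
  change fderiv 𝕜 (x i) z₀ (p z₀ (fderiv 𝕜 (y i) z₀)) ≠ 0
  have hs1 : θ i (p z₀ (θ i)) = 0 := hΩ.self_eq_zero (θ i)
  have hs2 : θ' i (p z₀ (θ' i)) = 0 := hΩ.self_eq_zero (θ' i)
  have hs3 : θ' i (p z₀ (θ i)) = -θ i (p z₀ (θ' i)) := hΩ (θ' i) (θ i)
  -- The bracket at `z₀` is the determinant of `(dx_i, dy_i)` in the basis `θ i`, `θ' i`, times the
  -- pairing of that basis. Independence of `dx_i` and `dy_i` makes the determinant nonzero.
  have hdet : fderiv 𝕜 (x i) z₀ (p z₀ (fderiv 𝕜 (y i) z₀))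
      = (a * d - b * c) * θ i (p z₀ (θ' i)) := by
    rw [hab, hcd, map_add, map_smul, map_smul, map_add, map_smul, map_smul]
    simp only [add_apply, smul_apply, hs1, hs2, hs3, smul_eq_mul]
    ring
  rw [hdet]
  refine mul_ne_zero (fun h0 => ?_) (hne i)
  rw [hab] at hv1 hw1
  rw [hcd] at hv2 hw2
  simp only [add_apply, smul_apply, smul_eq_mul] at hv1 hv2 hw1 hw2
  have h4 : (a * d - b * c) * (θ i v * θ' i w - θ' i v * θ i w) = 1 := by
    linear_combination hv1 * (c * θ i w + d * θ' i w) + hw2 - hw1 * (c * θ i v + d * θ' i v)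
  rw [h0, zero_mul] at h4
  exact zero_ne_one h4

end DNCoordinates

/-! ### Normalization of the brackets and Darboux–Nijenhuis charts. -/

section DNCoordinates

variable {𝕜 : Type*} [RCLike 𝕜] {E : Type*} [NormedAddCommGroup E] [NormedSpace 𝕜 E]
  {p p' : E → (E →L[𝕜] 𝕜) →L[𝕜] E} {n : ℕ} {x y : Fin n → E → 𝕜}

lemma localBracket_swap {r : E → (E →L[𝕜] 𝕜) →L[𝕜] E} {U : Set E} (hr : IsPoissonOn r U) {z : E}
    (hz : z ∈ U) (f g : E → 𝕜) : localBracket r f g z = -localBracket r g f z :=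
  hr.skew z hz _ _

lemma localBracket_of_eventually_eq_zero (r : E → (E →L[𝕜] 𝕜) →L[𝕜] E) {f g : E → 𝕜} {z : E}
    (hg : ∀ᶠ w in 𝓝 z, g w = 0) : localBracket r f g z = 0 := by
  have h : fderiv 𝕜 g z = 0 := by
    have h1 : HasFDerivAt g (0 : E →L[𝕜] 𝕜) z :=
      (hasFDerivAt_const (0 : 𝕜) z).congr_of_eventuallyEq hg
    exact h1.fderiv
  rw [localBracket, h, map_zero, map_zero]

variable [FiniteDimensional 𝕜 E]

/-- The bracket `{x_i, y_i}` is a function of `x_i` and `y_i`. -/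
lemma IsEigenSystem.fderiv_bracket (hn : Module.finrank 𝕜 E = 2 * n) {U : Set E} (hU : IsOpen U)
    (hp : IsPencilOn p p' U) (h : IsEigenSystem p p' U x y) (i : Fin n) {z : E} (hz : z ∈ U)
    {v : E} (hx : fderiv 𝕜 (x i) z v = 0) (hy : fderiv 𝕜 (y i) z v = 0) :
    fderiv 𝕜 (localBracket p (x i) (y i)) z v = 0 := by
  have hn' : Module.finrank 𝕜 (E →L[𝕜] 𝕜) = 2 * n := finrank_continuousDual.trans hn
  have hg := contDiffOn_localBracket hU hp.poisson.smooth (h.smooth_x i) (h.smooth_y i)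
  -- By the Jacobi identity, whatever commutes with `x_i` and `y_i` commutes with `{x_i, y_i}`.
  -- Applied to the other pairs, this leaves only `dx_i` and `dy_i` in its differential.
  have key : ∀ u : E → 𝕜, ContDiffOn 𝕜 ∞ u U → (∀ w ∈ U, localBracket p (x i) u w = 0) →
      (∀ w ∈ U, localBracket p (y i) u w = 0) →
      fderiv 𝕜 (localBracket p (x i) (y i)) z (p z (fderiv 𝕜 u z)) = 0 := by
    intro u hu h1 h2
    have hj := hp.poisson.jacobi U u (x i) (y i) hU subset_rfl hu (h.smooth_x i) (h.smooth_y i) z hz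
    rw [localBracket_of_eventually_eq_zero p (g := localBracket p (y i) u)
        (by filter_upwards [hU.mem_nhds hz] with w hw using h2 w hw),
      localBracket_of_eventually_eq_zero p (g := localBracket p u (x i))
        (by filter_upwards [hU.mem_nhds hz] with w hw using by
              rw [localBracket_swap hp.poisson hw, h1 w hw, neg_zero]),
      add_zero, add_zero, localBracket_swap hp.poisson hz] at hj
    exact neg_eq_zero.1 hj
  have hf := fun {w : E} (hw : w ∈ U) => h.isFrame hp hw
  obtain ⟨a, b, hab⟩ := (hf hz).eq_of_orth hn' (hp.poisson.isSkew hz)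
    (ξ := fderiv 𝕜 (localBracket p (x i) (y i)) z) (i := i) (fun j hj =>
      ⟨key (x j) (h.smooth_x j) (fun w hw => ((hf hw).orth i j hj.symm).1) (fun w hw => by
          rw [localBracket_swap hp.poisson hw]
          exact neg_eq_zero.2 ((hf hw).orth j i hj).2.1),
        key (y j) (h.smooth_y j) (fun w hw => ((hf hw).orth i j hj.symm).2.1)
          (fun w hw => ((hf hw).orth i j hj.symm).2.2)⟩)
  rw [hab]
  simp only [add_apply, smul_apply, hx, hy, smul_zero, add_zero]

/-- The second function of each pair can be changed so that `{x_i, y_i} = 1`. -/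
lemma IsEigenSystem.exists_normalized (hn : Module.finrank 𝕜 E = 2 * n) {U : Set E}
    (hU : IsOpen U) (hp : IsPencilOn p p' U) (h : IsEigenSystem p p' U x y) {z₀ : E}
    (hz₀ : z₀ ∈ U) :
    ∃ (V : Set E) (y' : Fin n → E → 𝕜), IsOpen V ∧ z₀ ∈ V ∧ V ⊆ U ∧
      IsEigenSystem p p' V x y' ∧ ∀ z ∈ V, ∀ i, localBracket p (x i) (y' i) z = 1 := by
  have hxd : ∀ i, ∀ z ∈ U, HasFDerivAt (x i) (fderiv 𝕜 (x i) z) z := fun i z hz =>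
    (((h.smooth_x i).contDiffAt (hU.mem_nhds hz)).differentiableAt (by simp)).hasFDerivAt
  have hyd : ∀ i, ∀ z ∈ U, HasFDerivAt (y i) (fderiv 𝕜 (y i) z) z := fun i z hz =>
    (((h.smooth_y i).contDiffAt (hU.mem_nhds hz)).differentiableAt (by simp)).hasFDerivAt
  let q : Fin n → E → 𝕜 × 𝕜 := fun i z => (x i z, y i z)
  have hq : ∀ i, ContDiffOn 𝕜 ∞ (q i) U := fun i => (h.smooth_x i).prodMk (h.smooth_y i)
  have hqd : ∀ i, ∀ z ∈ U, fderiv 𝕜 (q i) z = (fderiv 𝕜 (x i) z).prod (fderiv 𝕜 (y i) z) :=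
    fun i z hz => ((hxd i z hz).prodMk (hyd i z hz)).fderiv
  have hself : ∀ (f : E → 𝕜) z, z ∈ U → fderiv 𝕜 f z (p z (fderiv 𝕜 f z)) = 0 := fun f z hz =>
    (hp.poisson.isSkew hz).self_eq_zero _
  have key : ∀ i, ∃ (V : Set E) (Y : E → 𝕜), IsOpen V ∧ z₀ ∈ V ∧ V ⊆ U ∧ ContDiffOn 𝕜 ∞ Y V ∧
      ∀ z ∈ V, (∃ a b : 𝕜, fderiv 𝕜 Y z = a • fderiv 𝕜 (x i) z + b • fderiv 𝕜 (y i) z) ∧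
        localBracket p (x i) Y z = 1 := by
    intro i
    have h0 : fderiv 𝕜 (x i) z₀ (p z₀ (fderiv 𝕜 (y i) z₀)) ≠ 0 := h.pair z₀ hz₀ i
    -- With `{x_i, y_i} = G (x_i, y_i)` and `∂Y/∂y = 1/G`, the function `Y (x_i, y_i)` has bracket 1
    -- with `x_i`, the `dx_i` part of its differential being irrelevant.
    obtain ⟨W, G, hW, hqW, hG, hGq⟩ := exists_eq_comp_submersion hU (hq i)
      (contDiffOn_localBracket hU hp.poisson.smooth (h.smooth_x i) (h.smooth_y i)) hz₀ (by
        rintro ⟨a, b⟩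
        refine ⟨(a / fderiv 𝕜 (x i) z₀ (p z₀ (fderiv 𝕜 (y i) z₀))) • p z₀ (fderiv 𝕜 (y i) z₀)
          - (b / fderiv 𝕜 (x i) z₀ (p z₀ (fderiv 𝕜 (y i) z₀))) • p z₀ (fderiv 𝕜 (x i) z₀), ?_⟩
        have e1 := hp.poisson.skew z₀ hz₀ (fderiv 𝕜 (y i) z₀) (fderiv 𝕜 (x i) z₀)
        rw [hqd i z₀ hz₀]
        simp only [ContinuousLinearMap.prod_apply, map_sub, map_smul, e1, hself _ z₀ hz₀,
          Prod.smul_mk, Prod.mk_sub_mk, smul_eq_mul, mul_zero, sub_zero, zero_sub, mul_neg,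
          neg_neg]
        rw [div_mul_cancel₀ _ h0, div_mul_cancel₀ _ h0])
      (fun z hz v hv => by
        rw [hqd i z hz] at hv
        exact h.fderiv_bracket hn hU hp i hz (congrArg Prod.fst hv) (congrArg Prod.snd hv))
    have hG0 : G (q i z₀) ≠ 0 := by
      rw [← hGq.self_of_nhds.2]
      exact h0
    let W' : Set (𝕜 × 𝕜) := W ∩ G ⁻¹' {0}ᶜ
    have hW' : IsOpen W' := hG.continuousOn.isOpen_inter_preimage hW isOpen_compl_singleton
    have hGinv : ContDiffOn 𝕜 ∞ (fun s => (G s)⁻¹) W' :=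
      (hG.mono Set.inter_subset_left).inv fun s hs => hs.2
    obtain ⟨S, Y, hS, hqS, hSW, hY, hYd⟩ := exists_antiderivative hW' hGinv (b := q i z₀)
      ⟨hqW, hG0⟩
    obtain ⟨N, hN, hNo, hzN⟩ := eventually_nhds_iff.1 hGq
    have hqc := (hq i).continuousOn.isOpen_inter_preimage hU hS
    refine ⟨(U ∩ q i ⁻¹' S) ∩ N, fun z => Y (q i z), hqc.inter hNo, ⟨⟨hz₀, hqS⟩, hzN⟩,
      fun z hz => hz.1.1, hY.comp ((hq i).mono fun z hz => hz.1.1) fun z hz => hz.1.2,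
      fun z hz => ?_⟩
    have hYz : HasFDerivAt Y (fderiv 𝕜 Y (q i z)) (q i z) :=
      ((hY.contDiffAt (hS.mem_nhds hz.1.2)).differentiableAt (by simp)).hasFDerivAt
    have hYq : fderiv 𝕜 (fun z => Y (q i z)) z = fderiv 𝕜 Y (q i z) (1, 0) • fderiv 𝕜 (x i) z
        + (G (q i z))⁻¹ • fderiv 𝕜 (y i) z := by
      have h1 := HasFDerivAt.comp (g := Y) (f := q i) z hYz
        ((hxd i z hz.1.1).prodMk (hyd i z hz.1.1))
      have h2 : fderiv 𝕜 (fun z => Y (q i z)) z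
        = (fderiv 𝕜 Y (q i z)).comp ((fderiv 𝕜 (x i) z).prod (fderiv 𝕜 (y i) z)) := h1.fderiv
      rw [h2]
      ext v
      have h3 : ((fderiv 𝕜 (x i) z v, fderiv 𝕜 (y i) z v) : 𝕜 × 𝕜)
        = fderiv 𝕜 (x i) z v • (1, 0) + fderiv 𝕜 (y i) z v • (0, 1) := by simp
      rw [ContinuousLinearMap.comp_apply, ContinuousLinearMap.prod_apply, h3, map_add, map_smul,
        map_smul, hYd _ hz.1.2]
      simp only [add_apply, smul_apply, smul_eq_mul]
      ring
    refine ⟨⟨_, _, hYq⟩, ?_⟩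
    have hGz : G (q i z) = fderiv 𝕜 (x i) z (p z (fderiv 𝕜 (y i) z)) := (hN z hz.2).2.symm
    rw [localBracket, hYq, map_add, map_smul, map_smul, map_add, map_smul, map_smul,
      hself _ z hz.1.1, ← hGz, smul_zero, zero_add, smul_eq_mul, inv_mul_cancel₀]
    rw [hGz]
    exact h.pair z hz.1.1 i
  choose V Y hV hzV hVU hY hYz using key
  refine ⟨U ∩ ⋂ i, V i, Y, hU.inter (isOpen_iInter_of_finite hV), ⟨hz₀, Set.mem_iInter.2 hzV⟩,
    Set.inter_subset_left, ⟨fun i => (h.smooth_x i).mono Set.inter_subset_left,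
      fun i => (hY i).mono fun z hz => Set.mem_iInter.1 hz.2 i, fun z hz => ?_, fun z hz i => ?_⟩,
    fun z hz i => (hYz i z (Set.mem_iInter.1 hz.2 i)).2⟩
  · obtain ⟨l, hl, hxy⟩ := h.eigen z hz.1
    refine ⟨l, hl, fun i => ⟨(hxy i).1, ?_⟩⟩
    obtain ⟨a, b, hab⟩ := (hYz i z (Set.mem_iInter.1 hz.2 i)).1
    rw [hab, map_add, map_smul, map_smul, map_add, map_smul, map_smul, (hxy i).1, (hxy i).2,
      smul_add, smul_comm a, smul_comm b]
  · rw [(hYz i z (Set.mem_iInter.1 hz.2 i)).2]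
    exact one_ne_zero

/-- A normalized system of eigenfunctions defines a chart. -/
lemma IsEigenSystem.exists_chart (hn : Module.finrank 𝕜 E = 2 * n) {U : Set E}
    (hU : IsOpen U) (hp : IsPencilOn p p' U) (h : IsEigenSystem p p' U x y) {z₀ : E}
    (hz₀ : z₀ ∈ U) : ∃ φ : OpenPartialHomeomorph E ((Fin n → 𝕜) × (Fin n → 𝕜)),
      z₀ ∈ φ.source ∧ φ.source ⊆ U ∧ (∀ z, φ z = (fun i => x i z, fun i => y i z)) ∧
      ContDiffOn 𝕜 ∞ φ.symm φ.target := by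
  have _ := FiniteDimensional.complete 𝕜 E
  have hn' : Module.finrank 𝕜 (E →L[𝕜] 𝕜) = 2 * n := finrank_continuousDual.trans hn
  have hxd : ∀ i, HasFDerivAt (x i) (fderiv 𝕜 (x i) z₀) z₀ := fun i =>
    (((h.smooth_x i).contDiffAt (hU.mem_nhds hz₀)).differentiableAt (by simp)).hasFDerivAt
  have hyd : ∀ i, HasFDerivAt (y i) (fderiv 𝕜 (y i) z₀) z₀ := fun i =>
    (((h.smooth_y i).contDiffAt (hU.mem_nhds hz₀)).differentiableAt (by simp)).hasFDerivAt
  let Ξ : E → (Fin n → 𝕜) × (Fin n → 𝕜) := fun z => (fun i => x i z, fun i => y i z)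
  have hΞ : ContDiffOn 𝕜 ∞ Ξ U :=
    (contDiffOn_pi.2 h.smooth_x).prodMk (contDiffOn_pi.2 h.smooth_y)
  let Λ : E →L[𝕜] (Fin n → 𝕜) × (Fin n → 𝕜) :=
    (ContinuousLinearMap.pi fun i => fderiv 𝕜 (x i) z₀).prod
      (ContinuousLinearMap.pi fun i => fderiv 𝕜 (y i) z₀)
  have hΛ : HasFDerivAt Ξ Λ z₀ := (hasFDerivAt_pi.2 hxd).prodMk (hasFDerivAt_pi.2 hyd)
  have hinj : Function.Injective Λ := by
    refine (injective_iff_map_eq_zero Λ).2 fun v hv => ?_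
    obtain ⟨η, rfl⟩ := (hp.bijective z₀ hz₀).2 v
    have h1 : ∀ i, fderiv 𝕜 (x i) z₀ (p z₀ η) = 0 := fun i => congrFun (congrArg Prod.fst hv) i
    have h2 : ∀ i, fderiv 𝕜 (y i) z₀ (p z₀ η) = 0 := fun i => congrFun (congrArg Prod.snd hv) i
    have h3 : η = 0 := (h.isFrame hp hz₀).eq_zero_of_orth hn' (hp.poisson.isSkew hz₀) fun i => by
      rw [hp.poisson.isSkew hz₀, hp.poisson.isSkew hz₀ η]
      exact ⟨neg_eq_zero.2 (h1 i), neg_eq_zero.2 (h2 i)⟩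
    rw [h3, map_zero]
  let Λe : E ≃L[𝕜] (Fin n → 𝕜) × (Fin n → 𝕜) :=
    (LinearMap.linearEquivOfInjective (Λ : E →ₗ[𝕜] (Fin n → 𝕜) × (Fin n → 𝕜)) hinj
      (by simp [hn, two_mul])).toContinuousLinearEquiv
  have hΛe : HasFDerivAt Ξ (Λe : E →L[𝕜] (Fin n → 𝕜) × (Fin n → 𝕜)) z₀ :=
    hΛ.congr_fderiv (ContinuousLinearMap.ext fun _ => rfl)
  exact exists_openPartialHomeomorph hU hΞ hz₀ Λe hΛe

/-- Existence of Darboux-Nijenhuis coordinates. -/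
theorem exists_local_DN_coordinates (hn : Module.finrank 𝕜 E = 2 * n) {U : Set E} (hU : IsOpen U)
    (hp : IsPencilOn p p' U) {z₀ : E} (hz₀ : z₀ ∈ U) {l : Fin n → 𝕜} (hl : Function.Injective l)
    {θ : Fin n → E →L[𝕜] 𝕜} (hθ : ∀ i, p' z₀ (θ i) = l i • p z₀ (θ i)) (hθ0 : ∀ i, θ i ≠ 0) :
    ∃ (φ : OpenPartialHomeomorph E ((Fin n → 𝕜) × (Fin n → 𝕜))) (x y : Fin n → E → 𝕜),
      z₀ ∈ φ.source ∧ φ.source ⊆ U ∧ (∀ z, φ z = (fun i => x i z, fun i => y i z)) ∧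
      ContDiffOn 𝕜 ∞ φ.symm φ.target ∧ IsEigenSystem p p' φ.source x y ∧
      ∀ z ∈ φ.source, ∀ i, localBracket p (x i) (y i) z = 1 := by
  obtain ⟨V, x, y, hV, hzV, hVU, hxy⟩ := exists_eigenSystem hn hU hp hz₀ hl hθ hθ0
  obtain ⟨W, y', hW, hzW, hWV, hxy', hone⟩ :=
    hxy.exists_normalized hn hV (hp.mono hVU) hzV
  obtain ⟨φ, hzφ, hφW, hφ, hφs⟩ :=
    hxy'.exists_chart hn hW (hp.mono (hWV.trans hVU)) hzW
  exact ⟨φ, x, y', hzφ, hφW.trans (hWV.trans hVU), hφ, hφs, hxy'.mono hφW,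
    fun z hz => hone z (hφW hz)⟩

end DNCoordinates

/-! ### Separation relations and bi-involution in an eigensystem. -/

section Separation

variable {𝕜 : Type*} [RCLike 𝕜] {E : Type*} [NormedAddCommGroup E] [NormedSpace 𝕜 E]
  {p p' : E → (E →L[𝕜] 𝕜) →L[𝕜] E} {n : ℕ} {x y h : Fin n → E → 𝕜} {U : Set E}

/-- There is a non-trivial relation between the functions `u`, `w`, `h_1`, …, `h_n` at `z`. -/
def HasRelationAt (u w : E → 𝕜) (h : Fin n → E → 𝕜) (z : E) : Prop :=
  ∃ (W : Set (𝕜 × 𝕜 × (Fin n → 𝕜))) (Φ : 𝕜 × 𝕜 × (Fin n → 𝕜) → 𝕜),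
    IsOpen W ∧ (u z, w z, fun j => h j z) ∈ W ∧
    ContDiffOn 𝕜 ∞ Φ W ∧ (∀ s ∈ W, fderiv 𝕜 Φ s ≠ 0) ∧
    ∀ᶠ z' in 𝓝 z, Φ (u z', w z', fun j => h j z') = 0

/-- A relation between functions gives a linear relation between their differentials. -/
lemma HasRelationAt.exists_combination {u w : E → 𝕜} {z : E} (hr : HasRelationAt u w h z)
    (hu : DifferentiableAt 𝕜 u z) (hw : DifferentiableAt 𝕜 w z)
    (hh : ∀ i, DifferentiableAt 𝕜 (h i) z)
    (hind : LinearIndependent 𝕜 fun i => fderiv 𝕜 (h i) z) :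
    ∃ a b : 𝕜, (a ≠ 0 ∨ b ≠ 0) ∧ a • fderiv 𝕜 u z + b • fderiv 𝕜 w z
      ∈ Submodule.span 𝕜 (Set.range fun i => fderiv 𝕜 (h i) z) := by
  obtain ⟨W, Φ, hW, hzW, hΦ, hne, hev⟩ := hr
  set D := fderiv 𝕜 Φ (u z, w z, fun j => h j z) with hD
  have hΦd : HasFDerivAt Φ D (u z, w z, fun j => h j z) :=
    ((hΦ.contDiffAt (hW.mem_nhds hzW)).differentiableAt (by simp)).hasFDerivAt
  have hexp : ∀ (s t : 𝕜) (c : Fin n → 𝕜), D (s, t, c)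
      = s * D (1, 0, 0) + t * D (0, 1, 0) + ∑ j, c j * D (0, 0, Pi.single j 1) := by
    intro s t c
    have e1 : ((s, t, c) : 𝕜 × 𝕜 × (Fin n → 𝕜)) = s • (1, 0, 0) + t • (0, 1, 0)
        + ∑ j, c j • (0, 0, Pi.single j 1) := by
      have e2 : (∑ j, c j • ((0, 0, Pi.single j 1) : 𝕜 × 𝕜 × (Fin n → 𝕜))) = (0, 0, c) := by
        refine Prod.ext ?_ (Prod.ext ?_ ?_)
        · simp [Prod.fst_sum]
        · simp [Prod.fst_sum, Prod.snd_sum]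
        · rw [Prod.snd_sum, Prod.snd_sum]
          conv_rhs => rw [← Finset.univ_sum_single c]
          exact Finset.sum_congr rfl fun j _ => by simp [← Pi.single_smul]
      rw [e2]
      simp
    rw [e1, map_add, map_add, map_smul, map_smul, map_sum]
    simp only [map_smul, smul_eq_mul]
  have hcomp := HasFDerivAt.comp (g := Φ) (f := fun z => (u z, w z, fun j => h j z)) z hΦd
    (hu.hasFDerivAt.prodMk (hw.hasFDerivAt.prodMk (hasFDerivAt_pi.2 fun i => (hh i).hasFDerivAt)))
  have hzero : HasFDerivAt (Φ ∘ fun z => (u z, w z, fun j => h j z)) (0 : E →L[𝕜] 𝕜) z :=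
    (hasFDerivAt_const (0 : 𝕜) z).congr_of_eventuallyEq hev
  have hrel : ∀ v, fderiv 𝕜 u z v * D (1, 0, 0) + fderiv 𝕜 w z v * D (0, 1, 0)
      + ∑ j, fderiv 𝕜 (h j) z v * D (0, 0, Pi.single j 1) = 0 := fun v => by
    have h1 : D (fderiv 𝕜 u z v, fderiv 𝕜 w z v, fun j => fderiv 𝕜 (h j) z v) = 0 :=
      DFunLike.congr_fun (hcomp.unique hzero) v
    exact (hexp _ _ _).symm.trans h1
  refine ⟨D (1, 0, 0), D (0, 1, 0), ?_, ?_⟩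
  -- If the relation did not involve `u` and `w` to first order, independence of the `dh_j` would
  -- kill the rest of its differential.
  · by_contra! hcon
    have hc := Fintype.linearIndependent_iff.1 hind (fun j => D (0, 0, Pi.single j 1)) (by
      ext v
      have h1 := hrel v
      rw [hcon.1, hcon.2, mul_zero, mul_zero, zero_add, zero_add] at h1
      rw [sum_apply, zero_apply]
      refine Eq.trans (Finset.sum_congr rfl fun j _ => ?_) h1
      rw [smul_apply, smul_eq_mul, mul_comm])
    refine hne _ hzW (ContinuousLinearMap.ext ?_)
    rintro ⟨s, t, c⟩
    rw [← hD, hexp, hcon.1, hcon.2, zero_apply]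
    simp [hc]
  · have e : D (1, 0, 0) • fderiv 𝕜 u z + D (0, 1, 0) • fderiv 𝕜 w z
        = ∑ j, (-D (0, 0, Pi.single j 1)) • fderiv 𝕜 (h j) z := by
      ext v
      rw [sum_apply]
      simp only [add_apply, smul_apply, smul_eq_mul, neg_mul, Finset.sum_neg_distrib]
      have h1 := hrel v
      have h2 : ∑ j, D (0, 0, Pi.single j 1) * fderiv 𝕜 (h j) z v
          = ∑ j, fderiv 𝕜 (h j) z v * D (0, 0, Pi.single j 1) :=
        Finset.sum_congr rfl fun j _ => mul_comm _ _
      rw [h2]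
      linear_combination h1
    rw [e]
    exact Submodule.sum_mem _ fun j _ => Submodule.smul_mem _ _ (Submodule.subset_span ⟨j, rfl⟩)

variable [FiniteDimensional 𝕜 E]

/-- Functions separable in an eigensystem are in involution for the second bracket. -/
lemma IsEigenSystem.localBracket_eq_zero (hp : IsPencilOn p p' U) (hU : IsOpen U)
    (hxy : IsEigenSystem p p' U x y) {z : E} (hz : z ∈ U)
    (hh : ∀ i, DifferentiableAt 𝕜 (h i) z)
    (hind : LinearIndependent 𝕜 fun i => fderiv 𝕜 (h i) z)
    (hsep : ∀ i, HasRelationAt (x i) (y i) h z) (i j : Fin n) :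
    localBracket p' (h i) (h j) z = 0 := by
  choose a b hab hmem using fun i => (hsep i).exists_combination
    (((hxy.smooth_x i).contDiffAt (hU.mem_nhds hz)).differentiableAt (by simp))
    (((hxy.smooth_y i).contDiffAt (hU.mem_nhds hz)).differentiableAt (by simp)) hh hind
  obtain ⟨l, hl, hlxy⟩ := hxy.eigen z hz
  exact (hxy.isFrame hp hz).isotropic_of_combination_mem_span
    (Ω' := pairing (p' z : (E →L[𝕜] 𝕜) →ₗ[𝕜] E)) (hp.poisson.isSkew hz) (l := l)
    (fun i => isEigen_pairing.2 (hlxy i).1) (fun i => isEigen_pairing.2 (hlxy i).2) hind hab hmem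
    i j

/-- A function whose differential is a combination of those of `u` and `h_1`, …, `h_n` is a
function of `u` and `h_1`, …, `h_n`. -/
lemma exists_eq_comp_of_bracket_ne_zero (hU : IsOpen U) (hp : IsPoissonOn p U) {u w : E → 𝕜}
    (hu : ContDiffOn 𝕜 ∞ u U) (hw : ContDiffOn 𝕜 ∞ w U) (hh : ∀ i, ContDiffOn 𝕜 ∞ (h i) U)
    (hind : ∀ z ∈ U, LinearIndependent 𝕜 fun i => fderiv 𝕜 (h i) z)
    (hinv : ∀ z ∈ U, ∀ i j, localBracket p (h i) (h j) z = 0)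
    (hcomb : ∀ z ∈ U, ∃ a b : 𝕜, (a ≠ 0 ∨ b ≠ 0) ∧ a • fderiv 𝕜 u z + b • fderiv 𝕜 w z
      ∈ Submodule.span 𝕜 (Set.range fun i => fderiv 𝕜 (h i) z))
    {z₀ : E} (hz₀ : z₀ ∈ U) {j : Fin n} (hj : localBracket p u (h j) z₀ ≠ 0) :
    ∃ (W : Set (𝕜 × (Fin n → 𝕜))) (G : 𝕜 × (Fin n → 𝕜) → 𝕜), IsOpen W ∧
      (u z₀, fun i => h i z₀) ∈ W ∧ ContDiffOn 𝕜 ∞ G W ∧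
      ∀ᶠ z in 𝓝 z₀, w z = G (u z, fun i => h i z) := by
  have hbc := (contDiffOn_localBracket hU hp.smooth hu (hh j)).continuousOn
  let V := U ∩ (localBracket p u (h j)) ⁻¹' {0}ᶜ
  have hV : IsOpen V := hbc.isOpen_inter_preimage hU isOpen_compl_singleton
  have hVU : V ⊆ U := Set.inter_subset_left
  let q : E → 𝕜 × (Fin n → 𝕜) := fun z => (u z, fun i => h i z)
  have hq : ContDiffOn 𝕜 ∞ q V := (hu.mono hVU).prodMk (contDiffOn_pi.2 fun i => (hh i).mono hVU)
  have hqd : ∀ z ∈ V, ∀ v, fderiv 𝕜 q z v = (fderiv 𝕜 u z v, fun i => fderiv 𝕜 (h i) z v) := by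
    intro z hz v
    have h1 : HasFDerivAt u (fderiv 𝕜 u z) z :=
      ((hu.contDiffAt (hU.mem_nhds (hVU hz))).differentiableAt (by simp)).hasFDerivAt
    have h2 : ∀ i, HasFDerivAt (h i) (fderiv 𝕜 (h i) z) z := fun i =>
      (((hh i).contDiffAt (hU.mem_nhds (hVU hz))).differentiableAt (by simp)).hasFDerivAt
    have h3 : HasFDerivAt q _ z := h1.prodMk (hasFDerivAt_pi.2 h2)
    rw [h3.fderiv]
    rfl
  obtain ⟨W, G, hW, hqW, hG, hev⟩ := exists_eq_comp_submersion (g := w) hV hq (hw.mono hVU)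
    (z₀ := z₀) ⟨hz₀, hj⟩ (by
      rintro ⟨s, t⟩
      obtain ⟨v, hv⟩ := surjective_of_linearIndependent
        ((hind z₀ hz₀).map' (ContinuousLinearMap.coeLM 𝕜 : (E →L[𝕜] 𝕜) →ₗ[𝕜] (E →ₗ[𝕜] 𝕜))
          (LinearMap.ker_eq_bot.2 ContinuousLinearMap.coe_injective)) t
      have hv' : ∀ i, fderiv 𝕜 (h i) z₀ v = t i := fun i => congrFun hv i
      have hb : fderiv 𝕜 u z₀ (p z₀ (fderiv 𝕜 (h j) z₀)) ≠ 0 := hj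
      have hb' : ∀ i, fderiv 𝕜 (h i) z₀ (p z₀ (fderiv 𝕜 (h j) z₀)) = 0 := fun i => hinv z₀ hz₀ i j
      -- The Hamiltonian vector of `h_j` kills every `dh_i` but not `du`, so it adjusts the first
      -- component alone.
      refine ⟨v + ((s - fderiv 𝕜 u z₀ v) / fderiv 𝕜 u z₀ (p z₀ (fderiv 𝕜 (h j) z₀)))
        • p z₀ (fderiv 𝕜 (h j) z₀), ?_⟩
      rw [hqd z₀ ⟨hz₀, hj⟩]
      refine Prod.ext ?_ (funext fun i => ?_)
      · simp only [map_add, map_smul, smul_eq_mul]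
        rw [div_mul_cancel₀ _ hb]
        ring
      · simp only [map_add, map_smul, smul_eq_mul, hv', hb', mul_zero, add_zero])
    (by
      intro z hz v hv
      rw [hqd z hz] at hv
      have hv1 : fderiv 𝕜 u z v = 0 := congrArg Prod.fst hv
      have hv2 : ∀ i, fderiv 𝕜 (h i) z v = 0 := fun i => congrFun (congrArg Prod.snd hv) i
      obtain ⟨a, b, hab, hmem⟩ := hcomb z (hVU hz)
      have hspan : ∀ α ∈ Submodule.span 𝕜 (Set.range fun i => fderiv 𝕜 (h i) z),
          α v = 0 ∧ α (p z (fderiv 𝕜 (h j) z)) = 0 := by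
        intro α hα
        induction hα using Submodule.span_induction with
        | mem α hα =>
          obtain ⟨i, rfl⟩ := hα
          exact ⟨hv2 i, hinv z (hVU hz) i j⟩
        | zero => exact ⟨rfl, rfl⟩
        | add α β _ _ h1 h2 =>
          rw [add_apply, add_apply, h1.1, h1.2, h2.1, h2.2, add_zero]
          exact ⟨rfl, rfl⟩
        | smul c α _ h1 =>
          rw [smul_apply, smul_apply, h1.1, h1.2, smul_zero]
          exact ⟨rfl, rfl⟩
      obtain ⟨h1, h2⟩ := hspan _ hmem
      simp only [add_apply, smul_apply, smul_eq_mul, hv1, mul_zero, zero_add] at h1 h2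
      -- Evaluation on the same Hamiltonian vector gives `a {u, h_j} + b {w, h_j} = 0`, so `b = 0`
      -- would force `a = 0`.
      have hb : b ≠ 0 := by
        rintro rfl
        rw [zero_mul, add_zero] at h2
        exact hz.2 ((mul_eq_zero.1 h2).resolve_left (by simpa using hab))
      exact (mul_eq_zero.1 h1).resolve_left hb)
  exact ⟨W, G, hW, hqW, hG, hev.mono fun z hz => hz.2⟩

/-- Functions in involution for both brackets are separable in every eigensystem. -/
lemma IsEigenSystem.hasRelationAt (hn : Module.finrank 𝕜 E = 2 * n) (hU : IsOpen U)
    (hp : IsPencilOn p p' U) (hxy : IsEigenSystem p p' U x y)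
    (hh : ∀ i, ContDiffOn 𝕜 ∞ (h i) U)
    (hind : ∀ z ∈ U, LinearIndependent 𝕜 fun i => fderiv 𝕜 (h i) z)
    (hinv : ∀ z ∈ U, ∀ i j, localBracket p (h i) (h j) z = 0)
    (hinv' : ∀ z ∈ U, ∀ i j, localBracket p' (h i) (h j) z = 0)
    {z₀ : E} (hz₀ : z₀ ∈ U) (i : Fin n) : HasRelationAt (x i) (y i) h z₀ := by
  have hn' : Module.finrank 𝕜 (E →L[𝕜] 𝕜) = 2 * n := finrank_continuousDual.trans hn
  have hnd : ∀ z ∈ U, ∀ η, (∀ ξ, pairing (p z : (E →L[𝕜] 𝕜) →ₗ[𝕜] E) ξ η = 0) → η = 0 :=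
    fun z hz => pairing_nondegenerate (hp.bijective z hz).1
  have hcomb : ∀ z ∈ U, ∃ a b : 𝕜, (a ≠ 0 ∨ b ≠ 0) ∧
      a • fderiv 𝕜 (x i) z + b • fderiv 𝕜 (y i) z
        ∈ Submodule.span 𝕜 (Set.range fun i => fderiv 𝕜 (h i) z) := by
    intro z hz
    obtain ⟨l, hl, hlxy⟩ := hxy.eigen z hz
    exact (hxy.isFrame hp hz).exists_combination_mem_span
      (Ω' := pairing (p' z : (E →L[𝕜] 𝕜) →ₗ[𝕜] E)) hn' (hp.poisson.isSkew hz)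
      (hp.poisson'.isSkew hz) (hnd z hz) hl (fun i => isEigen_pairing.2 (hlxy i).1)
      (fun i => isEigen_pairing.2 (hlxy i).2) (hind z hz) (hinv z hz) (hinv' z hz) i
  -- If `x_i` and `y_i` both commuted with all `h_j`, their differentials would lie in the
  -- Lagrangian span and be orthogonal, against `{x_i, y_i} ≠ 0`.
  have hcases : (∃ j, localBracket p (x i) (h j) z₀ ≠ 0) ∨
      ∃ j, localBracket p (y i) (h j) z₀ ≠ 0 := by
    by_contra! hcon
    have hmem : ∀ {u : E → 𝕜}, (∀ j, localBracket p u (h j) z₀ = 0) → fderiv 𝕜 u z₀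
        ∈ Submodule.span 𝕜 (Set.range fun i => fderiv 𝕜 (h i) z₀) := fun {u} hu =>
      mem_span_of_orth hn' (hp.poisson.isSkew hz₀) (hnd z₀ hz₀) (hind z₀ hz₀) (hinv z₀ hz₀)
        fun j => by
          rw [hp.poisson.isSkew hz₀]
          exact neg_eq_zero.2 (hu j)
    have h1 := hmem hcon.1
    refine hxy.pair z₀ hz₀ i ?_
    change pairing (p z₀ : (E →L[𝕜] 𝕜) →ₗ[𝕜] E) (fderiv 𝕜 (x i) z₀) (fderiv 𝕜 (y i) z₀) = 0
    have h2 := hmem hcon.2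
    generalize fderiv 𝕜 (y i) z₀ = β at h2
    induction h2 using Submodule.span_induction with
    | mem β hβ =>
      obtain ⟨j, rfl⟩ := hβ
      exact hcon.1 j
    | zero => exact map_zero _
    | add α β _ _ h1 h2 => rw [map_add, h1, h2, add_zero]
    | smul c α _ h1 => rw [map_smul, h1, smul_zero]
  rcases hcases with ⟨j, hj⟩ | ⟨j, hj⟩
  · obtain ⟨W, G, hW, hzW, hG, hev⟩ := exists_eq_comp_of_bracket_ne_zero hU hp.poisson
      (hxy.smooth_x i) (hxy.smooth_y i) hh hind hinv hcomb hz₀ hj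
    let π : 𝕜 × 𝕜 × (Fin n → 𝕜) → 𝕜 × (Fin n → 𝕜) := fun s => (s.1, s.2.2)
    have hπ : ContDiff 𝕜 ∞ π := contDiff_fst.prodMk contDiff_snd.snd
    have hGπ : ContDiffOn 𝕜 ∞ (fun s => G (π s)) (π ⁻¹' W) := hG.comp hπ.contDiffOn fun _ h => h
    have hWo := hW.preimage hπ.continuous
    -- The relation `y_i = G (x_i, h)` is solved for `y_i`, so its derivative in that slot is 1.
    refine ⟨π ⁻¹' W, fun s => s.2.1 - G (π s), hWo, hzW,
      contDiff_snd.fst.contDiffOn.sub hGπ, fun s hs h0 => ?_, hev.mono fun z hz => ?_⟩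
    · have h1 : HasFDerivAt (fun s => G (π s)) (fderiv 𝕜 (fun s => G (π s)) s) s :=
        ((hGπ.contDiffAt (hWo.mem_nhds hs)).differentiableAt (by simp)).hasFDerivAt
      have h2 : HasFDerivAt (fun t : 𝕜 => ((s.1, t, s.2.2) : 𝕜 × 𝕜 × (Fin n → 𝕜)))
          ((0 : 𝕜 →L[𝕜] 𝕜).prod ((ContinuousLinearMap.id 𝕜 𝕜).prod 0)) s.2.1 :=
        (hasFDerivAt_const s.1 _).prodMk ((hasFDerivAt_id _).prodMk (hasFDerivAt_const s.2.2 _))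
      have h3 := HasFDerivAt.comp (g := fun s => s.2.1 - G (π s)) s.2.1
        (hasFDerivAt_snd.fst.sub h1) h2
      have h4 : HasFDerivAt (fun t : 𝕜 => t - G (s.1, s.2.2)) (ContinuousLinearMap.id 𝕜 𝕜) s.2.1 :=
        (hasFDerivAt_id _).sub_const _
      have h5 : fderiv 𝕜 (fun s => s.2.1 - G (π s)) s = _ := (hasFDerivAt_snd.fst.sub h1).fderiv
      have h6 := DFunLike.congr_fun (h3.unique h4) 1
      rw [← h5, h0] at h6
      exact zero_ne_one h6
    · exact sub_eq_zero.2 hz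
  · obtain ⟨W, G, hW, hzW, hG, hev⟩ := exists_eq_comp_of_bracket_ne_zero hU hp.poisson
      (hxy.smooth_y i) (hxy.smooth_x i) hh hind hinv (fun z hz => by
        obtain ⟨a, b, hab, hmem⟩ := hcomb z hz
        exact ⟨b, a, hab.symm, by rwa [add_comm]⟩) hz₀ hj
    let π : 𝕜 × 𝕜 × (Fin n → 𝕜) → 𝕜 × (Fin n → 𝕜) := Prod.snd
    have hπ : ContDiff 𝕜 ∞ π := contDiff_snd
    have hGπ : ContDiffOn 𝕜 ∞ (fun s => G (π s)) (π ⁻¹' W) := hG.comp hπ.contDiffOn fun _ h => h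
    have hWo := hW.preimage hπ.continuous
    refine ⟨π ⁻¹' W, fun s => s.1 - G (π s), hWo, hzW,
      contDiff_fst.contDiffOn.sub hGπ, fun s hs h0 => ?_, hev.mono fun z hz => ?_⟩
    · have h1 : HasFDerivAt (fun s => G (π s)) (fderiv 𝕜 (fun s => G (π s)) s) s :=
        ((hGπ.contDiffAt (hWo.mem_nhds hs)).differentiableAt (by simp)).hasFDerivAt
      have h2 : HasFDerivAt (fun t : 𝕜 => ((t, s.2) : 𝕜 × 𝕜 × (Fin n → 𝕜)))
          ((ContinuousLinearMap.id 𝕜 𝕜).prod 0) s.1 :=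
        (hasFDerivAt_id _).prodMk (hasFDerivAt_const s.2 _)
      have h3 := HasFDerivAt.comp (g := fun s => s.1 - G (π s)) s.1 (hasFDerivAt_fst.sub h1) h2
      have h4 : HasFDerivAt (fun t : 𝕜 => t - G s.2) (ContinuousLinearMap.id 𝕜 𝕜) s.1 :=
        (hasFDerivAt_id _).sub_const _
      have h5 : fderiv 𝕜 (fun s => s.1 - G (π s)) s = _ := (hasFDerivAt_fst.sub h1).fderiv
      have h6 := DFunLike.congr_fun (h3.unique h4) 1
      rw [← h5, h0] at h6
      exact zero_ne_one h6
    · exact sub_eq_zero.2 hz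

end Separation

/-! ### Transfer of Poisson structures to charts. -/

section Localization

variable {𝕜 : Type*} [RCLike 𝕜] {E : Type*} [NormedAddCommGroup E] [NormedSpace 𝕜 E]
  {M : Type*} [TopologicalSpace M] [ChartedSpace E M]

/-- The derivative of a map `M → E` as a map with values in `E`. -/
def tangentCoord (ψ : M → E) (m : M) : TangentSpace 𝓘(𝕜, E) m →L[𝕜] E :=
  mfderiv 𝓘(𝕜, E) 𝓘(𝕜, E) ψ m

/-- The codifferential of a map `M → E`. -/
def pullCovector (ψ : M → E) (m : M) :
    (E →L[𝕜] 𝕜) →ₗ[𝕜] (TangentSpace 𝓘(𝕜, E) m →L[𝕜] 𝕜) where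
  toFun ξ := ξ.comp (tangentCoord ψ m)
  map_add' _ _ := rfl
  map_smul' _ _ := rfl

/-- The local expression of a bivector field in a chart. -/
def localize [FiniteDimensional 𝕜 E] (P : BivectorField 𝕜 E M) (ψ : OpenPartialHomeomorph M E)
    (z : E) : (E →L[𝕜] 𝕜) →L[𝕜] E :=
  LinearMap.toContinuousLinearMap ((tangentCoord (𝕜 := 𝕜) ψ (ψ.symm z) :
    TangentSpace 𝓘(𝕜, E) (ψ.symm z) →ₗ[𝕜] E) ∘ₗ P (ψ.symm z) ∘ₗ pullCovector ψ (ψ.symm z))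

lemma dAt_congr {f g : M → 𝕜} {m : M} (h : f =ᶠ[𝓝 m] g) :
    dAt (E := E) f m = dAt (E := E) g m := h.mfderiv_eq

lemma bracket_congr (P : BivectorField 𝕜 E M) {f f' g g' : M → 𝕜} {m : M}
    (hf : f =ᶠ[𝓝 m] f') (hg : g =ᶠ[𝓝 m] g') : bracket P f g m = bracket P f' g' m := by
  rw [bracket, bracket, dAt_congr hf, dAt_congr hg]

variable {ψ : OpenPartialHomeomorph M E}

lemma contMDiffOn_comp_chart [IsManifold 𝓘(𝕜, E) ∞ M]
    (hψ : ψ ∈ IsManifold.maximalAtlas 𝓘(𝕜, E) ∞ M) {F : Type*} [NormedAddCommGroup F]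
    [NormedSpace 𝕜 F] {f : E → F} {V : Set E} (hf : ContDiffOn 𝕜 ∞ f V) :
    ContMDiffOn 𝓘(𝕜, E) 𝓘(𝕜, F) ∞ (fun m => f (ψ m)) (ψ.source ∩ ψ ⁻¹' V) :=
  hf.contMDiffOn.comp ((contMDiffOn_of_mem_maximalAtlas hψ).mono Set.inter_subset_left)
    fun _ hm => hm.2

lemma contDiffOn_comp_chart_symm [IsManifold 𝓘(𝕜, E) ∞ M]
    (hψ : ψ ∈ IsManifold.maximalAtlas 𝓘(𝕜, E) ∞ M) {F : Type*} [NormedAddCommGroup F]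
    [NormedSpace 𝕜 F] {f : M → F} {O : Set M} (hf : ContMDiffOn 𝓘(𝕜, E) 𝓘(𝕜, F) ∞ f O) :
    ContDiffOn 𝕜 ∞ (fun z => f (ψ.symm z)) (ψ.target ∩ ψ.symm ⁻¹' O) :=
  (hf.comp ((contMDiffOn_symm_of_mem_maximalAtlas hψ).mono Set.inter_subset_left)
    fun _ hm => hm.2).contDiffOn

lemma mdifferentiable_of_mem_maximalAtlas [IsManifold 𝓘(𝕜, E) ∞ M]
    (hψ : ψ ∈ IsManifold.maximalAtlas 𝓘(𝕜, E) ∞ M) :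
    ψ.MDifferentiable 𝓘(𝕜, E) 𝓘(𝕜, E) :=
  ⟨(contMDiffOn_of_mem_maximalAtlas hψ).mdifferentiableOn (by simp),
    (contMDiffOn_symm_of_mem_maximalAtlas hψ).mdifferentiableOn (by simp)⟩

lemma bijective_tangentCoord [IsManifold 𝓘(𝕜, E) ∞ M]
    (hψ : ψ ∈ IsManifold.maximalAtlas 𝓘(𝕜, E) ∞ M) {m : M} (hm : m ∈ ψ.source) :
    Function.Bijective (tangentCoord (𝕜 := 𝕜) ψ m) :=
  (mdifferentiable_of_mem_maximalAtlas hψ).mfderiv_bijective hm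

lemma injective_pullCovector [IsManifold 𝓘(𝕜, E) ∞ M]
    (hψ : ψ ∈ IsManifold.maximalAtlas 𝓘(𝕜, E) ∞ M) {m : M} (hm : m ∈ ψ.source) :
    Function.Injective (pullCovector (𝕜 := 𝕜) ψ m) := by
  intro ξ η h
  ext v
  obtain ⟨w, rfl⟩ := (bijective_tangentCoord (𝕜 := 𝕜) hψ hm).2 v
  exact DFunLike.congr_fun h w

lemma surjective_pullCovector [IsManifold 𝓘(𝕜, E) ∞ M]
    (hψ : ψ ∈ IsManifold.maximalAtlas 𝓘(𝕜, E) ∞ M) {m : M} (hm : m ∈ ψ.source) :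
    Function.Surjective (pullCovector (𝕜 := 𝕜) ψ m) := by
  intro α
  let e := (mdifferentiable_of_mem_maximalAtlas hψ).mfderiv hm
  have h : ∃ ξ : TangentSpace 𝓘(𝕜, E) (ψ m) →L[𝕜] 𝕜, ∀ v, ξ (e v) = α v :=
    ⟨α.comp (e.symm : TangentSpace 𝓘(𝕜, E) (ψ m) →L[𝕜] TangentSpace 𝓘(𝕜, E) m),
      fun v => congrArg α (e.symm_apply_apply v)⟩
  obtain ⟨ξ, hξ⟩ := h
  exact ⟨ξ, ContinuousLinearMap.ext hξ⟩

/-- The differential of the local expression of a function. -/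
lemma dAt_symm [IsManifold 𝓘(𝕜, E) ∞ M] (hψ : ψ ∈ IsManifold.maximalAtlas 𝓘(𝕜, E) ∞ M)
    {z : E} (hz : z ∈ ψ.target) {f : M → 𝕜}
    (hf : DifferentiableAt 𝕜 (fun w => f (ψ.symm w)) z) :
    dAt (E := E) f (ψ.symm z) = pullCovector ψ (ψ.symm z) (fderiv 𝕜 (fun w => f (ψ.symm w)) z) := by
  have hm := ψ.map_target hz
  have h1 : f =ᶠ[𝓝 (ψ.symm z)] (fun w => f (ψ.symm w)) ∘ ψ := by
    filter_upwards [ψ.open_source.mem_nhds hm] with m hm'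
    exact congrArg f (ψ.left_inv hm').symm
  have h2 : MDifferentiableAt 𝓘(𝕜, E) 𝓘(𝕜, 𝕜) (fun w => f (ψ.symm w)) (ψ (ψ.symm z)) := by
    rw [ψ.right_inv hz]
    exact hf.mdifferentiableAt
  have h3 := (mdifferentiable_of_mem_maximalAtlas hψ).mdifferentiableAt hm
  have h4 := mfderiv_comp (ψ.symm z) h2 h3
  rw [dAt_congr h1]
  refine Eq.trans h4 ?_
  rw [mfderiv_eq_fderiv, ψ.right_inv hz]
  rfl

variable [FiniteDimensional 𝕜 E]

lemma localize_apply (P : BivectorField 𝕜 E M) (z : E) (ξ : E →L[𝕜] 𝕜) : localize P ψ z ξ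
    = tangentCoord (𝕜 := 𝕜) ψ (ψ.symm z) (P (ψ.symm z) (pullCovector ψ (ψ.symm z) ξ)) := rfl

/-- The local expression of a bracket. -/
lemma localBracket_symm [IsManifold 𝓘(𝕜, E) ∞ M] (hψ : ψ ∈ IsManifold.maximalAtlas 𝓘(𝕜, E) ∞ M)
    (P : BivectorField 𝕜 E M) {z : E} (hz : z ∈ ψ.target) {f g : M → 𝕜}
    (hf : DifferentiableAt 𝕜 (fun w => f (ψ.symm w)) z)
    (hg : DifferentiableAt 𝕜 (fun w => g (ψ.symm w)) z) :
    localBracket (localize P ψ) (fun w => f (ψ.symm w)) (fun w => g (ψ.symm w)) z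
      = bracket P f g (ψ.symm z) := by
  rw [bracket, dAt_symm hψ hz hf, dAt_symm hψ hz hg]
  rfl

/-- The local expression of a bracket. -/
lemma localBracket_eq_bracket [IsManifold 𝓘(𝕜, E) ∞ M]
    (hψ : ψ ∈ IsManifold.maximalAtlas 𝓘(𝕜, E) ∞ M)
    (P : BivectorField 𝕜 E M) {z : E} (hz : z ∈ ψ.target) {f g : E → 𝕜}
    (hf : DifferentiableAt 𝕜 f z) (hg : DifferentiableAt 𝕜 g z) :
    localBracket (localize P ψ) f g z
      = bracket P (fun m => f (ψ m)) (fun m => g (ψ m)) (ψ.symm z) := by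
  have h : ∀ f : E → 𝕜, (fun w => f (ψ (ψ.symm w))) =ᶠ[𝓝 z] f := fun f => by
    filter_upwards [ψ.open_target.mem_nhds hz] with w hw
    rw [ψ.right_inv hw]
  rw [← localBracket_symm hψ P hz (hf.congr_of_eventuallyEq (h f))
    (hg.congr_of_eventuallyEq (h g)), localBracket, localBracket, (h f).fderiv_eq,
    (h g).fderiv_eq]

/-- The coefficients are brackets of linear functions composed with the chart. These functions are
smooth only on its source, so the smoothness axiom is needed for locally defined functions. -/
lemma contDiffOn_localize [IsManifold 𝓘(𝕜, E) ∞ M] (hψ : ψ ∈ IsManifold.maximalAtlas 𝓘(𝕜, E) ∞ M)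
    {P : BivectorField 𝕜 E M} (hP : IsPoissonTensor P) :
    ContDiffOn 𝕜 ∞ (localize P ψ) ψ.target := by
  have key : ∀ ξ η : E →L[𝕜] 𝕜, ContDiffOn 𝕜 ∞ (fun z => η (localize P ψ z ξ)) ψ.target := by
    intro ξ η
    have h1 : ∀ α : E →L[𝕜] 𝕜, ContMDiffOn 𝓘(𝕜, E) 𝓘(𝕜, 𝕜) ∞ (fun m => α (ψ m)) ψ.source :=
      fun α => by simpa using contMDiffOn_comp_chart hψ (V := Set.univ) α.contDiff.contDiffOn
    have h2 := contDiffOn_comp_chart_symm hψ (hP.smooth ψ.source _ _ ψ.open_source (h1 η) (h1 ξ))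
    refine (h2.mono fun z hz => ⟨hz, ψ.map_target hz⟩).congr fun z hz => ?_
    rw [← localBracket_eq_bracket hψ P hz η.differentiableAt ξ.differentiableAt, localBracket,
      ContinuousLinearMap.fderiv, ContinuousLinearMap.fderiv]
  refine contDiffOn_clm_apply.2 fun ξ => ?_
  let e := (Module.finBasis 𝕜 E).equivFunL
  refine e.comp_contDiffOn_iff.1 (contDiffOn_pi.2 fun i => ?_)
  exact key ξ ((ContinuousLinearMap.proj i).comp (e : E →L[𝕜] (Fin (Module.finrank 𝕜 E) → 𝕜)))

/-- The local expression of a Poisson tensor. -/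
lemma isPoissonOn_localize [IsManifold 𝓘(𝕜, E) ∞ M]
    (hψ : ψ ∈ IsManifold.maximalAtlas 𝓘(𝕜, E) ∞ M) {P : BivectorField 𝕜 E M}
    (hP : IsPoissonTensor P) : IsPoissonOn (localize P ψ) ψ.target where
  skew z _ ξ η := hP.skew (ψ.symm z) (pullCovector ψ _ ξ) (pullCovector ψ _ η)
  smooth := contDiffOn_localize hψ hP
  jacobi V f g h hV hVt hf hg hh z hz := by
    have hO : IsOpen (ψ.source ∩ ψ ⁻¹' V) := ψ.isOpen_inter_preimage hV
    have hm : ψ.symm z ∈ ψ.source ∩ ψ ⁻¹' V :=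
      ⟨ψ.map_target (hVt hz), by rw [Set.mem_preimage, ψ.right_inv (hVt hz)]; exact hz⟩
    have hd : ∀ {k : E → 𝕜}, ContDiffOn 𝕜 ∞ k V → ∀ w ∈ V, DifferentiableAt 𝕜 k w :=
      fun hk w hw => (hk.contDiffAt (hV.mem_nhds hw)).differentiableAt (by simp)
    have key : ∀ {a b c : E → 𝕜}, ContDiffOn 𝕜 ∞ a V → ContDiffOn 𝕜 ∞ b V → ContDiffOn 𝕜 ∞ c V →
        localBracket (localize P ψ) a (localBracket (localize P ψ) b c) z =
          bracket P (fun m => a (ψ m)) (bracket P (fun m => b (ψ m)) (fun m => c (ψ m)))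
            (ψ.symm z) := by
      intro a b c ha hb hc
      have hbc := contDiffOn_localBracket hV ((contDiffOn_localize hψ hP).mono hVt) hb hc
      rw [localBracket_eq_bracket hψ P (hVt hz) (hd ha z hz) (hd hbc z hz)]
      refine bracket_congr P Filter.EventuallyEq.rfl ?_
      filter_upwards [hO.mem_nhds hm] with m hm'
      rw [localBracket_eq_bracket hψ P (ψ.map_source hm'.1) (hd hb _ hm'.2) (hd hc _ hm'.2),
        ψ.left_inv hm'.1]
    rw [key hf hg hh, key hg hh hf, key hh hf hg]
    exact hP.jacobi _ _ _ _ hO (contMDiffOn_comp_chart hψ hf) (contMDiffOn_comp_chart hψ hg)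
      (contMDiffOn_comp_chart hψ hh) _ hm

end Localization

/-! ### Eigencovectors at regular points. -/

section Regular

variable {𝕜 : Type*} [RCLike 𝕜] {E : Type*} [NormedAddCommGroup E] [NormedSpace 𝕜 E]
  {M : Type*} [TopologicalSpace M] [ChartedSpace E M]
  {n : ℕ} {P P' : BivectorField 𝕜 E M}

lemma isPoissonTensor_snd (h : IsBihamiltonian P P') : IsPoissonTensor P' := by
  have h0 := h.pencil 0
  have e : (fun m => P' m - (0 : 𝕜) • P m) = P' := by
    funext m
    rw [zero_smul, sub_zero]
  rwa [e] at h0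

lemma nijenhuis_apply {m : M} (h : Function.Bijective (P m))
    (α : TangentSpace 𝓘(𝕜, E) m →L[𝕜] 𝕜) : nijenhuis P P' m (P m α) = P' m α := by
  rw [nijenhuis, dif_pos h]
  exact congrArg (P' m) ((LinearEquiv.ofBijective (P m) h).symm_apply_apply α)

lemma tangent_eq_zero {m : M} {v : TangentSpace 𝓘(𝕜, E) m}
    (h : ∀ α : TangentSpace 𝓘(𝕜, E) m →L[𝕜] 𝕜, α v = 0) : v = 0 :=
  SeparatingDual.eq_zero_of_forall_dual_eq_zero (R := 𝕜) (V := E) h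

/-- Every `v` is some `P β`, and `N (P β) = P' β`; skewness moves both tensors from `β` to `α`. This
translates the diagonal form of `N` into the pencil equation. -/
lemma eigencovector_iff (h : IsBihamiltonian P P') {m : M} (hP : Function.Bijective (P m))
    {α : TangentSpace 𝓘(𝕜, E) m →L[𝕜] 𝕜} {l : 𝕜} :
    (∀ v, α (nijenhuis P P' m v) = l * α v) ↔ P' m α = l • P m α := by
  constructor
  · intro hα
    refine sub_eq_zero.1 (tangent_eq_zero fun β => ?_)
    have h1 := hα (P m β)
    rw [nijenhuis_apply hP, (isPoissonTensor_snd h).skew, h.poisson.skew m α] at h1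
    rw [map_sub, map_smul, smul_eq_mul]
    linear_combination -h1
  · intro hα v
    obtain ⟨β, rfl⟩ := hP.2 v
    rw [nijenhuis_apply hP, (isPoissonTensor_snd h).skew, hα, map_smul, h.poisson.skew m α, smul_eq_mul]
    ring

/-- `P` carries eigencovectors of the pencil to eigenvectors of `N`. -/
lemma isRegularPoint_iff {m : M} (hP : Function.Bijective (P m)) :
    IsRegularPoint n P P' m ↔ ∃ l : Fin n → 𝕜, Function.Injective l ∧
      ∃ θ : Fin n → TangentSpace 𝓘(𝕜, E) m →L[𝕜] 𝕜, ∀ i, θ i ≠ 0 ∧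
        P' m (θ i) = l i • P m (θ i) := by
  refine exists_congr fun l => and_congr_right fun _ => ?_
  constructor
  · intro h
    choose v hv using fun i => (h i).exists_hasEigenvector
    choose θ hθ using fun i => hP.2 (v i)
    refine ⟨θ, fun i => ⟨fun h0 => (hv i).2 ?_, ?_⟩⟩
    · rw [← hθ, h0, map_zero]
    · rw [← nijenhuis_apply (P' := P') hP, hθ]
      exact (hv i).apply_eq_smul
  · rintro ⟨θ, hθ⟩ i
    refine Module.End.hasEigenvalue_of_hasEigenvector (x := P m (θ i))
      ⟨Module.End.mem_eigenspace_iff.2 ?_, fun h0 => (hθ i).1 (hP.1 (by rw [h0, map_zero]))⟩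
    rw [nijenhuis_apply hP, (hθ i).2]

end Regular

/-- Relations between functions on `M` can be tested in a chart. -/
lemma hasRelationAt_symm_iff {𝕜 : Type*} [RCLike 𝕜] {E : Type*} [NormedAddCommGroup E]
    {M : Type*} [TopologicalSpace M] {n : ℕ} {ψ : OpenPartialHomeomorph M E} {m : M} (hm : m ∈ ψ.source) (u w : M → 𝕜) (H : Fin n → M → 𝕜) :
    HasRelationAt (fun z => u (ψ.symm z)) (fun z => w (ψ.symm z)) (fun i z => H i (ψ.symm z)) (ψ m)
      ↔ ∃ (W : Set (𝕜 × 𝕜 × (Fin n → 𝕜))) (Φ : 𝕜 × 𝕜 × (Fin n → 𝕜) → 𝕜),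
      IsOpen W ∧ (u m, w m, fun j => H j m) ∈ W ∧
      ContDiffOn 𝕜 ∞ Φ W ∧ (∀ z ∈ W, fderiv 𝕜 Φ z ≠ 0) ∧
      ∀ᶠ m' in 𝓝 m, Φ (u m', w m', fun j => H j m') = 0 := by
  refine exists_congr fun W => exists_congr fun Φ => and_congr_right fun _ => ?_
  beta_reduce
  rw [ψ.left_inv hm]
  refine and_congr_right fun _ => and_congr_right fun _ => and_congr_right fun _ => ?_
  constructor
  · intro h
    filter_upwards [(ψ.continuousAt hm).eventually h, ψ.open_source.mem_nhds hm] with m' h1 h2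
    rwa [ψ.left_inv h2] at h1
  · intro h
    have hc := ψ.symm.continuousAt (x := ψ m) (ψ.map_source hm)
    rw [ContinuousAt, ψ.left_inv hm] at hc
    exact hc.eventually h

/-- Separability can be tested in the charts of the manifold. -/
lemma isSeparableIn_iff_hasRelationAt {𝕜 : Type*} [RCLike 𝕜] {E : Type*} [NormedAddCommGroup E]
    {M : Type*} [TopologicalSpace M] [ChartedSpace E M] {n : ℕ}
    {φ : OpenPartialHomeomorph M ((Fin n → 𝕜) × (Fin n → 𝕜))} {H : Fin n → M → 𝕜} : IsSeparableIn φ H ↔ ∀ m ∈ φ.source, ∀ i,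
    HasRelationAt (fun z => xCoord φ i ((chartAt E m).symm z))
      (fun z => yCoord φ i ((chartAt E m).symm z)) (fun i z => H i ((chartAt E m).symm z))
      (chartAt E m m) :=
  forall_congr' fun m => forall_congr' fun _ => forall_congr' fun _ =>
    (hasRelationAt_symm_iff (mem_chart_source E m) _ _ _).symm

/-! ### Darboux–Nijenhuis charts and separability on the manifold. -/

section Manifold

variable {𝕜 : Type*} [RCLike 𝕜] {E : Type*} [NormedAddCommGroup E] [NormedSpace 𝕜 E]
  {M : Type*} [TopologicalSpace M] [ChartedSpace E M] {n : ℕ} {P P' : BivectorField 𝕜 E M}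
  {ψ : OpenPartialHomeomorph M E} {φ : OpenPartialHomeomorph M ((Fin n → 𝕜) × (Fin n → 𝕜))}
  {H : Fin n → M → 𝕜}

lemma contMDiffOn_xCoord (hφ : ContMDiffOn 𝓘(𝕜, E) 𝓘(𝕜, (Fin n → 𝕜) × (Fin n → 𝕜)) ∞ φ φ.source)
    (i : Fin n) : ContMDiffOn 𝓘(𝕜, E) 𝓘(𝕜, 𝕜) ∞ (xCoord φ i) φ.source :=
  (((ContinuousLinearMap.proj i).comp (ContinuousLinearMap.fst 𝕜 (Fin n → 𝕜) (Fin n → 𝕜)) :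
    (Fin n → 𝕜) × (Fin n → 𝕜) →L[𝕜] 𝕜).contMDiff.contMDiffOn (s := Set.univ)).comp hφ
    fun _ _ => trivial

lemma contMDiffOn_yCoord (hφ : ContMDiffOn 𝓘(𝕜, E) 𝓘(𝕜, (Fin n → 𝕜) × (Fin n → 𝕜)) ∞ φ φ.source)
    (i : Fin n) : ContMDiffOn 𝓘(𝕜, E) 𝓘(𝕜, 𝕜) ∞ (yCoord φ i) φ.source :=
  (((ContinuousLinearMap.proj i).comp (ContinuousLinearMap.snd 𝕜 (Fin n → 𝕜) (Fin n → 𝕜)) :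
    (Fin n → 𝕜) × (Fin n → 𝕜) →L[𝕜] 𝕜).contMDiff.contMDiffOn (s := Set.univ)).comp hφ
    fun _ _ => trivial

/-- Involution at the regular points implies involution everywhere. -/
lemma bracket_eq_zero_of_regular (hreg : IsRegularBihamiltonian n P P')
    (hH : IsIntegrableSystem P H) {i j : Fin n}
    (h : ∀ m, IsRegularPoint n P P' m → bracket P' (H i) (H j) m = 0) (m : M) :
    bracket P' (H i) (H j) m = 0 := by
  have hs := (isPoissonTensor_snd hreg.bihamiltonian).smooth Set.univ (H i) (H j) isOpen_univ
    (hH.smooth i).contMDiffOn (hH.smooth j).contMDiffOn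
  have hc : Continuous (bracket P' (H i) (H j)) := continuousOn_univ.1 hs.continuousOn
  exact congrFun (hc.ext_on hreg.regular continuous_const fun m hm => h m hm) m

/-- Only elementwise conditions on covectors remain, which is the form treated on a plain vector
space by `isotropic_iff_lagrangian`. -/
lemma isLagrangianSubspace_leafTangent_iff (m : M) :
    IsLagrangianSubspace P (leafTangent (E := E) H m) ↔
      ∀ v, (∃ α : TangentSpace 𝓘(𝕜, E) m →L[𝕜] 𝕜,
        (∀ w, (∀ i, dAt (E := E) (H i) m w = 0) → α w = 0) ∧ P m α = v) ↔
        (∀ i, dAt (E := E) (H i) m v = 0) ∧ ∃ ξ, P m ξ = v := by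
  have hmem : ∀ v, v ∈ leafTangent (E := E) H m ↔ ∀ i, dAt (E := E) (H i) m v = 0 := fun v => by
    rw [leafTangent, Submodule.mem_iInf]
    rfl
  have hann : ∀ α, α ∈ annihilator (leafTangent (E := E) H m) ↔
      ∀ w, (∀ i, dAt (E := E) (H i) m w = 0) → α w = 0 := fun α =>
    forall_congr' fun w => by rw [hmem]
  rw [IsLagrangianSubspace, SetLike.ext_iff]
  refine forall_congr' fun v => ?_
  rw [Submodule.mem_map, Submodule.mem_inf, hmem, LinearMap.mem_range]
  simp only [hann]

variable [IsManifold 𝓘(𝕜, E) ∞ M]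

/-- The local expression of an integrable system. -/
lemma linearIndependent_symm (hψ : ψ ∈ IsManifold.maximalAtlas 𝓘(𝕜, E) ∞ M)
    (hH : IsIntegrableSystem P H) {z : E} (hz : z ∈ ψ.target) :
    LinearIndependent 𝕜 fun i => fderiv 𝕜 (fun w => H i (ψ.symm w)) z := by
  refine LinearIndependent.of_comp (pullCovector ψ (ψ.symm z)) ?_
  have h1 : ∀ i, ContDiffOn 𝕜 ∞ (fun w => H i (ψ.symm w)) ψ.target := fun i => by
    simpa using contDiffOn_comp_chart_symm hψ (hH.smooth i).contMDiffOn (O := Set.univ)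
  have e : (pullCovector ψ (ψ.symm z)) ∘ (fun i => fderiv 𝕜 (fun w => H i (ψ.symm w)) z)
      = fun i => dAt (E := E) (H i) (ψ.symm z) := funext fun i =>
    (dAt_symm hψ hz (((h1 i).contDiffAt (ψ.open_target.mem_nhds hz)).differentiableAt
      (by simp))).symm
  rw [e]
  exact hH.independent _

variable [FiniteDimensional 𝕜 E]

lemma isPencilOn_localize (hψ : ψ ∈ IsManifold.maximalAtlas 𝓘(𝕜, E) ∞ M)
    (h : IsBihamiltonian P P') (hP : ∀ m, Function.Bijective (P m)) :
    IsPencilOn (localize P ψ) (localize P' ψ) ψ.target where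
  poisson := isPoissonOn_localize hψ h.poisson
  poisson' := isPoissonOn_localize hψ (isPoissonTensor_snd h)
  pencil c := by
    have e : (fun z => localize P' ψ z - c • localize P ψ z)
        = localize (fun m => P' m - c • P m) ψ := by
      funext z
      refine ContinuousLinearMap.ext fun ξ => ?_
      rw [sub_apply, smul_apply, localize_apply, localize_apply, localize_apply, ← map_smul,
        ← map_sub]
      rfl
    rw [e]
    exact isPoissonOn_localize hψ (h.pencil c)
  bijective z hz := by
    have hm := ψ.map_target hz
    exact (bijective_tangentCoord hψ hm).comp ((hP (ψ.symm z)).comp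
      ⟨injective_pullCovector hψ hm, surjective_pullCovector hψ hm⟩)

lemma localize_eigen (hψ : ψ ∈ IsManifold.maximalAtlas 𝓘(𝕜, E) ∞ M) {z : E} (hz : z ∈ ψ.target)
    {ξ : E →L[𝕜] 𝕜} {l : 𝕜} : localize P' ψ z ξ = l • localize P ψ z ξ ↔
      P' (ψ.symm z) (pullCovector ψ (ψ.symm z) ξ)
        = l • P (ψ.symm z) (pullCovector ψ (ψ.symm z) ξ) := by
  rw [localize_apply, localize_apply, ← map_smul]
  exact (bijective_tangentCoord hψ (ψ.map_target hz)).1.eq_iff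

/-- Darboux-Nijenhuis coordinates form an eigensystem in every chart of the manifold. -/
lemma isEigenSystem_of_isDNChart (hψ : ψ ∈ IsManifold.maximalAtlas 𝓘(𝕜, E) ∞ M)
    (h : IsBihamiltonian P P') (hP : ∀ m, Function.Bijective (P m)) (hφ : IsDNChart P P' φ) :
    IsEigenSystem (localize P ψ) (localize P' ψ) (ψ.target ∩ ψ.symm ⁻¹' φ.source)
      (fun i z => xCoord φ i (ψ.symm z)) (fun i z => yCoord φ i (ψ.symm z)) := by
  have hx := fun i => contDiffOn_comp_chart_symm hψ (contMDiffOn_xCoord hφ.smooth i)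
  have hy := fun i => contDiffOn_comp_chart_symm hψ (contMDiffOn_yCoord hφ.smooth i)
  have hO : IsOpen (ψ.target ∩ ψ.symm ⁻¹' φ.source) :=
    ψ.symm.isOpen_inter_preimage φ.open_source
  have hd : ∀ {f : E → 𝕜}, ContDiffOn 𝕜 ∞ f (ψ.target ∩ ψ.symm ⁻¹' φ.source) →
      ∀ z ∈ ψ.target ∩ ψ.symm ⁻¹' φ.source, DifferentiableAt 𝕜 f z :=
    fun hf z hz => (hf.contDiffAt (hO.mem_nhds hz)).differentiableAt (by simp)
  refine ⟨hx, hy, fun z hz => ?_, fun z hz i => ?_⟩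
  · obtain ⟨l, hl, hlv⟩ := hφ.diagonal _ hz.2
    refine ⟨l, hl, fun i => ⟨?_, ?_⟩⟩
    · rw [localize_eigen hψ hz.1, ← dAt_symm hψ hz.1 (hd (hx i) z hz)]
      exact (eigencovector_iff h (hP _)).1 fun v => (hlv i v).1
    · rw [localize_eigen hψ hz.1, ← dAt_symm hψ hz.1 (hd (hy i) z hz)]
      exact (eigencovector_iff h (hP _)).1 fun v => (hlv i v).2
  · rw [localBracket_symm hψ P hz.1 (hd (hx i) z hz) (hd (hy i) z hz),
      hφ.darboux_xy _ hz.2, if_pos rfl]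
    exact one_ne_zero

/-- Every regular point lies in the domain of Darboux-Nijenhuis coordinates. -/
theorem exists_isDNChart (hreg : IsRegularBihamiltonian n P P') {m : M}
    (hm : IsRegularPoint n P P' m) :
    ∃ φ : OpenPartialHomeomorph M ((Fin n → 𝕜) × (Fin n → 𝕜)),
      m ∈ φ.source ∧ IsDNChart P P' φ := by
  let ψ := chartAt E m
  have hψ : ψ ∈ IsManifold.maximalAtlas 𝓘(𝕜, E) ∞ M := IsManifold.chart_mem_maximalAtlas m
  have hmψ : m ∈ ψ.source := mem_chart_source E m
  have hzt : ψ m ∈ ψ.target := ψ.map_source hmψ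
  have hB := hreg.bihamiltonian
  have hP := hreg.invertible
  have hpen := isPencilOn_localize hψ hB hP
  rw [← ψ.left_inv hmψ] at hm
  obtain ⟨l, hl, θ, hθ⟩ := (isRegularPoint_iff (hP _)).1 hm
  choose ξ hξ using fun i => surjective_pullCovector hψ (ψ.map_target hzt) (θ i)
  obtain ⟨φ, x, y, hzφ, hφt, hφ, hφs, hsys, hone⟩ := exists_local_DN_coordinates hreg.finrank_eq
    ψ.open_target hpen hzt hl (θ := ξ)
    (fun i => by
      rw [localize_eigen hψ hzt, hξ]
      exact (hθ i).2)
    (fun i h0 => (hθ i).1 (by rw [← hξ, h0, map_zero]))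
  have hsrc : (ψ.trans φ).source = ψ.source ∩ ψ ⁻¹' φ.source := ψ.trans_source φ
  have hpen' := hpen.mono hφt
  have hxc : ∀ i, xCoord (ψ.trans φ) i = fun m => x i (ψ m) := fun i => by
    funext m
    change (φ (ψ m)).1 i = _
    rw [hφ]
  have hyc : ∀ i, yCoord (ψ.trans φ) i = fun m => y i (ψ m) := fun i => by
    funext m
    change (φ (ψ m)).2 i = _
    rw [hφ]
  have hxd : ∀ i, ∀ z ∈ φ.source, DifferentiableAt 𝕜 (x i) z := fun i z hz =>
    ((hsys.smooth_x i).contDiffAt (φ.open_source.mem_nhds hz)).differentiableAt (by simp)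
  have hyd : ∀ i, ∀ z ∈ φ.source, DifferentiableAt 𝕜 (y i) z := fun i z hz =>
    ((hsys.smooth_y i).contDiffAt (φ.open_source.mem_nhds hz)).differentiableAt (by simp)
  have hbr : ∀ {f g : E → 𝕜} {m : M}, m ∈ (ψ.trans φ).source → DifferentiableAt 𝕜 f (ψ m) →
      DifferentiableAt 𝕜 g (ψ m) → bracket P (fun m => f (ψ m)) (fun m => g (ψ m)) m
        = localBracket (localize P ψ) f g (ψ m) := by
    intro f g m hm hf hg
    rw [hsrc] at hm
    rw [localBracket_eq_bracket hψ P (ψ.map_source hm.1) hf hg, ψ.left_inv hm.1]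
  have hfr := fun {m : M} (hm : m ∈ (ψ.trans φ).source) =>
    hsys.isFrame hpen' (z := ψ m) (by rw [hsrc] at hm; exact hm.2)
  have hmem : ∀ {m : M}, m ∈ (ψ.trans φ).source → m ∈ ψ.source ∧ ψ m ∈ φ.source :=
    fun {m} hm => by rwa [hsrc] at hm
  have hself : ∀ {m : M} (hm : m ∈ (ψ.trans φ).source) (f : E → 𝕜),
      localBracket (localize P ψ) f f (ψ m) = 0 := fun {m} hm f =>
    (hpen'.poisson.isSkew (hmem hm).2).self_eq_zero _
  refine ⟨ψ.trans φ, by rw [hsrc]; exact ⟨hmψ, hzφ⟩, ?_, ?_, ?_, ?_, ?_, ?_⟩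
  · have h1 : ContDiffOn 𝕜 ∞ φ φ.source :=
      ((contDiffOn_pi.2 hsys.smooth_x).prodMk (contDiffOn_pi.2 hsys.smooth_y)).congr
        fun z _ => hφ z
    rw [hsrc]
    exact contMDiffOn_comp_chart hψ h1
  · have h1 := (contMDiffOn_symm_of_mem_maximalAtlas hψ).comp
      (hφs.contMDiffOn) (t := ψ.target) (s := φ.target) fun z hz => hφt (φ.map_target hz)
    exact h1.mono fun z hz => by
      rw [OpenPartialHomeomorph.trans_target] at hz
      exact hz.1
  · intro m hm i j
    obtain ⟨h1, h2⟩ := hmem hm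
    rw [hxc, hyc, hbr hm (hxd i _ h2) (hyd j _ h2)]
    by_cases hij : i = j
    · subst hij
      rw [if_pos rfl, hone _ h2]
    · rw [if_neg hij]
      exact ((hfr hm).orth i j hij).2.1
  · intro m hm i j
    obtain ⟨h1, h2⟩ := hmem hm
    rw [hxc, hxc, hbr hm (hxd i _ h2) (hxd j _ h2)]
    by_cases hij : i = j
    · subst hij
      exact hself hm _
    · exact ((hfr hm).orth i j hij).1
  · intro m hm i j
    obtain ⟨h1, h2⟩ := hmem hm
    rw [hyc, hyc, hbr hm (hyd i _ h2) (hyd j _ h2)]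
    by_cases hij : i = j
    · subst hij
      exact hself hm _
    · exact ((hfr hm).orth i j hij).2.2
  · intro m hm
    obtain ⟨h1, h2⟩ := hmem hm
    obtain ⟨L, hL, hLxy⟩ := hsys.eigen _ h2
    refine ⟨L, hL, fun i v => ?_⟩
    have key : ∀ {f : E → 𝕜}, DifferentiableAt 𝕜 f (ψ m) → localize P' ψ (ψ m) (fderiv 𝕜 f (ψ m))
        = L i • localize P ψ (ψ m) (fderiv 𝕜 f (ψ m)) →
        ∀ v, dAt (E := E) (fun m => f (ψ m)) m (nijenhuis P P' m v)
          = L i * dAt (fun m => f (ψ m)) m v := by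
      intro f hf he
      have hzm := ψ.map_source h1
      have hfe : (fun w => f (ψ (ψ.symm w))) =ᶠ[𝓝 (ψ m)] f := by
        filter_upwards [ψ.open_target.mem_nhds hzm] with w hw
        rw [ψ.right_inv hw]
      rw [localize_eigen hψ hzm, ← hfe.fderiv_eq,
        ← dAt_symm hψ hzm (f := fun m => f (ψ m)) (hf.congr_of_eventuallyEq hfe),
        ψ.left_inv h1] at he
      exact (eigencovector_iff hB (hP m)).2 he
    rw [hxc, hyc]
    exact ⟨key (hxd i _ h2) (hLxy i).1 v, key (hyd i _ h2) (hLxy i).2 v⟩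

/-- Separability in Darboux-Nijenhuis coordinates is the same as involution for the second
bracket. -/
theorem isSeparableIn_iff_involution (hreg : IsRegularBihamiltonian n P P')
    (hH : IsIntegrableSystem P H) (hφ : IsDNChart P P' φ) :
    IsSeparableIn φ H ↔ ∀ m ∈ φ.source, ∀ i j, bracket P' (H i) (H j) m = 0 := by
  rw [isSeparableIn_iff_hasRelationAt (E := E)]
  have hB := hreg.bihamiltonian
  have hP := hreg.invertible
  have hloc : ∀ {ψ : OpenPartialHomeomorph M E}, ψ ∈ IsManifold.maximalAtlas 𝓘(𝕜, E) ∞ M →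
      ∀ i, ContDiffOn 𝕜 ∞ (fun w => H i (ψ.symm w)) ψ.target := fun hψ i => by
    simpa using contDiffOn_comp_chart_symm hψ (hH.smooth i).contMDiffOn (O := Set.univ)
  refine ⟨fun hsep m hm i j => ?_, fun hinv m hm i => ?_⟩ <;>
    set ψ := chartAt E m <;>
    have hψ : ψ ∈ IsManifold.maximalAtlas 𝓘(𝕜, E) ∞ M := IsManifold.chart_mem_maximalAtlas m <;>
    have hmψ : m ∈ ψ.source := mem_chart_source E m <;>
    have hO : IsOpen (ψ.target ∩ ψ.symm ⁻¹' φ.source) :=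
      ψ.symm.isOpen_inter_preimage φ.open_source <;>
    have hz : ψ m ∈ ψ.target ∩ ψ.symm ⁻¹' φ.source :=
      ⟨ψ.map_source hmψ, by rwa [Set.mem_preimage, ψ.left_inv hmψ]⟩ <;>
    have hpen := (isPencilOn_localize hψ hB hP).mono
      (Set.inter_subset_left (t := ψ.symm ⁻¹' φ.source)) <;>
    have hsys := isEigenSystem_of_isDNChart hψ hB hP hφ <;>
    have hd : ∀ z ∈ ψ.target, ∀ i, DifferentiableAt 𝕜 (fun w => H i (ψ.symm w)) z := fun z hz i =>
      ((hloc hψ i).contDiffAt (ψ.open_target.mem_nhds hz)).differentiableAt (by simp)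
  · have h1 := hsys.localBracket_eq_zero hpen hO hz (hd _ hz.1)
      (linearIndependent_symm hψ hH hz.1) (hsep m hm) i j
    rwa [localBracket_symm hψ P' hz.1 (hd _ hz.1 i) (hd _ hz.1 j), ψ.left_inv hmψ] at h1
  · refine hsys.hasRelationAt hreg.finrank_eq hO hpen
      (fun i => (hloc hψ i).mono Set.inter_subset_left)
      (fun z hz => linearIndependent_symm hψ hH hz.1) (fun z hz i j => ?_) (fun z hz i j => ?_) hz i
    · rw [localBracket_symm hψ P hz.1 (hd _ hz.1 i) (hd _ hz.1 j)]
      exact hH.involution i j _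
    · rw [localBracket_symm hψ P' hz.1 (hd _ hz.1 i) (hd _ hz.1 j)]
      exact hinv _ hz.2 i j

end Manifold

/-! ### The bilagrangian condition. -/

section Lagrangian

variable {𝕜 : Type*} [RCLike 𝕜] {E : Type*} [NormedAddCommGroup E] [NormedSpace 𝕜 E]
  [FiniteDimensional 𝕜 E] {n : ℕ}

/-- For an isotropic system of covectors, biisotropy is the bilagrangian property of the common
kernel. -/
lemma isotropic_iff_lagrangian (hn : Module.finrank 𝕜 E = 2 * n)
    {A A' : (E →L[𝕜] 𝕜) →ₗ[𝕜] E} (hA : Function.Bijective A)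
    (hs : ∀ ξ η : E →L[𝕜] 𝕜, ξ (A η) = -η (A ξ)) (hs' : ∀ ξ η : E →L[𝕜] 𝕜, ξ (A' η) = -η (A' ξ))
    {l : Fin n → 𝕜} (hl : Function.Injective l) {θ : Fin n → E →L[𝕜] 𝕜}
    (hθ : ∀ i, θ i ≠ 0 ∧ A' (θ i) = l i • A (θ i)) {h : Fin n → E →L[𝕜] 𝕜}
    (hind : LinearIndependent 𝕜 h) (hiso : ∀ i j, h i (A (h j)) = 0) :
    (∀ i j, h i (A' (h j)) = 0) ↔
      (∀ v, (∃ α : E →L[𝕜] 𝕜, (∀ w, (∀ i, h i w = 0) → α w = 0) ∧ A α = v) ↔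
        (∀ i, h i v = 0) ∧ ∃ ξ, A ξ = v) ∧
      (∀ v, (∃ α : E →L[𝕜] 𝕜, (∀ w, (∀ i, h i w = 0) → α w = 0) ∧ A' α = v) ↔
        (∀ i, h i v = 0) ∧ ∃ ξ, A' ξ = v) := by
  have hn' : Module.finrank 𝕜 (E →L[𝕜] 𝕜) = 2 * n := finrank_continuousDual.trans hn
  have hΩ : IsSkew (pairing A) := hs
  have hΩ' : IsSkew (pairing A') := hs'
  have hnd := pairing_nondegenerate hA.1
  -- By isotropy the vectors `A (h j)` lie in the common kernel, so `α` is orthogonal to the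
  -- Lagrangian span of the `h j`.
  have hspan : ∀ α : E →L[𝕜] 𝕜, (∀ w, (∀ i, h i w = 0) → α w = 0) →
      α ∈ Submodule.span 𝕜 (Set.range h) := fun α hα =>
    mem_span_of_orth hn' hΩ hnd hind hiso fun i => by
      rw [hΩ]
      exact neg_eq_zero.2 (hα _ fun j => hiso j i)
  have hspan' : ∀ α ∈ Submodule.span 𝕜 (Set.range h), ∀ w, (∀ i, h i w = 0) → α w = 0 := by
    intro α hα w hw
    induction hα using Submodule.span_induction with
    | mem α hα =>
      obtain ⟨i, rfl⟩ := hα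
      exact hw i
    | zero => rfl
    | add α β _ _ h1 h2 => rw [add_apply, h1, h2, add_zero]
    | smul c α _ h1 => rw [smul_apply, h1, smul_zero]
  have himg : ∀ {B : (E →L[𝕜] 𝕜) →ₗ[𝕜] E}, (∀ i j, h i (B (h j)) = 0) →
      ∀ α ∈ Submodule.span 𝕜 (Set.range h), ∀ i, h i (B α) = 0 := by
    intro B hB α hα i
    induction hα using Submodule.span_induction with
    | mem α hα =>
      obtain ⟨j, rfl⟩ := hα
      exact hB i j
    | zero => rw [map_zero, map_zero]
    | add α β _ _ h1 h2 => rw [map_add, map_add, h1, h2, add_zero]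
    | smul c α _ h1 => rw [map_smul, map_smul, h1, smul_zero]
  constructor
  · intro hiso'
    have hθe : ∀ i, IsEigen (pairing A) (pairing A') (l i) (θ i) := fun i =>
      isEigen_pairing.2 (hθ i).2
    obtain ⟨θ', hθ', hne⟩ := exists_hyperbolic_partner hn' hΩ hΩ' hnd hl hθe fun i => (hθ i).1
    have hframe := IsFrame.of_eigen hΩ hΩ' hl hθe hθ' hne
    refine ⟨fun v => ⟨?_, ?_⟩, fun v => ⟨?_, ?_⟩⟩
    · rintro ⟨α, hα, rfl⟩
      exact ⟨himg hiso α (hspan α hα), α, rfl⟩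
    · rintro ⟨hv, ξ, rfl⟩
      exact ⟨ξ, hspan' ξ (mem_span_of_orth hn' hΩ hnd hind hiso hv), rfl⟩
    · rintro ⟨α, hα, rfl⟩
      exact ⟨himg hiso' α (hspan α hα), α, rfl⟩
    · rintro ⟨hv, ξ, rfl⟩
      -- `A'` may be degenerate, so `ξ` itself need not annihilate the kernel; it is corrected by an
      -- element of the kernel of `A'`.
      obtain ⟨η, hη, hηξ⟩ := hframe.exists_mem_span_congr hn' hΩ hnd hθe hθ' hind hiso hiso' hv
      refine ⟨η, hspan' η hη, sub_eq_zero.1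
        (SeparatingDual.eq_zero_of_forall_dual_eq_zero (R := 𝕜) fun ζ => ?_)⟩
      rw [map_sub]
      exact sub_eq_zero.2 (hηξ ζ)
  -- Only the inclusion `A' (D°) ⊆ D` enters, applied to `h j ∈ D°`.
  · rintro ⟨-, h2⟩ i j
    exact ((h2 _).1 ⟨h j, fun w hw => hw j, rfl⟩).1 i

variable {M : Type*} [TopologicalSpace M] [ChartedSpace E M] {P P' : BivectorField 𝕜 E M}
  {H : Fin n → M → 𝕜}

/-- At a regular point, the leaf is bilagrangian if and only if the system is in involution for
the second bracket. -/
theorem involution_iff_isLagrangianSubspace (hreg : IsRegularBihamiltonian n P P')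
    (hH : IsIntegrableSystem P H) {m : M} (hm : IsRegularPoint n P P' m) :
    (∀ i j, bracket P' (H i) (H j) m = 0) ↔
      IsLagrangianSubspace P (leafTangent (E := E) H m) ∧
      IsLagrangianSubspace P' (leafTangent (E := E) H m) := by
  obtain ⟨l, hl, θ, hθ⟩ := (isRegularPoint_iff (hreg.invertible m)).1 hm
  rw [isLagrangianSubspace_leafTangent_iff, isLagrangianSubspace_leafTangent_iff]
  exact isotropic_iff_lagrangian (E := E) hreg.finrank_eq (hreg.invertible m)
    (hreg.bihamiltonian.poisson.skew m) ((isPoissonTensor_snd hreg.bihamiltonian).skew m) hl hθ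
    (hH.independent m) (fun i j => hH.involution i j m)

end Lagrangian

end BihamDN

end

/-! ### The equivalences, each through involution for the second bracket. -/

theorem theorem3p2 {𝕜 : Type*} [RCLike 𝕜]
    {E : Type*} [NormedAddCommGroup E] [NormedSpace 𝕜 E] [FiniteDimensional 𝕜 E]
    {M : Type*} [TopologicalSpace M] [ChartedSpace E M] [IsManifold 𝓘(𝕜, E) ∞ M]
    (n : ℕ) (P P' : BivectorField 𝕜 E M) (hreg : IsRegularBihamiltonian n P P')
    (H : Fin n → M → 𝕜) (hH : IsIntegrableSystem P H) :
    -- separability in some Darboux-Nijenhuis coordinates around every regular point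
    ((∀ m, IsRegularPoint n P P' m →
        ∃ φ : OpenPartialHomeomorph M ((Fin n → 𝕜) × (Fin n → 𝕜)),
          m ∈ φ.source ∧ IsDNChart P P' φ ∧ IsSeparableIn φ H) ↔
      ∀ i j m, bracket P' (H i) (H j) m = 0) ∧
    -- separability in all Darboux-Nijenhuis coordinates
    ((∀ φ : OpenPartialHomeomorph M ((Fin n → 𝕜) × (Fin n → 𝕜)),
        IsDNChart P P' φ → IsSeparableIn φ H) ↔
      ∀ i j m, bracket P' (H i) (H j) m = 0) ∧
    -- the foliation by the level sets of the Hamiltonians is bilagrangian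
    (IsBilagrangian P P' H ↔ ∀ i j m, bracket P' (H i) (H j) m = 0) := by
  refine ⟨⟨fun h i j m => ?_, fun h m hm => ?_⟩, ⟨fun h i j m => ?_, fun h φ hφ => ?_⟩,
    fun h i j m => ?_, fun h m hm => ?_⟩
  · refine BihamDN.bracket_eq_zero_of_regular hreg hH (fun m hm => ?_) m
    obtain ⟨φ, hmφ, hφ, hsep⟩ := h m hm
    exact (BihamDN.isSeparableIn_iff_involution hreg hH hφ).1 hsep m hmφ i j
  · obtain ⟨φ, hmφ, hφ⟩ := BihamDN.exists_isDNChart hreg hm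
    exact ⟨φ, hmφ, hφ, (BihamDN.isSeparableIn_iff_involution hreg hH hφ).2 fun m _ i j => h i j m⟩
  · refine BihamDN.bracket_eq_zero_of_regular hreg hH (fun m hm => ?_) m
    -- Existence of DN coordinates around `m` keeps the hypothesis on all DN charts from being
    -- vacuous there.
    obtain ⟨φ, hmφ, hφ⟩ := BihamDN.exists_isDNChart hreg hm
    exact (BihamDN.isSeparableIn_iff_involution hreg hH hφ).1 (h φ hφ) m hmφ i j
  · exact (BihamDN.isSeparableIn_iff_involution hreg hH hφ).2 fun m _ i j => h i j m
  · refine BihamDN.bracket_eq_zero_of_regular hreg hH (fun m hm => ?_) m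
    exact (BihamDN.involution_iff_isLagrangianSubspace hreg hH hm).2 (h m hm) i j
  · exact (BihamDN.involution_iff_isLagrangianSubspace hreg hH hm).1 fun i j => h i j m
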